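/- Let $d\in\mathbb N$, $T>0$, $\mathbb T^d=\mathbb R^d/\mathbb Z^d$ and assume the following. (H1) $f:\mathbb T^d\times[0,\infty)\to\mathbb R$ is continuous, strictly increasing in its second variable, $f(x,0)=0$ for all $x$, and there are $q>1$, $C>0$ with $\frac1C m^{q-1}-C\le f(x,m)\le C m^{q-1}+C$ for all $x\in\mathbb T^d$, $m\ge 0$. (H2) $H:\mathbb T^d\times\mathbb R^d\to\mathbb R$ is continuous, convex and differentiable in its second variable, with $D_pH$ continuous in both variables, and there are $r>1$, $C>0$ with $\frac1{rC}|\xi|^r-C\le H(x,\xi)\le\frac Cr|\xi|^r+C$ for all $(x,\xi)\in\mathbb T^d\times\mathbb R^d$. (H3) There are $\theta\in[0,\frac r{d+1})$ and $C>0$ with $|H(x,\xi)-H(y,\xi)|\le C|x-y|\,(\max\{|\xi|,1\})^\theta$ for all $x,y\in\mathbb T^d$, $\xi\in\mathbb R^d$, where $|x-y|$ is the flat distance on $\mathbb T^d$. (H4) $\phi_T:\mathbb T^d\to\mathbb R$ is of class $C^1$; $m_0:\mathbb T^d\to\mathbb R$ is continuous, $m_0\ge0$, $\int_{\mathbb T^d}m_0\,dx=1$.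 Let $F(x,m)=\int_0^m f(x,\tau)\,d\tau$ for $m\ge0$ and $F(x,m)=+\infty$ for $m<0$; let $F^*(x,\cdot)$ and $H^*(x,\cdot)$ be the Fenchel conjugates of $F(x,\cdot)$ and $H(x,\cdot)$, and let $r'=\frac r{r-1}$. Let $\mathcal K_0$ be the set of $\phi\in C^1([0,T]\times\mathbb T^d)$ with $\phi(T,\cdot)=\phi_T$, and $$\mathcal A(\phi)=\int_0^T\!\!\int_{\mathbb T^d}F^*\big(x,-\partial_t\phi(t,x)+H(x,D\phi(t,x))\big)\,dx\,dt-\int_{\mathbb T^d}\phi(0,x)\,m_0(x)\,dx .$$ Let $\mathcal K_1$ be the set of pairs $(m,w)\in L^1((0,T)\times\mathbb T^d)\times L^1((0,T)\times\mathbb T^d,\mathbb R^d)$ such that $m\ge0$ a.e., $\int_{\mathbb T^d}m(t,x)\,dx=1$ for a.e. $t\in(0,T)$, and $\partial_tm+\operatorname{div}w=0$ in $(0,T)\times\mathbb T^d$, $m(0)=m_0$, in the sense of distributions, i.e. $\int_0^T\!\int_{\mathbb T^d}(m\,\partial_t\psi+\langle w,D\psi\rangle)\,dx\,dt+\int_{\mathbb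 T^d}\psi(0,x)m_0(x)\,dx=0$ for every smooth $\psi$ with compact support in $[0,T)\times\mathbb T^d$. On $\mathcal K_1$ let $$\mathcal B(m,w)=\int_0^T\!\!\int_{\mathbb T^d}\Big(m\,H^*\big(x,-\tfrac wm\big)+F(x,m)\Big)\,dx\,dt+\int_{\mathbb T^d}\phi_T\,dm(T)\ \in\ \mathbb R\cup\{+\infty\},$$ where, if $m(t,x)=0$, the term $mH^*(x,-\frac wm)$ is $0$ if $w=0$ and $+\infty$ if $w\ne0$, and where $m(T)$ is the value at $t=T$ of the weakly continuous representative of $m$, that is, of the continuous map from $[0,T]$ to the Borel probability measures on $\mathbb T^d$ (with weak convergence) that equals $m(t,\cdot)\,dx$ for a.e. $t$. Then $\mathcal B$ attains its minimum over $\mathcal K_1$, the minimum is finite, and $$\inf_{\phi\in\mathcal K_0}\mathcal A(\phi)=-\min_{(m,w)\in\mathcal K_1}\mathcal B(m,w).$$ Moreover, the minimum is attained at a unique pair $(m,w)\in\mathcal K_1$ (up to equality a.e.), and this pair satisfies $m\in L^q((0,T)\times\mathbb T^d)$ and $w\in L^{\frac{r'q}{r'+q-1}}((0,T)\times\mathbb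 T^d,\mathbb R^d)$. -/

import Mathlib

open MeasureTheory Set

noncomputable section

namespace MeanField

/-- The flat torus `ℝ^d / ℤ^d`, with its normalized Haar (Lebesgue) measure `volume`. -/
abbrev Torus (d : ℕ) : Type := UnitAddTorus (Fin d)

/-- `ℝ^d` with the Euclidean norm and scalar product. -/
abbrev Vec (d : ℕ) : Type := EuclideanSpace ℝ (Fin d)

/-- The canonical projection `ℝ^d → ℝ^d / ℤ^d`. -/
def toTorus {d : ℕ} (y : Vec d) : Torus d := fun i => ((y i : ℝ) : UnitAddCircle)

/-- The gradient `Dg(x) ∈ ℝ^d` at the point `x` of a function `g` on the torus. -/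
def torusGrad {d : ℕ} (g : Torus d → ℝ) (x : Torus d) : Vec d :=
  gradient (fun v : Vec d => g (x + toTorus v)) 0

/-- The Lebesgue measure on `(0,T) × 𝕋^d`. -/
def cyl (d : ℕ) (T : ℝ) : Measure (ℝ × Torus d) :=
  (volume.restrict (Ioo 0 T)).prod volume

/-- The integral in `[-∞, +∞]` of an extended real valued function: the integral of the positive
part minus the integral of the negative part. -/
def eintegral {Ω : Type*} [MeasurableSpace Ω] (μ : Measure Ω) (g : Ω → EReal) : EReal :=
  ((∫⁻ z, (g z).toENNReal ∂μ : ENNReal) : EReal) - ((∫⁻ z, (-g z).toENNReal ∂μ : ENNReal) : EReal)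

/-- The Fenchel conjugate `g^*(p) = sup_ξ (⟨p, ξ⟩ - g(ξ))`. -/
def fenchelConj {V : Type*} [NormedAddCommGroup V] [InnerProductSpace ℝ V]
    (g : V → EReal) (p : V) : EReal :=
  ⨆ ξ : V, ((inner ℝ p ξ : ℝ) : EReal) - g ξ

/-- The condition on the coupling `f : 𝕋^d × [0,∞) → ℝ` (the values of `f x m` for `m < 0` play no
role): continuity, strict monotonicity in `m`, growth of order `q - 1`, and `f(x,0) = 0`. -/
structure CouplingCondition {d : ℕ} (f : Torus d → ℝ → ℝ) (q : ℝ) : Prop where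
  one_lt : 1 < q
  continuousOn : ContinuousOn (fun z : Torus d × ℝ => f z.1 z.2) (univ ×ˢ Ici 0)
  strictMonoOn : ∀ x, StrictMonoOn (f x) (Ici 0)
  growth : ∃ C : ℝ, 0 < C ∧ ∀ x, ∀ m : ℝ, 0 ≤ m →
    1 / C * m ^ (q - 1) - C ≤ f x m ∧ f x m ≤ C * m ^ (q - 1) + C
  map_zero : ∀ x, f x 0 = 0

/-- The condition on the Hamiltonian `H : 𝕋^d × ℝ^d → ℝ`: continuity, convexity and `C¹` regularity
in the second variable, superlinear growth of order `r > 1`. -/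
structure HamiltonianCondition {d : ℕ} (H : Torus d → Vec d → ℝ) (r : ℝ) : Prop where
  one_lt : 1 < r
  continuous : Continuous (fun z : Torus d × Vec d => H z.1 z.2)
  convexOn : ∀ x, ConvexOn ℝ univ (H x)
  differentiable : ∀ x, Differentiable ℝ (H x)
  continuous_gradient : Continuous (fun z : Torus d × Vec d => gradient (H z.1) z.2)
  growth : ∃ C : ℝ, 0 < C ∧ ∀ x ξ,
    1 / (r * C) * ‖ξ‖ ^ r - C ≤ H x ξ ∧ H x ξ ≤ C / r * ‖ξ‖ ^ r + C

/-- The condition on the dependence of the Hamiltonian on `x`. Points of the torus are represented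
by points of `ℝ^d`. -/
def HamiltonianSpaceRegularity {d : ℕ} (H : Torus d → Vec d → ℝ) (r : ℝ) : Prop :=
  ∃ θ C : ℝ, 0 ≤ θ ∧ θ < r / (d + 1) ∧ 0 < C ∧ ∀ x y ξ : Vec d,
    |H (toTorus x) ξ - H (toTorus y) ξ| ≤ C * ‖x - y‖ * (max ‖ξ‖ 1) ^ θ

/-- The conditions on the initial density `m₀` and on the terminal cost `φ_T`. -/
structure DataCondition {d : ℕ} (m₀ φT : Torus d → ℝ) : Prop where
  terminal_contDiff : ContDiff ℝ 1 (fun y : Vec d => φT (toTorus y))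
  initial_continuous : Continuous m₀
  initial_nonneg : ∀ x, 0 ≤ m₀ x
  initial_mass : ∫ x, m₀ x = 1

/-- `F(x,m) = ∫_0^m f(x,τ) dτ` for `m ≥ 0` and `F(x,m) = +∞` for `m < 0`. -/
def primitive {d : ℕ} (f : Torus d → ℝ → ℝ) (x : Torus d) (m : ℝ) : EReal :=
  if 0 ≤ m then ((∫ τ in (0 : ℝ)..m, f x τ : ℝ) : EReal) else ⊤

/-- The Fenchel conjugate `F^*(x,a)` of `F` with respect to its second variable. -/
def primitiveConj {d : ℕ} (f : Torus d → ℝ → ℝ) (x : Torus d) (a : ℝ) : EReal :=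
  fenchelConj (primitive f x) a

/-- The Fenchel conjugate `H^*(x,p)` of `H` with respect to its second variable. -/
def hamConj {d : ℕ} (H : Torus d → Vec d → ℝ) (x : Torus d) (p : Vec d) : EReal :=
  fenchelConj (fun ξ => ((H x ξ : ℝ) : EReal)) p

/-- The set of `C¹` maps `φ` on `[0,T] × 𝕋^d` with `φ(T,·) = φ_T`. Values of `φ` at times outside
`[0,T]` play no role. -/
def K0 {d : ℕ} (T : ℝ) (φT : Torus d → ℝ) : Set (ℝ → Torus d → ℝ) :=
  {φ | ContDiffOn ℝ 1 (fun z : ℝ × Vec d => φ z.1 (toTorus z.2)) (Icc 0 T ×ˢ univ) ∧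
    ∀ x, φ T x = φT x}

/-- `A(φ) = ∫_0^T ∫ F^*(x, -∂_t φ + H(x, Dφ)) dx dt - ∫ φ(0,x) m₀(x) dx`. -/
def A {d : ℕ} (T : ℝ) (f : Torus d → ℝ → ℝ) (H : Torus d → Vec d → ℝ) (m₀ : Torus d → ℝ)
    (φ : ℝ → Torus d → ℝ) : EReal :=
  eintegral (cyl d T) (fun z => primitiveConj f z.2
      (-deriv (fun s => φ s z.2) z.1 + H z.2 (torusGrad (φ z.1) z.2)))
    - ((∫ x, φ 0 x * m₀ x : ℝ) : EReal)

/-- Smooth test functions with compact support in `[0,T) × 𝕋^d`. -/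
def IsTest {d : ℕ} (T : ℝ) (ψ : ℝ → Torus d → ℝ) : Prop :=
  ContDiff ℝ (⊤ : ℕ∞) (fun z : ℝ × Vec d => ψ z.1 (toTorus z.2)) ∧
    ∃ t₁ < T, ∀ t, t₁ ≤ t → ∀ x, ψ t x = 0

/-- `∂_t m + div w = 0` in `(0,T) × 𝕋^d`, `m(0) = m₀`, in the sense of distributions. -/
def ContinuityEquation {d : ℕ} (T : ℝ) (m₀ : Torus d → ℝ)
    (m : ℝ × Torus d → ℝ) (w : ℝ × Torus d → Vec d) : Prop :=
  ∀ ψ : ℝ → Torus d → ℝ, IsTest T ψ →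
    ∫ z, (m z * deriv (fun s => ψ s z.2) z.1 + inner ℝ (w z) (torusGrad (ψ z.1) z.2)) ∂(cyl d T)
      + ∫ x, ψ 0 x * m₀ x = 0

/-- The admissible pairs `(m,w)` for the control of the continuity equation. -/
structure K1 {d : ℕ} (T : ℝ) (m₀ : Torus d → ℝ)
    (m : ℝ × Torus d → ℝ) (w : ℝ × Torus d → Vec d) : Prop where
  integrable_density : Integrable m (cyl d T)
  integrable_flux : Integrable w (cyl d T)
  nonneg : ∀ᵐ z ∂(cyl d T), 0 ≤ m z
  mass : ∀ᵐ t ∂(volume.restrict (Ioo 0 T)), ∫ x, m (t, x) = 1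
  continuity : ContinuityEquation T m₀ m w

/-- `μ` is a representative of `m` that is continuous from `[0,T]` to the space of Borel probability
measures on the torus with the weak topology. -/
def IsContinuousRep {d : ℕ} (T : ℝ) (m : ℝ × Torus d → ℝ)
    (μ : ℝ → ProbabilityMeasure (Torus d)) : Prop :=
  ContinuousOn μ (Icc 0 T) ∧ ∀ᵐ t ∂(volume.restrict (Ioo 0 T)),
    (μ t : Measure (Torus d)) = volume.withDensity (fun x => ENNReal.ofReal (m (t, x)))

open Classical in
/-- `∫ φ_T dm(T)`, where `m(T)` is the value at `T` of the continuous representative of `m`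
(for `0 < T` this value does not depend on the representative). By convention it is `+∞` if there
is no such representative. -/
def terminalCost {d : ℕ} (T : ℝ) (φT : Torus d → ℝ) (m : ℝ × Torus d → ℝ) : EReal :=
  if h : ∃ μ, IsContinuousRep T m μ then
    ((∫ x, φT x ∂((h.choose T : ProbabilityMeasure (Torus d)) : Measure (Torus d)) : ℝ) : EReal)
  else ⊤

open Classical in
/-- The quantity `m H^*(x, -w/m)`, which is `0` if `m = 0` and `w = 0`, and `+∞` if `m = 0` and
`w ≠ 0`. -/
def kinetic {d : ℕ} (H : Torus d → Vec d → ℝ) (x : Torus d) (m : ℝ) (w : Vec d) : EReal :=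
  if m = 0 then (if w = 0 then 0 else ⊤) else (m : EReal) * hamConj H x (-(m⁻¹ • w))

/-- `B(m,w) = ∫_0^T ∫ (m H^*(x, -w/m) + F(x,m)) dx dt + ∫ φ_T dm(T)`. -/
def B {d : ℕ} (T : ℝ) (f : Torus d → ℝ → ℝ) (H : Torus d → Vec d → ℝ) (φT : Torus d → ℝ)
    (m : ℝ × Torus d → ℝ) (w : ℝ × Torus d → Vec d) : EReal :=
  eintegral (cyl d T) (fun z => kinetic H z.2 (m z) (w z) + primitive f z.2 (m z))
    + terminalCost T φT m

end MeanField

end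

/-!
The proof is Fenchel-Rockafellar duality for the convex functional
`G(y) = ∫ F^*(x, -a + H(x,b))` of `y = (a,b) = (∂_t φ, Dφ)`, carried out on the vector space of
bounded measurable functions with no topology on it.

*Energy density.* For `m ≥ 0` the density `m H^*(x,-w/m) + F(x,m)` is the supremum of the affine
functions `minorant` of `(m,w)`, and a countable family of parameters suffices (`isLUB_minorant`).
In the variables `(a,b)` these minorants are `-(m a + ⟨w,b⟩) - F^*(x, -a + H(x,b))`
(`minorant_eq`).

*Continuity equation.* An admissible pair satisfies the equation for all test functions of class `C¹`
on `[0,T] × 𝕋^d` that vanish at `T` (`K1.equation_of_C1`), by mollification with powers of a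
trigonometric polynomial. The moments of `m(t)` against the Fourier monomials are primitives of flux
moments; by compactness of the space of probability measures this gives the weakly continuous
representative, and the terminal cost is `∫ φ_T m₀ + ∫∫ ⟨w, Dφ_T⟩` (`K1.terminalCost_eq`), an affine
function of `w`. With the minorants, this gives the inequality `-A ≤ B` (`neg_A_le_B`).

*Existence.* Let `α` be the infimum of `A`. The Hahn-Banach theorem
(`exists_linearMap_le_of_convexOn`) yields a linear functional `ρ` on bounded functions that has the
values prescribed by the equation on the pairs `(∂_t ψ, Dψ)` with `ψ(T) = 0`, and that lies below `G`
up to constants. Since `G` is finite on bounded functions, `ρ` is small on functions of bounded size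
with support of small measure, hence it is countably additive, and by the Radon-Nikodym theorem it is
the pairing with integrable functions `-(m,w)` (`exists_integrable_of_functional`). There is no
singular part. Inserting measurable selections of parameters into `ρ ≤ G` shows that the supremum of
the minorants has an integral of at most `-α` minus the terminal cost
(`exists_integrable_isLUB_of_selection`): the pair is admissible and `B(m,w) ≤ -α`.

*Uniqueness and integrability.* At the midpoint of two minimizers the energy density is the mean of
the two densities almost everywhere. Strict monotonicity of `f` identifies the densities, and, as `H`
is differentiable, a point where the supremum in `H^*` is attained determines `w / m`
(`eq_of_energy_midpoint`). Finally `F(x,m)` controls `m ^ q`, and testing the energy density in the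
direction `-|w|^{s-2} w` controls `|w| ^ s` by Young's inequality, for `s = r'q / (r' + q - 1)`.
-/

noncomputable section

namespace MeanField

/-! ### Hahn-Banach separation for a convex function and a subspace -/

/-- An algebraic form of Fenchel-Rockafellar duality, with no topology on `X`. If `α` is a lower
bound of `G (x₀ + y) - l` over the pairs `(y, l)` of a subspace `R`, then some linear `ρ` that takes
the value `l` at `y` for all these pairs satisfies `α + ρ ≤ G (x₀ + ·)`. It is obtained by extending
the zero functional below the sublinear function
`N x = inf {(G (x₀ + t x + y) - l - α) / t | t > 0, (y, l) ∈ R}`. -/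
theorem exists_linearMap_le_of_convexOn {X : Type*} [AddCommGroup X] [Module ℝ X] {G : X → ℝ}
    (hG : ConvexOn ℝ univ G) (x₀ : X) (R : Submodule ℝ (X × ℝ)) {α : ℝ}
    (h : ∀ p ∈ R, α ≤ G (x₀ + p.1) - p.2) :
    ∃ ρ : X →ₗ[ℝ] ℝ, (∀ p ∈ R, ρ p.1 = p.2) ∧ ∀ x, α + ρ x ≤ G (x₀ + x) := by
  let S : X → Set ℝ := fun x =>
    {v | ∃ t : ℝ, 0 < t ∧ ∃ p ∈ R, v = (G (x₀ + t • x + p.1) - p.2 - α) / t}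
  let N : X → ℝ := fun x => sInf (S x)
  have hne : ∀ x, (S x).Nonempty := fun x => ⟨_, 1, one_pos, 0, R.zero_mem, rfl⟩
  have key : ∀ (x y z : X) (a b : ℝ), 0 ≤ a → 0 ≤ b → a + b = 1 → z = a • x + b • y →
      G z ≤ a * G x + b * G y := by
    intro x y z a b ha hb hab hz
    rw [hz]; exact hG.2 (mem_univ _) (mem_univ _) ha hb hab
  have hlb : ∀ x, ∀ v ∈ S x, α - G (x₀ - x) ≤ v := by
    rintro x v ⟨t, ht, p, hp, rfl⟩
    have h1 := h _ (R.smul_mem (1 / (1 + t)) hp)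
    have h2 := key (x₀ + t • x + p.1) (x₀ - x) (x₀ + ((1 / (1 + t)) • p).1) (1 / (1 + t))
      (t / (1 + t)) (by positivity) (by positivity) (by field_simp) (by
        have : x₀ = (1 / (1 + t)) • x₀ + (t / (1 + t)) • x₀ := by
          rw [← add_smul, show 1 / (1 + t) + t / (1 + t) = 1 by field_simp, one_smul]
        conv_lhs => rw [this]
        simp only [Prod.smul_fst]
        module)
    simp only [Prod.smul_snd, smul_eq_mul] at h1
    rw [le_div_iff₀ ht]
    have h3 : α + 1 / (1 + t) * p.2 ≤ 1 / (1 + t) * G (x₀ + t • x + p.1)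
        + t / (1 + t) * G (x₀ - x) := by linarith
    have h4 := mul_le_mul_of_nonneg_left h3 (show 0 ≤ 1 + t by positivity)
    have e1 : (1 + t) * (α + 1 / (1 + t) * p.2) = (1 + t) * α + p.2 := by field_simp
    have e2 : (1 + t) * (1 / (1 + t) * G (x₀ + t • x + p.1) + t / (1 + t) * G (x₀ - x))
        = G (x₀ + t • x + p.1) + t * G (x₀ - x) := by field_simp
    rw [e1, e2] at h4
    linarith
  have hbdd : ∀ x, BddBelow (S x) := fun x => ⟨_, hlb x⟩
  have hmem : ∀ x (t : ℝ) (p : X × ℝ), 0 < t → p ∈ R →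
      N x ≤ (G (x₀ + t • x + p.1) - p.2 - α) / t :=
    fun x t p ht hp => csInf_le (hbdd x) ⟨t, ht, p, hp, rfl⟩
  -- `N` is positively homogeneous: rescale `t`
  have hhom : ∀ c : ℝ, 0 < c → ∀ x, N (c • x) ≤ c * N x := by
    intro c hc x
    rw [mul_comm, ← div_le_iff₀ hc]
    refine le_csInf (hne x) ?_
    rintro v ⟨t, ht, p, hp, rfl⟩
    have := hmem (c • x) (t / c) p (by positivity) hp
    rw [smul_smul, div_mul_cancel₀ _ hc.ne'] at this
    rw [div_le_iff₀ hc]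
    refine this.trans (le_of_eq ?_)
    field_simp
  obtain ⟨ρ, -, hρ⟩ := exists_extension_of_le_sublinear (⊥ : X →ₗ.[ℝ] ℝ) N (by
      intro c hc x
      refine le_antisymm (hhom c hc x) ?_
      have := hhom c⁻¹ (inv_pos.2 hc) (c • x)
      rw [smul_smul, inv_mul_cancel₀ hc.ne', one_smul] at this
      rwa [inv_mul_eq_div, le_div_iff₀ hc, mul_comm] at this)
    (by
      intro x y
      have : N (x + y) - N y ≤ N x := by
        refine le_csInf (hne x) ?_
        rintro v ⟨t, ht, p, hp, rfl⟩
        rw [sub_le_iff_le_add, ← sub_le_iff_le_add']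
        refine le_csInf (hne y) ?_
        rintro v ⟨s, hs, p', hp', rfl⟩
        rw [sub_le_iff_le_add']
        -- the step of `x + y` for which a convex combination of the two competitors is admissible
        have h1 := hmem (x + y) (t * s / (s + t))
          ((s / (s + t)) • p + (t / (s + t)) • p') (by positivity)
          (R.add_mem (R.smul_mem _ hp) (R.smul_mem _ hp'))
        have h2 := key (x₀ + t • x + p.1) (x₀ + s • y + p'.1)
          (x₀ + (t * s / (s + t)) • (x + y) + ((s / (s + t)) • p + (t / (s + t)) • p').1)
          (s / (s + t)) (t / (s + t)) (by positivity) (by positivity) (by field_simp) (by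
            have : x₀ = (s / (s + t)) • x₀ + (t / (s + t)) • x₀ := by
              rw [← add_smul, show s / (s + t) + t / (s + t) = 1 by field_simp, one_smul]
            conv_lhs => rw [this]
            simp only [Prod.fst_add, Prod.smul_fst]
            have e : t * s / (s + t) = (s / (s + t)) * t := by ring
            have e' : t * s / (s + t) = (t / (s + t)) * s := by ring
            rw [smul_add (t * s / (s + t))]
            conv_lhs => rw [e]
            simp only [smul_add, smul_smul]
            rw [show s / (s + t) * t = t / (s + t) * s by ring]
            abel)
        simp only [Prod.snd_add, Prod.smul_snd, smul_eq_mul] at h1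
        refine h1.trans ?_
        rw [div_le_iff₀ (by positivity)]
        have e : ((G (x₀ + t • x + p.1) - p.2 - α) / t + (G (x₀ + s • y + p'.1) - p'.2 - α) / s)
            * (t * s / (s + t)) = s / (s + t) * G (x₀ + t • x + p.1)
            + t / (s + t) * G (x₀ + s • y + p'.1) - (s / (s + t) * p.2 + t / (s + t) * p'.2) - α := by
          field_simp; ring
        rw [e]
        linarith
      linarith)
    (by
      rintro ⟨x, hx⟩
      have hx0 : x = 0 := (Submodule.mem_bot ℝ).1 hx
      subst hx0
      have : ((⊥ : X →ₗ.[ℝ] ℝ) ⟨0, hx⟩) = 0 := map_zero _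
      rw [this]
      refine le_csInf (hne 0) ?_
      rintro v ⟨t, ht, p, hp, rfl⟩
      have := h p hp
      rw [smul_zero, add_zero]
      exact div_nonneg (by linarith) ht.le)
  have hle : ∀ x, ∀ p ∈ R, ρ x ≤ G (x₀ + x + p.1) - p.2 - α := by
    intro x p hp
    have := (hρ x).trans (hmem x 1 p one_pos hp)
    simpa using this
  have hone : ∀ p ∈ R, p.2 ≤ ρ p.1 := by
    intro p hp
    by_contra! hlt
    -- on the line spanned by `(y, l)` the linear function `n (l - ρ y)` would be bounded above
    obtain ⟨n, hn⟩ := exists_nat_gt ((G x₀ - α) / (p.2 - ρ p.1))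
    have h1 := hle (-((n : ℝ) • p.1)) _ (R.smul_mem (n : ℝ) hp)
    simp only [map_neg, map_smul, Prod.smul_fst, Prod.smul_snd, smul_eq_mul,
      neg_add_cancel_right] at h1
    rw [div_lt_iff₀ (by linarith)] at hn
    nlinarith
  refine ⟨ρ, fun p hp => le_antisymm ?_ (hone p hp), fun x => ?_⟩
  · have := hone _ (R.neg_mem hp)
    simp only [Prod.snd_neg, Prod.fst_neg, map_neg] at this
    linarith
  · have := hle x 0 R.zero_mem
    simp at this
    linarith

/-! ### Functionals on bounded functions which are absolutely continuous -/

/-- The vector space of essentially bounded measurable functions. The elements are functions, not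
classes of functions up to equality almost everywhere. -/
def boundedFun {Ω : Type*} [MeasurableSpace Ω] (μ : Measure Ω) (V : Type*) [NormedAddCommGroup V]
    [NormedSpace ℝ V] : Submodule ℝ (Ω → V) where
  carrier := {f | MemLp f ⊤ μ}
  add_mem' := fun hf hg => hf.add hg
  zero_mem' := MemLp.zero
  smul_mem' := fun c _ hf => hf.const_smul c

section Representation

variable {Ω : Type*} [MeasurableSpace Ω] {μ : Measure Ω}

theorem boundedFun_mem_of_bound {V : Type*} [NormedAddCommGroup V] [NormedSpace ℝ V] {f : Ω → V}
    (hf : AEStronglyMeasurable f μ) (C : ℝ) (h : ∀ᵐ z ∂μ, ‖f z‖ ≤ C) : f ∈ boundedFun μ V :=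
  memLp_top_of_bound hf C h

theorem ae_norm_le_of_boundedFun {V : Type*} [NormedAddCommGroup V] [NormedSpace ℝ V]
    (f : boundedFun μ V) : ∀ᵐ z ∂μ, ‖f.1 z‖ ≤ (eLpNorm f.1 ⊤ μ).toReal := by
  filter_upwards [ae_le_eLpNormEssSup (f := f.1) (μ := μ)] with z hz
  rw [eLpNorm_exponent_top]
  have h2 := ENNReal.toReal_mono (by have := f.2.2.ne; rwa [eLpNorm_exponent_top] at this) hz
  simpa using h2

/-- The condition on a linear functional on bounded functions that makes it countably additive. It
holds when the functional is bounded above by a finite integral functional. -/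
def BoundedOnSmallSets {V : Type*} [NormedAddCommGroup V] [NormedSpace ℝ V]
    (ρ : boundedFun μ V →ₗ[ℝ] ℝ) : Prop :=
  ∃ c : ℝ, ∀ K : ℝ, ∃ C : ℝ, 0 ≤ C ∧ ∀ (f : boundedFun μ V) (E : Set Ω), MeasurableSet E →
    (∀ᵐ z ∂μ, ‖f.1 z‖ ≤ E.indicator (fun _ => K) z) → ρ f ≤ C * μ.real E + c

/-- The bound of the functional at the height `K`, rescaled to functions of size `δ` supported in `E`.
For large `K` the constant `c` becomes harmless. -/
theorem BoundedOnSmallSets.abs_apply_le {V : Type*} [NormedAddCommGroup V] [NormedSpace ℝ V]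
    {ρ : boundedFun μ V →ₗ[ℝ] ℝ} (h : BoundedOnSmallSets ρ) :
    ∃ c : ℝ, 0 ≤ c ∧ ∀ K : ℝ, 0 < K → ∃ C : ℝ, 0 ≤ C ∧ ∀ (f : boundedFun μ V) (E : Set Ω) (δ : ℝ),
      0 ≤ δ → MeasurableSet E → (∀ᵐ z ∂μ, ‖f.1 z‖ ≤ E.indicator (fun _ => δ) z) →
      |ρ f| ≤ δ * ((C * μ.real E + c) / K) := by
  obtain ⟨c, hc⟩ := h
  refine ⟨max c 0, le_max_right _ _, fun K hK => ?_⟩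
  obtain ⟨C, hC, h⟩ := hc K
  refine ⟨C, hC, ?_⟩
  have h1 : ∀ (f : boundedFun μ V) (E : Set Ω) (δ : ℝ), 0 < δ → MeasurableSet E →
      (∀ᵐ z ∂μ, ‖f.1 z‖ ≤ E.indicator (fun _ => δ) z) →
      ρ f ≤ δ * ((C * μ.real E + max c 0) / K) := by
    intro f E δ hδ hE hf
    have := h ((K / δ) • f) E hE (by
      filter_upwards [hf] with z hz
      have e : ((K / δ) • f).1 z = (K / δ) • f.1 z := rfl
      rw [e, norm_smul, Real.norm_of_nonneg (by positivity)]
      by_cases hzE : z ∈ E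
      · simp only [hzE, indicator_of_mem] at hz ⊢
        calc K / δ * ‖f.1 z‖ ≤ K / δ * δ := by gcongr
          _ = K := by field_simp
      · simp only [hzE, not_false_eq_true, indicator_of_notMem] at hz ⊢
        have : ‖f.1 z‖ = 0 := le_antisymm hz (norm_nonneg _)
        simp [this])
    rw [map_smul, smul_eq_mul] at this
    have h2 : K / δ * ρ f ≤ C * μ.real E + max c 0 := this.trans (by gcongr; exact le_max_left _ _)
    rw [div_mul_eq_mul_div, div_le_iff₀ hδ] at h2
    rw [← mul_div_assoc, le_div_iff₀ hK]
    linarith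
  have h2 : ∀ (f : boundedFun μ V) (E : Set Ω) (δ : ℝ), 0 ≤ δ → MeasurableSet E →
      (∀ᵐ z ∂μ, ‖f.1 z‖ ≤ E.indicator (fun _ => δ) z) →
      ρ f ≤ δ * ((C * μ.real E + max c 0) / K) := by
    intro f E δ hδ hE hf
    rcases hδ.eq_or_lt with rfl | hδ
    · rw [zero_mul]
      have hB : 0 ≤ (C * μ.real E + max c 0) / K := by positivity
      refine le_of_forall_pos_le_add fun ε hε => ?_
      set B := (C * μ.real E + max c 0) / K
      refine (h1 f E (ε / (B + 1)) (by positivity) hE (hf.mono fun z hz => hz.trans ?_)).trans ?_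
      · exact indicator_le_indicator (by positivity)
      · rw [zero_add, div_mul_eq_mul_div, div_le_iff₀ (by positivity)]
        nlinarith
    · exact h1 f E δ hδ hE hf
  intro f E δ hδ hE hf
  refine abs_le.2 ⟨?_, h2 f E δ hδ hE hf⟩
  have := h2 (-f) E δ hδ hE (by
    filter_upwards [hf] with z hz
    have e : (-f).1 z = - f.1 z := rfl
    rwa [e, norm_neg])
  rw [map_neg] at this
  linarith

/-- The indicator function of a measurable set, as a bounded function. -/
def indicatorFun (μ : Measure Ω) {E : Set Ω} (hE : MeasurableSet E) : boundedFun μ ℝ :=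
  ⟨E.indicator (fun _ => (1 : ℝ)), boundedFun_mem_of_bound
    (stronglyMeasurable_const.indicator hE).aestronglyMeasurable 1 (ae_of_all _ fun z => by
      by_cases hz : z ∈ E <;> simp [hz])⟩

theorem coe_indicatorFun {E : Set Ω} (hE : MeasurableSet E) :
    (indicatorFun μ hE).1 = E.indicator (fun _ => (1 : ℝ)) := rfl

theorem indicatorFun_apply_of_mem {E : Set Ω} (hE : MeasurableSet E) {z : Ω} (hz : z ∈ E) :
    (indicatorFun μ hE).1 z = 1 := by simp [coe_indicatorFun, hz]

theorem indicatorFun_apply_of_notMem {E : Set Ω} (hE : MeasurableSet E) {z : Ω} (hz : z ∉ E) :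
    (indicatorFun μ hE).1 z = 0 := by simp [coe_indicatorFun, hz]

theorem indicatorFun_union (ρ : boundedFun μ ℝ →ₗ[ℝ] ℝ) {A B : Set Ω} (hA : MeasurableSet A)
    (hB : MeasurableSet B) (hAB : Disjoint A B) :
    ρ (indicatorFun μ (hA.union hB)) = ρ (indicatorFun μ hA) + ρ (indicatorFun μ hB) := by
  rw [← map_add]
  congr 1
  ext z
  exact congrFun (indicator_union_of_disjoint hAB (fun _ => (1 : ℝ))) z

theorem indicatorFun_congr {A B : Set Ω} (hA : MeasurableSet A)
    (hB : MeasurableSet B) (h : A = B) : indicatorFun μ hA = indicatorFun μ hB := by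
  subst h; rfl

theorem indicatorFun_empty (ρ : boundedFun μ ℝ →ₗ[ℝ] ℝ) :
    ρ (indicatorFun μ MeasurableSet.empty) = 0 := by
  rw [← map_zero ρ]; congr 1; ext z; simp [coe_indicatorFun]

theorem BoundedOnSmallSets.abs_indicatorFun_le {ρ : boundedFun μ ℝ →ₗ[ℝ] ℝ}
    (h : BoundedOnSmallSets ρ) : ∃ c : ℝ, 0 ≤ c ∧ ∀ K : ℝ, 0 < K → ∃ C : ℝ, 0 ≤ C ∧
      ∀ (E : Set Ω) (hE : MeasurableSet E), |ρ (indicatorFun μ hE)| ≤ (C * μ.real E + c) / K := by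
  obtain ⟨c, hc0, hc⟩ := h.abs_apply_le
  refine ⟨c, hc0, fun K hK => ?_⟩
  obtain ⟨C, hC, h⟩ := hc K hK
  refine ⟨C, hC, fun E hE => ?_⟩
  have := h (indicatorFun μ hE) E 1 zero_le_one hE (ae_of_all _ fun z => by
    by_cases hz : z ∈ E <;> simp [coe_indicatorFun, hz])
  linarith

variable [IsFiniteMeasure μ]

/-- Countable additivity: the tails of the union have small measure, and the functional is small there
by `abs_indicatorFun_le` for `K` large. -/
theorem BoundedOnSmallSets.hasSum_indicatorFun {ρ : boundedFun μ ℝ →ₗ[ℝ] ℝ}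
    (h : BoundedOnSmallSets ρ) {f : ℕ → Set Ω} (hf : ∀ i, MeasurableSet (f i))
    (hd : Pairwise (Function.onFun Disjoint f)) :
    HasSum (fun i => ρ (indicatorFun μ (hf i))) (ρ (indicatorFun μ (MeasurableSet.iUnion hf))) := by
  obtain ⟨c, hc0, hχ⟩ := h.abs_indicatorFun_le
  have hU : ∀ s : Finset ℕ, MeasurableSet (⋃ i ∈ s, f i) := fun s =>
    s.measurableSet_biUnion fun i _ => hf i
  have hsum : ∀ s : Finset ℕ, ∑ i ∈ s, ρ (indicatorFun μ (hf i)) = ρ (indicatorFun μ (hU s)) := by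
    intro s
    induction s using Finset.induction_on with
    | empty =>
      rw [Finset.sum_empty, indicatorFun_congr (hU ∅) MeasurableSet.empty (by simp),
        indicatorFun_empty]
    | insert a s ha ih =>
      rw [Finset.sum_insert ha, ih, ← indicatorFun_union ρ (hf a) (hU s),
        indicatorFun_congr _ (hU (insert a s)) (by simp)]
      rw [disjoint_iUnion₂_right]
      intro i hi
      exact hd (fun h => ha (h ▸ hi))
  have hms : HasSum (fun i => μ.real (f i)) (μ.real (⋃ i, f i)) := by
    have h1 : HasSum (fun i => μ (f i)) (μ (⋃ i, f i)) := by
      rw [measure_iUnion hd hf]; exact ENNReal.summable.hasSum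
    exact ENNReal.hasSum_toReal (by rw [h1.tsum_eq]; exact measure_ne_top _ _) |> fun h2 => by
      rwa [← ENNReal.tsum_toReal_eq (fun i => measure_ne_top _ _), h1.tsum_eq] at h2
  have hUn := MeasurableSet.iUnion hf
  rw [HasSum, SummationFilter.unconditional_filter, Metric.tendsto_atTop]
  intro ε hε
  obtain ⟨C, hC, hCb⟩ := hχ (2 * (c + 1) / ε) (by positivity)
  rw [HasSum, SummationFilter.unconditional_filter, Metric.tendsto_atTop] at hms
  obtain ⟨s₀, hs₀⟩ := hms (1 / (C + 1)) (by positivity)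
  refine ⟨s₀, fun s hs => ?_⟩
  have h1 := hs₀ s hs
  have hsub : (⋃ i ∈ s, f i) ⊆ ⋃ i, f i := iUnion₂_subset fun i _ => subset_iUnion f i
  have hdiff := hUn.diff (hU s)
  have h3 : ρ (indicatorFun μ hUn) = ρ (indicatorFun μ (hU s)) + ρ (indicatorFun μ hdiff) := by
    rw [← indicatorFun_union ρ (hU s) hdiff disjoint_sdiff_right]
    exact congrArg ρ (indicatorFun_congr _ _ (union_sdiff_cancel hsub).symm)
  have h4 : μ.real ((⋃ i, f i) \ ⋃ i ∈ s, f i) < 1 / (C + 1) := by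
    rw [measureReal_sdiff hsub (hU s), measureReal_biUnion_finset (fun i _ j _ hij => hd hij)
      (fun i _ => hf i)]
    rw [Real.dist_eq, abs_lt] at h1
    linarith
  rw [hsum, Real.dist_eq, h3, sub_add_cancel_left, abs_neg]
  refine (hCb _ hdiff).trans_lt ?_
  rw [div_lt_iff₀ (by positivity)]
  have : C * μ.real ((⋃ i, f i) \ ⋃ i ∈ s, f i) ≤ 1 := by
    calc _ ≤ C * (1 / (C + 1)) := by gcongr
      _ ≤ 1 := by rw [mul_one_div, div_le_one (by positivity)]; linarith
  have e : ε * (2 * (c + 1) / ε) = 2 * (c + 1) := by field_simp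
  rw [e]; linarith

/-- On indicator functions the functional is a signed measure that is absolutely continuous with
respect to `μ`, so that it has a Radon-Nikodym density. -/
theorem BoundedOnSmallSets.exists_density {ρ : boundedFun μ ℝ →ₗ[ℝ] ℝ}
    (h : BoundedOnSmallSets ρ) : ∃ g : Ω → ℝ, Integrable g μ ∧
      ∀ E (hE : MeasurableSet E), ρ (indicatorFun μ hE) = ∫ z in E, g z ∂μ := by
  classical
  obtain ⟨c, hc0, hχ⟩ := h.abs_indicatorFun_le
  let ν : SignedMeasure Ω :=
    { measureOf' := fun E => if hE : MeasurableSet E then ρ (indicatorFun μ hE) else 0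
      empty' := by simp [indicatorFun_empty]
      not_measurable' := fun E hE => by simp [hE]
      m_iUnion' := by
        intro f hf hd
        simpa only [hf, MeasurableSet.iUnion hf, dif_pos] using h.hasSum_indicatorFun hf hd }
  have hν : ∀ E (hE : MeasurableSet E), ν E = ρ (indicatorFun μ hE) := fun E hE => dif_pos hE
  have hac : ν ≪ᵥ μ.toENNRealVectorMeasure := by
    intro E hE
    by_cases hEm : MeasurableSet E
    · rw [Measure.toENNRealVectorMeasure_apply_measurable hEm] at hE
      rw [hν E hEm]
      have h0 : μ.real E = 0 := by simp [measureReal_def, hE]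
      have : ∀ ε > 0, |ρ (indicatorFun μ hEm)| ≤ 0 + ε := by
        intro ε hε
        obtain ⟨C, hC, hCb⟩ := hχ ((c + 1) / ε) (by positivity)
        refine (hCb E hEm).trans ?_
        rw [h0, mul_zero, zero_add, zero_add, div_le_iff₀ (by positivity)]
        field_simp
        linarith
      exact abs_nonpos_iff.1 (le_of_forall_pos_le_add this)
    · exact ν.not_measurable hEm
  have hRN := SignedMeasure.absolutelyContinuous_iff_withDensityᵥ_rnDeriv_eq ν μ |>.1 hac
  set g := ν.rnDeriv μ
  have hg : Integrable g μ := SignedMeasure.integrable_rnDeriv ν μ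
  refine ⟨g, hg, fun E hE => ?_⟩
  rw [← hν E hE, ← hRN, withDensityᵥ_apply hg hE]

theorem exists_integrable_of_scalar_functional {ρ : boundedFun μ ℝ →ₗ[ℝ] ℝ}
    (h : BoundedOnSmallSets ρ) :
    ∃ g : Ω → ℝ, Integrable g μ ∧ ∀ f : boundedFun μ ℝ, ρ f = ∫ z, g z * f.1 z ∂μ := by
  obtain ⟨g, hg, hind⟩ := h.exists_density
  obtain ⟨c, hc0, hc⟩ := h.abs_apply_le
  refine ⟨g, hg, ?_⟩
  -- passage from indicator functions to bounded functions by uniform approximation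
  obtain ⟨C, hC, hCb⟩ := hc 1 one_pos
  have hmulint : ∀ f : boundedFun μ ℝ, Integrable (fun z => g z * f.1 z) μ := fun f => by
    simpa [mul_comm] using hg.bdd_mul f.2.1 (ae_norm_le_of_boundedFun f)
  have huniv : ∀ (f : boundedFun μ ℝ) (δ : ℝ), 0 ≤ δ → (∀ᵐ z ∂μ, ‖f.1 z‖ ≤ δ) →
      |ρ f - ∫ z, g z * f.1 z ∂μ| ≤ δ * (C * μ.real univ + c + ∫ z, ‖g z‖ ∂μ) := by
    intro f δ hδ hf
    have h1 := hCb f univ δ hδ MeasurableSet.univ (by simpa using hf)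
    rw [div_one] at h1
    have h2 : |∫ z, g z * f.1 z ∂μ| ≤ δ * ∫ z, ‖g z‖ ∂μ := by
      rw [← integral_const_mul, ← Real.norm_eq_abs]
      refine norm_integral_le_of_norm_le (hg.norm.const_mul δ) ?_
      filter_upwards [hf] with z hz
      rw [norm_mul, mul_comm]
      gcongr
    calc |ρ f - ∫ z, g z * f.1 z ∂μ| ≤ |ρ f| + |∫ z, g z * f.1 z ∂μ| := abs_sub _ _
      _ ≤ _ := by rw [mul_add]; exact add_le_add h1 h2
  intro f
  obtain ⟨f', hf'm, hff'⟩ := f.2.1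
  obtain ⟨M, hM⟩ : ∃ M : ℕ, ∀ᵐ z ∂μ, ‖f.1 z‖ ≤ M := by
    obtain ⟨M, hM⟩ := exists_nat_ge (eLpNorm f.1 ⊤ μ).toReal
    exact ⟨M, (ae_norm_le_of_boundedFun f).mono fun z hz => hz.trans hM⟩
  set B := C * μ.real univ + c + ∫ z, ‖g z‖ ∂μ
  have hB : 0 ≤ B := by
    have : 0 ≤ ∫ z, ‖g z‖ ∂μ := integral_nonneg fun z => norm_nonneg _
    positivity
  rw [← sub_eq_zero, ← abs_nonpos_iff]
  refine le_of_forall_pos_le_add fun ε hε => ?_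
  obtain ⟨n, hn⟩ := exists_nat_gt (B / ε)
  have hn0 : 0 < (n : ℝ) := lt_of_le_of_lt (by positivity) hn
  have hlev : ∀ k : ℤ, MeasurableSet {z | ⌊(n : ℝ) * f' z⌋ = k} := fun k =>
    (Int.measurable_floor.comp (hf'm.measurable.const_mul _)) (measurableSet_singleton k)
  -- the simple function with values in `ℤ / n` just below `f`
  let s : boundedFun μ ℝ := ∑ k ∈ Finset.Icc (-(n * M : ℤ) - 1) (n * M),
    ((k : ℝ) / n) • indicatorFun μ (hlev k)
  have hs : ρ s = ∫ z, g z * s.1 z ∂μ := by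
    have : ∀ z, g z * s.1 z = ∑ k ∈ Finset.Icc (-(n * M : ℤ) - 1) (n * M),
        ((k : ℝ) / n) * ({z | ⌊(n : ℝ) * f' z⌋ = k}.indicator g z) := by
      intro z
      simp only [s, AddSubmonoidClass.coe_finsetSum, Finset.sum_apply, Finset.mul_sum]
      refine Finset.sum_congr rfl fun k _ => ?_
      change g z * ((k : ℝ) / n * (indicatorFun μ (hlev k)).1 z) = _
      by_cases hz : z ∈ {z | ⌊(n : ℝ) * f' z⌋ = k}
      · rw [indicatorFun_apply_of_mem (hlev k) (z := z) hz, indicator_of_mem hz]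
        ring
      · rw [indicatorFun_apply_of_notMem (hlev k) (z := z) hz, indicator_of_notMem hz]
        ring
    simp only [this]
    rw [integral_finsetSum _ fun k _ => (hg.indicator (hlev k)).const_mul _]
    simp only [s, map_sum, map_smul, smul_eq_mul, integral_const_mul]
    refine Finset.sum_congr rfl fun k _ => ?_
    rw [hind, integral_indicator (hlev k)]
  have hclose : ∀ᵐ z ∂μ, ‖(f - s).1 z‖ ≤ 1 / n := by
    filter_upwards [hff', hM] with z hz hz2
    have e : (f - s).1 z = f.1 z - s.1 z := rfl
    have e2 : s.1 z = (⌊(n : ℝ) * f' z⌋ : ℝ) / n := by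
      simp only [s, AddSubmonoidClass.coe_finsetSum, Finset.sum_apply]
      rw [Finset.sum_eq_single ⌊(n : ℝ) * f' z⌋]
      · change _ * (indicatorFun μ (hlev _)).1 z = _
        rw [indicatorFun_apply_of_mem (hlev _) (z := z) rfl, mul_one]
      · intro k _ hk
        change _ * (indicatorFun μ (hlev _)).1 z = _
        rw [indicatorFun_apply_of_notMem (hlev k) (z := z) (fun h => hk h.symm), mul_zero]
      · intro hk
        exfalso
        apply hk
        rw [hz, Real.norm_eq_abs, abs_le] at hz2
        rw [Finset.mem_Icc]
        constructor
        · rw [Int.le_floor]; push_cast; nlinarith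
        · have : (⌊(n : ℝ) * f' z⌋ : ℝ) ≤ n * M := (Int.floor_le _).trans (by nlinarith)
          exact_mod_cast this
    rw [e, e2, hz]
    have h1 := Int.floor_le ((n : ℝ) * f' z)
    have h2 := Int.lt_floor_add_one ((n : ℝ) * f' z)
    have e3 : f' z - (⌊(n : ℝ) * f' z⌋ : ℝ) / n = ((n : ℝ) * f' z - ⌊(n : ℝ) * f' z⌋) / n := by
      field_simp
    rw [e3, norm_div, Real.norm_of_nonneg (by linarith), Real.norm_of_nonneg hn0.le]
    gcongr
    linarith
  have h1 := huniv (f - s) (1 / n) (by positivity) hclose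
  have e : (∫ z, g z * (f - s).1 z ∂μ) = ∫ z, g z * f.1 z ∂μ - ∫ z, g z * s.1 z ∂μ := by
    rw [← integral_sub (hmulint f) (hmulint s)]
    refine integral_congr_ae (ae_of_all _ fun z => ?_)
    exact mul_sub _ _ _
  rw [map_sub, e, hs, sub_sub_sub_cancel_right] at h1
  refine h1.trans ?_
  rw [zero_add, one_div, inv_mul_le_iff₀ hn0]
  rw [div_lt_iff₀ hε] at hn
  exact hn.le

/-- Multiplication of bounded scalar functions by a fixed vector. -/
def boundedSmulRight (μ : Measure Ω) {V : Type*} [NormedAddCommGroup V] [NormedSpace ℝ V] (v : V) :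
    boundedFun μ ℝ →ₗ[ℝ] boundedFun μ V where
  toFun f := ⟨fun z => f.1 z • v,
    ((ContinuousLinearMap.id ℝ ℝ).smulRight v).comp_memLp' (f := f.1) f.2⟩
  map_add' f g := by ext z; exact add_smul _ _ _
  map_smul' c f := by ext z; exact mul_smul _ _ _

theorem BoundedOnSmallSets.comp_smulRight {V : Type*} [NormedAddCommGroup V] [NormedSpace ℝ V]
    {ρ : boundedFun μ V →ₗ[ℝ] ℝ} (h : BoundedOnSmallSets ρ) (v : V) :
    BoundedOnSmallSets (ρ ∘ₗ boundedSmulRight μ v) := by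
  obtain ⟨c, h⟩ := h
  refine ⟨c, fun K => ?_⟩
  obtain ⟨C, hC, h⟩ := h (K * ‖v‖)
  refine ⟨C, hC, fun f E hE hf => h _ E hE ?_⟩
  filter_upwards [hf] with z hz
  change ‖f.1 z • v‖ ≤ _
  rw [norm_smul]
  calc ‖f.1 z‖ * ‖v‖ ≤ E.indicator (fun _ => K) z * ‖v‖ := by gcongr
    _ = E.indicator (fun _ => K * ‖v‖) z := by by_cases hz : z ∈ E <;> simp [hz]

/-- A functional that is bounded on small sets is given by a pair of integrable functions, built from
the densities of its components. -/
theorem exists_integrable_of_functional {d : ℕ} {ρ : boundedFun μ (ℝ × Vec d) →ₗ[ℝ] ℝ}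
    (h : BoundedOnSmallSets ρ) :
    ∃ (m : Ω → ℝ) (w : Ω → Vec d), Integrable m μ ∧ Integrable w μ ∧
      ∀ y : boundedFun μ (ℝ × Vec d),
        ρ y = ∫ z, (m z * (y.1 z).1 + inner ℝ (w z) (y.1 z).2) ∂μ := by
  obtain ⟨m, hm, hm'⟩ := exists_integrable_of_scalar_functional
    (h.comp_smulRight ((1, 0) : ℝ × Vec d))
  choose g hg hg' using fun i : Fin d => exists_integrable_of_scalar_functional
    (h.comp_smulRight ((0, EuclideanSpace.single i 1) : ℝ × Vec d))
  have hw : Integrable (fun z => (WithLp.toLp 2 fun i => g i z : Vec d)) μ := by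
    have := Integrable.of_eval (f := fun z i => g i z) (μ := μ) hg
    exact (PiLp.continuousLinearEquiv 2 ℝ
      (fun _ : Fin d => ℝ)).symm.toContinuousLinearMap.integrable_comp this
  refine ⟨m, _, hm, hw, fun y => ?_⟩
  let a : boundedFun μ ℝ := ⟨fun z => (y.1 z).1,
    (ContinuousLinearMap.fst ℝ ℝ (Vec d)).comp_memLp' (f := y.1) y.2⟩
  let b : Fin d → boundedFun μ ℝ := fun i => ⟨fun z => (y.1 z).2 i,
    ((EuclideanSpace.proj i).comp (ContinuousLinearMap.snd ℝ ℝ (Vec d))).comp_memLp' (f := y.1) y.2⟩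
  have hy : y = boundedSmulRight μ (1, 0) a
      + ∑ i, boundedSmulRight μ ((0, EuclideanSpace.single i 1) : ℝ × Vec d) (b i) := by
    apply Subtype.ext
    funext z
    rw [Submodule.coe_add, AddSubmonoidClass.coe_finsetSum, Pi.add_apply, Finset.sum_apply]
    change y.1 z = (y.1 z).1 • (1, 0) + ∑ i, (y.1 z).2 i • (0, EuclideanSpace.single i 1)
    refine Prod.ext (by simp [Prod.fst_sum]) ?_
    ext i
    simp [Prod.snd_sum, Finset.sum_apply, Pi.single_apply]
  have hint : ∀ {u : Ω → ℝ}, Integrable u μ → ∀ f : boundedFun μ ℝ,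
      Integrable (fun z => u z * f.1 z) μ := fun hu f => by
    simpa [mul_comm] using hu.bdd_mul f.2.1 (ae_norm_le_of_boundedFun f)
  have e1 := hm' a
  have e2 := fun i => hg' i (b i)
  simp only [LinearMap.comp_apply] at e1 e2
  conv_lhs => rw [hy, map_add, map_sum, e1]
  simp only [e2]
  rw [← integral_finsetSum _ fun i _ => hint (hg i) (b i), ← integral_add (hint hm a)
    (integrable_finsetSum _ fun i _ => hint (hg i) (b i))]
  refine integral_congr_ae (ae_of_all _ fun z => ?_)
  simp [a, b, PiLp.inner_apply, mul_comm]

end Representation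

/-! ### Extended integrals and measurable selections -/

section ExtendedIntegral

variable {Ω : Type*} [MeasurableSpace Ω] {μ : Measure Ω}

theorem eintegral_mono {g h : Ω → EReal} (hgh : ∀ᵐ z ∂μ, g z ≤ h z) :
    eintegral μ g ≤ eintegral μ h := by
  refine EReal.sub_le_sub ?_ ?_
  · exact EReal.coe_ennreal_le_coe_ennreal_iff.2
      (lintegral_mono_ae (hgh.mono fun z hz => EReal.toENNReal_le_toENNReal hz))
  · exact EReal.coe_ennreal_le_coe_ennreal_iff.2 (lintegral_mono_ae (hgh.mono fun z hz =>
      EReal.toENNReal_le_toENNReal (EReal.neg_le_neg_iff.2 hz)))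

theorem eintegral_coe {u : Ω → ℝ} (hu : Integrable u μ) :
    eintegral μ (fun z => (u z : EReal)) = ((∫ z, u z ∂μ : ℝ) : EReal) := by
  have e1 : ∀ z, ((u z : EReal)).toENNReal = ENNReal.ofReal (u z) := fun z => by
    simp [EReal.toENNReal]
  have e2 : ∀ z, (-(u z : EReal)).toENNReal = ENNReal.ofReal (-u z) := fun z => by
    rw [← EReal.coe_neg]; simp [EReal.toENNReal]
  rw [eintegral, integral_eq_lintegral_pos_part_sub_lintegral_neg_part hu]
  simp only [e1, e2]
  have h1 : ∫⁻ z, ENNReal.ofReal (u z) ∂μ ≠ ⊤ :=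
    ((lintegral_mono fun z => Real.ofReal_le_enorm (u z)).trans_lt hu.2).ne
  have h2 : ∫⁻ z, ENNReal.ofReal (-u z) ∂μ ≠ ⊤ :=
    ((lintegral_mono fun z => Real.ofReal_le_enorm (-u z)).trans_lt
      (by simpa [hasFiniteIntegral_iff_enorm] using hu.2)).ne
  rw [EReal.coe_sub, EReal.coe_ennreal_toReal h1, EReal.coe_ennreal_toReal h2]

theorem eintegral_congr {g h : Ω → EReal} (hgh : ∀ᵐ z ∂μ, g z = h z) :
    eintegral μ g = eintegral μ h :=
  le_antisymm (eintegral_mono (hgh.mono fun _ h => h.le))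
    (eintegral_mono (hgh.mono fun _ h => h.ge))

theorem integral_le_eintegral {u : Ω → ℝ} {g : Ω → EReal} (hu : Integrable u μ)
    (h : ∀ᵐ z ∂μ, (u z : EReal) ≤ g z) : ((∫ z, u z ∂μ : ℝ) : EReal) ≤ eintegral μ g := by
  rw [← eintegral_coe hu]
  exact eintegral_mono h

/-- A function which is bounded below by an integrable function and whose extended integral is not
`+∞` is almost everywhere an integrable real valued function. -/
theorem exists_integrable_of_eintegral_ne_top {h : Ω → ℝ} {g : Ω → EReal} (hh : Integrable h μ)
    (hg : AEMeasurable g μ) (hle : ∀ᵐ z ∂μ, (h z : EReal) ≤ g z) (htop : eintegral μ g ≠ ⊤) :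
    ∃ u : Ω → ℝ, Integrable u μ ∧ ∀ᵐ z ∂μ, g z = u z := by
  have hneg : ∫⁻ z, (-g z).toENNReal ∂μ ≠ ⊤ := by
    refine ((lintegral_mono_ae (g := fun z => ENNReal.ofReal (-h z)) ?_).trans_lt
      ((lintegral_mono fun z => Real.ofReal_le_enorm (-h z)).trans_lt
        (by simpa [hasFiniteIntegral_iff_enorm] using hh.2))).ne
    filter_upwards [hle] with z hz
    have := EReal.toENNReal_le_toENNReal (EReal.neg_le_neg_iff.2 hz)
    refine this.trans (le_of_eq ?_)
    rw [← EReal.coe_neg]; simp [EReal.toENNReal]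
  have hpos : ∫⁻ z, (g z).toENNReal ∂μ ≠ ⊤ := by
    intro h
    apply htop
    rw [eintegral, h, EReal.coe_ennreal_top]
    exact EReal.top_sub (by simpa using hneg)
  have hfin : ∀ᵐ z ∂μ, g z = (g z).toReal := by
    filter_upwards [ae_lt_top' hg.ereal_toENNReal hpos, hle] with z h1 h2
    refine (EReal.coe_toReal ?_ ?_).symm
    · intro h; rw [h] at h1; simp at h1
    · intro h; rw [h] at h2; simp at h2
  refine ⟨fun z => (g z).toReal, ⟨hg.ereal_toReal.aestronglyMeasurable, ?_⟩, hfin⟩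
  rw [hasFiniteIntegral_iff_enorm]
  refine (lintegral_mono_ae (g := fun z => (g z).toENNReal + (-g z).toENNReal) ?_).trans_lt ?_
  · filter_upwards [hfin] with z hz
    rw [hz, ← EReal.coe_neg, EReal.toReal_coe]
    rcases le_total 0 (g z).toReal with h | h
    · simp [EReal.toENNReal, Real.enorm_eq_ofReal h]
    · rw [← enorm_neg, Real.enorm_eq_ofReal (neg_nonneg.2 h)]
      simp [EReal.toENNReal]
  · rw [lintegral_add_left' hg.ereal_toENNReal]
    exact ENNReal.add_lt_top.2 ⟨hpos.lt_top, hneg.lt_top⟩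

/-- An index at which the maximum of `h 0, …, h n` is attained. -/
def maxIndex (h : ℕ → Ω → ℝ) : ℕ → Ω → ℕ
  | 0, _ => 0
  | n + 1, z => if h (maxIndex h n z) z < h (n + 1) z then n + 1 else maxIndex h n z

theorem maxIndex_le (h : ℕ → Ω → ℝ) (n : ℕ) (z : Ω) : maxIndex h n z ≤ n := by
  induction n with
  | zero => exact le_rfl
  | succ n ih => rw [maxIndex]; split_ifs <;> omega

theorem apply_maxIndex_succ (h : ℕ → Ω → ℝ) (n : ℕ) (z : Ω) :
    h (maxIndex h (n + 1) z) z = max (h (maxIndex h n z) z) (h (n + 1) z) := by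
  rw [maxIndex]; split_ifs with hlt
  · exact (max_eq_right hlt.le).symm
  · exact (max_eq_left (not_lt.1 hlt)).symm

theorem apply_le_apply_maxIndex (h : ℕ → Ω → ℝ) (z : Ω) {k n : ℕ} (hk : k ≤ n) :
    h k z ≤ h (maxIndex h n z) z := by
  induction n with
  | zero => rw [Nat.le_zero.1 hk]; rfl
  | succ n ih =>
    rw [apply_maxIndex_succ h]
    rcases Nat.le_succ_iff.1 hk with h1 | rfl
    · exact (ih h1).trans (le_max_left _ _)
    · exact le_max_right _ _

theorem monotone_apply_maxIndex (h : ℕ → Ω → ℝ) (z : Ω) :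
    Monotone fun n => h (maxIndex h n z) z :=
  monotone_nat_of_le_succ fun n => by
    simp only [apply_maxIndex_succ h]; exact le_max_left _ _

theorem measurable_apply_index {h : ℕ → Ω → ℝ} (hm : ∀ k, Measurable (h k)) {k : Ω → ℕ}
    (hk : Measurable k) : Measurable fun z => h (k z) z :=
  (measurable_from_prod_countable_right (f := fun p : ℕ × Ω => h p.1 p.2) hm).comp
    (hk.prodMk measurable_id)

theorem measurable_maxIndex {h : ℕ → Ω → ℝ} (hm : ∀ k, Measurable (h k)) (n : ℕ) :
    Measurable (maxIndex h n) := by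
  induction n with
  | zero => exact measurable_const
  | succ n ih =>
    exact Measurable.ite (measurableSet_lt (measurable_apply_index hm ih) (hm (n + 1)))
      measurable_const ih

theorem integrable_apply_index {h : ℕ → Ω → ℝ} (hm : ∀ k, Measurable (h k))
    (hint : ∀ k, Integrable (h k) μ) {k : Ω → ℕ} (hk : Measurable k) {n : ℕ} (hkn : ∀ z, k z ≤ n) :
    Integrable (fun z => h (k z) z) μ := by
  refine (integrable_finsetSum (Finset.range (n + 1)) fun i _ => (hint i).norm).mono
    (measurable_apply_index hm hk).aestronglyMeasurable (ae_of_all _ fun z => ?_)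
  rw [Real.norm_of_nonneg (r := ∑ i ∈ _, _) (Finset.sum_nonneg fun i _ => norm_nonneg _)]
  exact Finset.single_le_sum (f := fun i => ‖h i z‖) (fun i _ => norm_nonneg _)
    (Finset.mem_range.2 (Nat.lt_succ_of_le (hkn z)))

/-- If the integrals of all measurable finite selections from a sequence of integrable functions are
bounded by `M`, then so is the integral of the supremum of the sequence. -/
theorem exists_integrable_isLUB_of_selection {h : ℕ → Ω → ℝ} (hint : ∀ k, Integrable (h k) μ)
    {M : ℝ} (hsel : ∀ (k : Ω → ℕ) (n : ℕ), Measurable k → (∀ z, k z ≤ n) →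
      ∫ z, h (k z) z ∂μ ≤ M) :
    ∃ u : Ω → ℝ, Integrable u μ ∧ ∫ z, u z ∂μ ≤ M ∧
      ∀ᵐ z ∂μ, IsLUB (range fun k => h k z) (u z) := by
  wlog hm : ∀ k, Measurable (h k) generalizing h
  · have hmk := fun k => (hint k).1.ae_eq_mk
    have hall : ∀ᵐ z ∂μ, ∀ k, h k z = (hint k).1.mk (h k) z := ae_all_iff.2 hmk
    obtain ⟨u, hu, huM, hlub⟩ := this (h := fun k => (hint k).1.mk (h k))
      (fun k => (hint k).congr (hmk k))
      (fun k n hk hkn => by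
        rw [← integral_congr_ae (hall.mono fun z hz => hz (k z))]
        exact hsel k n hk hkn)
      (fun k => (hint k).1.stronglyMeasurable_mk.measurable)
    refine ⟨u, hu, huM, ?_⟩
    filter_upwards [hall, hlub] with z h1 h2
    simpa only [h1] using h2
  -- `v n` is the maximum of `h 0, …, h n`; monotone convergence applies to `v n - v 0`
  set v : ℕ → Ω → ℝ := fun n z => h (maxIndex h n z) z with hv
  have hvint : ∀ n, Integrable (v n) μ := fun n =>
    integrable_apply_index hm hint (measurable_maxIndex hm n) (maxIndex_le h n)
  have hvM : ∀ n, ∫ z, v n z ∂μ ≤ M := fun n =>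
    hsel _ n (measurable_maxIndex hm n) (maxIndex_le h n)
  have hmono : ∀ z, Monotone fun n => v n z := monotone_apply_maxIndex h
  set g : ℕ → Ω → ENNReal := fun n z => ENNReal.ofReal (v n z - v 0 z) with hg
  have hgm : ∀ n, Measurable (g n) := fun n =>
    ((measurable_apply_index hm (measurable_maxIndex hm n)).sub
      (measurable_apply_index hm (measurable_maxIndex hm 0))).ennreal_ofReal
  have hgle : ∫⁻ z, ⨆ n, g n z ∂μ ≤ ENNReal.ofReal (M - ∫ z, v 0 z ∂μ) := by
    rw [lintegral_iSup hgm fun n k hnk z => ENNReal.ofReal_le_ofReal (by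
      have := hmono z hnk; simp only at this ⊢; linarith)]
    refine iSup_le fun n => ?_
    change ∫⁻ z, ENNReal.ofReal ((v n - v 0) z) ∂μ ≤ _
    rw [← ofReal_integral_eq_lintegral_ofReal ((hvint n).sub (hvint 0))
      (ae_of_all _ fun z => sub_nonneg.2 (hmono z (Nat.zero_le n)))]
    refine ENNReal.ofReal_le_ofReal ?_
    rw [integral_sub' (hvint n) (hvint 0)]
    linarith [hvM n]
  have hM0 : 0 ≤ M - ∫ z, v 0 z ∂μ := by linarith [hvM 0]
  have hgint : ∫⁻ z, ⨆ n, g n z ∂μ ≠ ⊤ := (hgle.trans_lt ENNReal.ofReal_lt_top).ne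
  have hsupm : Measurable fun z => ⨆ n, g n z := .iSup hgm
  have hw := integrable_toReal_of_lintegral_ne_top hsupm.aemeasurable hgint
  refine ⟨fun z => v 0 z + (⨆ n, g n z).toReal, (hvint 0).add hw, ?_, ?_⟩
  · rw [integral_add (hvint 0) hw, integral_toReal hsupm.aemeasurable (ae_lt_top hsupm hgint)]
    have := ENNReal.toReal_mono ENNReal.ofReal_ne_top hgle
    rw [ENNReal.toReal_ofReal hM0] at this
    linarith
  · filter_upwards [ae_lt_top hsupm hgint] with z hz
    constructor
    · rintro _ ⟨k, rfl⟩
      have h1 : g k z ≤ ⨆ n, g n z := le_iSup (fun n => g n z) k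
      have h2 := ENNReal.toReal_mono hz.ne h1
      rw [hg, ENNReal.toReal_ofReal (sub_nonneg.2 (hmono z (Nat.zero_le k)))] at h2
      have h3 : h k z ≤ v k z := apply_le_apply_maxIndex h z le_rfl
      simp only at h2 ⊢
      linarith
    · intro c hc
      have h1 : ∀ n, v n z ≤ c := fun n => hc ⟨_, rfl⟩
      have h2 : ⨆ n, g n z ≤ ENNReal.ofReal (c - v 0 z) :=
        iSup_le fun n => ENNReal.ofReal_le_ofReal (by linarith [h1 n])
      have h3 := ENNReal.toReal_mono ENNReal.ofReal_ne_top h2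
      rw [ENNReal.toReal_ofReal (sub_nonneg.2 (h1 0))] at h3
      linarith

end ExtendedIntegral

/-! ### The coupling and its conjugate -/

section Coupling

variable {d : ℕ} {f : Torus d → ℝ → ℝ} {q : ℝ}

/-- The real valued primitive `∫_0^m f(x,τ) dτ`. It is the primitive `F` of the coupling where
`0 ≤ m`, and is used only there. -/
def primR (f : Torus d → ℝ → ℝ) (x : Torus d) (m : ℝ) : ℝ := ∫ τ in (0 : ℝ)..m, f x τ

theorem primitive_of_nonneg {x : Torus d} {m : ℝ} (hm : 0 ≤ m) :
    primitive f x m = (primR f x m : EReal) := if_pos hm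

theorem primitive_of_neg {x : Torus d} {m : ℝ} (hm : m < 0) : primitive f x m = ⊤ :=
  if_neg (not_le.2 hm)

namespace CouplingCondition

theorem continuous_comp_max (hf : CouplingCondition f q) :
    Continuous fun z : Torus d × ℝ => f z.1 (max z.2 0) :=
  hf.continuousOn.comp_continuous (f := fun z : Torus d × ℝ => (z.1, max z.2 0)) (by fun_prop)
    fun z => ⟨mem_univ _, le_max_right z.2 0⟩

theorem primR_eq (x : Torus d) {m : ℝ} (hm : 0 ≤ m) :
    primR f x m = ∫ τ in (0 : ℝ)..m, f x (max τ 0) := by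
  refine intervalIntegral.integral_congr fun τ hτ => ?_
  rw [uIcc_of_le hm] at hτ
  simp only [max_eq_left hτ.1]

theorem continuousOn_apply (hf : CouplingCondition f q) (x : Torus d) :
    ContinuousOn (f x) (Ici 0) :=
  hf.continuousOn.comp (f := fun m : ℝ => (x, m)) (by fun_prop) fun m hm => ⟨mem_univ _, hm⟩

theorem intervalIntegrable (hf : CouplingCondition f q) (x : Torus d) {a b : ℝ} (ha : 0 ≤ a)
    (hb : 0 ≤ b) : IntervalIntegrable (f x) volume a b :=
  ((hf.continuousOn_apply x).mono fun _ ht => (le_min ha hb).trans ht.1).intervalIntegrable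

theorem primR_zero (x : Torus d) : primR f x 0 = 0 := intervalIntegral.integral_same

/-- Strict convexity of the primitive: it lies strictly above its tangents. -/
theorem tangent_lt (hf : CouplingCondition f q) (x : Torus d) {m n : ℝ} (hm : 0 ≤ m) (hn : 0 ≤ n)
    (hmn : m ≠ n) : primR f x m + f x m * (n - m) < primR f x n := by
  have hsub : primR f x n - primR f x m = ∫ τ in m..n, f x τ :=
    intervalIntegral.integral_interval_sub_left (hf.intervalIntegrable x le_rfl hn)
      (hf.intervalIntegrable x le_rfl hm)
  have hc : ∀ a b : ℝ, (∫ _τ in a..b, f x m) = f x m * (b - a) := fun a b => by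
    rw [intervalIntegral.integral_const, smul_eq_mul, mul_comm]
  rcases hmn.lt_or_gt with h | h
  · have : ∫ _τ in m..n, f x m < ∫ τ in m..n, f x τ := by
      refine intervalIntegral.integral_lt_integral_of_continuousOn_of_le_of_exists_lt h
        continuousOn_const ((hf.continuousOn_apply x).mono fun t ht => hm.trans ht.1)
        (fun t ht => (hf.strictMonoOn x).monotoneOn hm (hm.trans ht.1.le) ht.1.le)
        ⟨n, ⟨h.le, le_rfl⟩, hf.strictMonoOn x hm hn h⟩
    rw [hc] at this
    linarith
  · have : ∫ τ in n..m, f x τ < ∫ _τ in n..m, f x m := by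
      refine intervalIntegral.integral_lt_integral_of_continuousOn_of_le_of_exists_lt h
        ((hf.continuousOn_apply x).mono fun t ht => hn.trans ht.1) continuousOn_const
        (fun t ht => (hf.strictMonoOn x).monotoneOn (hn.trans ht.1.le) hm ht.2)
        ⟨n, ⟨le_rfl, h.le⟩, hf.strictMonoOn x hn hm h⟩
    rw [hc] at this
    rw [intervalIntegral.integral_symm] at hsub
    linarith

theorem tangent_le (hf : CouplingCondition f q) (x : Torus d) {m n : ℝ} (hm : 0 ≤ m) (hn : 0 ≤ n) :
    primR f x m + f x m * (n - m) ≤ primR f x n := by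
  rcases eq_or_ne m n with rfl | h
  · simp
  · exact (hf.tangent_lt x hm hn h).le

theorem primR_nonneg (hf : CouplingCondition f q) (x : Torus d) {m : ℝ} (hm : 0 ≤ m) :
    0 ≤ primR f x m := by
  have := hf.tangent_le x le_rfl hm
  rwa [primR_zero, hf.map_zero, zero_mul, add_zero] at this

theorem mul_half_le_primR (hf : CouplingCondition f q) (x : Torus d) {m : ℝ} (hm : 0 ≤ m) :
    f x (m / 2) * (m / 2) ≤ primR f x m := by
  have h1 := hf.tangent_le x (show 0 ≤ m / 2 by positivity) hm
  have h2 := hf.primR_nonneg x (show 0 ≤ m / 2 by positivity)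
  rw [show m - m / 2 = m / 2 by ring] at h1
  linarith

/-- The concave functions `m ↦ a m - F(x,m)` are bounded above, uniformly for bounded `a`. -/
theorem exists_bound (hf : CouplingCondition f q) (A : ℝ) :
    ∃ C : ℝ, 0 ≤ C ∧ ∀ x, ∀ a ≤ A, ∀ m, 0 ≤ m → a * m - primR f x m ≤ C := by
  obtain ⟨C, hC, hgr⟩ := hf.growth
  have hq : 0 < q - 1 := by linarith [hf.one_lt]
  -- beyond `M` the coupling exceeds `|A|`
  obtain ⟨M, hM⟩ := (Filter.tendsto_atTop.1 (tendsto_rpow_atTop hq)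
    (C * (|A| + C))).exists_forall_of_atTop
  set M' := max M 0
  have hf' : ∀ x, |A| ≤ f x M' := fun x => by
    have h1 := (hgr x M' (le_max_right _ _)).1
    have h2 := hM M' (le_max_left _ _)
    have h3 : 1 / C * (C * (|A| + C)) ≤ 1 / C * M' ^ (q - 1) := by gcongr
    have e : 1 / C * (C * (|A| + C)) = |A| + C := by field_simp
    linarith
  have hM0 : 0 ≤ M' := le_max_right _ _
  refine ⟨|A| * M', by positivity, fun x a ha m hm => ?_⟩
  have haA : a * m ≤ |A| * m := by gcongr; exact ha.trans (le_abs_self A)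
  rcases le_total m M' with h | h
  · have := hf.primR_nonneg x hm
    have h4 : |A| * m ≤ |A| * M' := by gcongr
    linarith
  · have h1 := hf.tangent_le x hM0 hm
    have h2 := hf.primR_nonneg x hM0
    have h3 : |A| * (m - M') ≤ f x M' * (m - M') := by
      have := hf' x
      have : 0 ≤ m - M' := by linarith
      gcongr
    linarith

end CouplingCondition

/-- The conjugate of the primitive of the coupling, as a supremum of real numbers. The superlinear
growth of the primitive makes it finite, see `primitiveConj_eq`. -/
def conjR (f : Torus d → ℝ → ℝ) (x : Torus d) (a : ℝ) : ℝ :=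
  sSup ((fun m => a * m - primR f x m) '' Ici 0)

namespace CouplingCondition

theorem isLUB_conjR (hf : CouplingCondition f q) (x : Torus d) (a : ℝ) :
    IsLUB ((fun m => a * m - primR f x m) '' Ici 0) (conjR f x a) := by
  obtain ⟨C, -, hC⟩ := hf.exists_bound a
  refine isLUB_csSup ⟨_, 0, self_mem_Ici, rfl⟩ ⟨C, ?_⟩
  rintro _ ⟨m, hm, rfl⟩
  exact hC x a le_rfl m hm

theorem le_conjR (hf : CouplingCondition f q) (x : Torus d) (a : ℝ) {m : ℝ} (hm : 0 ≤ m) :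
    a * m - primR f x m ≤ conjR f x a := (hf.isLUB_conjR x a).1 ⟨m, hm, rfl⟩

theorem conjR_le (hf : CouplingCondition f q) {x : Torus d} {a c : ℝ}
    (h : ∀ m, 0 ≤ m → a * m - primR f x m ≤ c) : conjR f x a ≤ c :=
  (hf.isLUB_conjR x a).2 (by rintro _ ⟨m, hm, rfl⟩; exact h m hm)

theorem conjR_nonneg (hf : CouplingCondition f q) (x : Torus d) (a : ℝ) : 0 ≤ conjR f x a := by
  have := hf.le_conjR x a le_rfl
  rwa [primR_zero, mul_zero, sub_zero] at this

theorem primitiveConj_eq (hf : CouplingCondition f q) (x : Torus d) (a : ℝ) :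
    primitiveConj f x a = (conjR f x a : EReal) := by
  refine le_antisymm (iSup_le fun m => ?_) ?_
  · rcases lt_or_ge m 0 with h | h
    · rw [primitive_of_neg h]; simp
    · rw [primitive_of_nonneg h, ← EReal.coe_sub]
      refine EReal.coe_le_coe_iff.2 ?_
      have := hf.le_conjR x a h
      simpa [mul_comm] using this
  · have hle : ∀ m : ℝ, 0 ≤ m → ((a * m - primR f x m : ℝ) : EReal) ≤ primitiveConj f x a := by
      intro m hm
      refine le_trans (le_of_eq ?_) (le_iSup _ m)
      rw [primitive_of_nonneg hm, ← EReal.coe_sub]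
      simp [mul_comm]
    induction h : primitiveConj f x a using EReal.rec with
    | bot => rw [h] at hle; simpa using hle 0 le_rfl
    | top => exact le_top
    | coe c =>
      rw [h] at hle
      exact EReal.coe_le_coe_iff.2 (hf.conjR_le fun m hm => EReal.coe_le_coe_iff.1 (hle m hm))

theorem conjR_mono (hf : CouplingCondition f q) (x : Torus d) : Monotone (conjR f x) :=
  fun a b hab => hf.conjR_le fun m hm =>
    le_trans (by gcongr) (hf.le_conjR x b hm)

theorem convexOn_conjR (hf : CouplingCondition f q) (x : Torus d) :
    ConvexOn ℝ univ (conjR f x) := by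
  refine ⟨convex_univ, fun a _ b _ s t hs ht hst => hf.conjR_le fun m hm => ?_⟩
  have h1 := mul_le_mul_of_nonneg_left (hf.le_conjR x a hm) hs
  have h2 := mul_le_mul_of_nonneg_left (hf.le_conjR x b hm) ht
  simp only [smul_eq_mul]
  have e : primR f x m = s * primR f x m + t * primR f x m := by rw [← add_mul, hst, one_mul]
  nlinarith

theorem continuous_conjR (hf : CouplingCondition f q) (x : Torus d) : Continuous (conjR f x) :=
  continuousOn_univ.1 ((hf.convexOn_conjR x).continuousOn isOpen_univ)

/-- The Fenchel equality for the coupling. -/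
theorem conjR_apply (hf : CouplingCondition f q) (x : Torus d) {m : ℝ} (hm : 0 ≤ m) :
    conjR f x (f x m) = f x m * m - primR f x m := by
  refine le_antisymm (hf.conjR_le fun n hn => ?_) (hf.le_conjR x _ hm)
  have := hf.tangent_le x hm hn
  linarith

theorem conjR_of_nonpos (hf : CouplingCondition f q) (x : Torus d) {a : ℝ} (ha : a ≤ 0) :
    conjR f x a = 0 :=
  le_antisymm (hf.conjR_le fun m hm => by
    have := hf.primR_nonneg x hm
    nlinarith [mul_nonneg (neg_nonneg.2 ha) hm]) (hf.conjR_nonneg x a)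

theorem continuous_primR_max (hf : CouplingCondition f q) :
    Continuous fun z : Torus d × ℝ => primR f z.1 (max z.2 0) := by
  have h : Continuous (Function.uncurry fun (z : Torus d × ℝ) (τ : ℝ) => f z.1 (max τ 0)) :=
    hf.continuous_comp_max.comp (f := fun p : (Torus d × ℝ) × ℝ => (p.1.1, p.2)) (by fun_prop)
  have := intervalIntegral.continuous_parametric_intervalIntegral_of_continuous
    (μ := volume) (a₀ := 0) h (s := fun z : Torus d × ℝ => max z.2 0) (by fun_prop)
  convert this using 2 with z
  exact primR_eq _ (le_max_right _ _)

theorem measurable_conjR (hf : CouplingCondition f q) :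
    Measurable fun z : Torus d × ℝ => conjR f z.1 z.2 := by
  set e := TopologicalSpace.denseSeq ℝ
  have h : ∀ z : Torus d × ℝ, conjR f z.1 z.2
      = ⨆ k : ℕ, (z.2 * max (e k) 0 - primR f z.1 (max (e k) 0)) := by
    intro z
    have hb : BddAbove (range fun k : ℕ =>
        z.2 * max (e k) 0 - primR f z.1 (max (e k) 0)) := by
      refine ⟨conjR f z.1 z.2, ?_⟩
      rintro _ ⟨k, rfl⟩
      exact hf.le_conjR _ _ (le_max_right _ _)
    refine le_antisymm (hf.conjR_le fun m hm => ?_) (ciSup_le fun k => ?_)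
    · have hcl : IsClosed {n : ℝ | z.2 * max n 0 - primR f z.1 (max n 0)
          ≤ ⨆ k : ℕ, (z.2 * max (e k) 0 - primR f z.1 (max (e k) 0))} := by
        refine isClosed_le ?_ continuous_const
        have := hf.continuous_primR_max.comp (f := fun n : ℝ => (z.1, n)) (by fun_prop)
        simp only [Function.comp_def] at this
        fun_prop
      have := (TopologicalSpace.denseRange_denseSeq ℝ).induction_on (p := fun n => n ∈ {n : ℝ | _}) m hcl
        fun k => le_ciSup hb k
      rwa [mem_ofPred_eq, max_eq_left hm] at this
    · exact hf.le_conjR _ _ (le_max_right _ _)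
  simp only [h]
  refine Measurable.iSup fun k => ?_
  have := hf.continuous_primR_max.comp
    (f := fun z : Torus d × ℝ => (z.1, e k)) (by fun_prop)
  simp only [Function.comp_def] at this
  exact (measurable_snd.mul_const _).sub this.measurable

end CouplingCondition

end Coupling

/-! ### The Hamiltonian, its conjugate, and the energy density -/

section Hamiltonian

variable {d : ℕ} {f : Torus d → ℝ → ℝ} {H : Torus d → Vec d → ℝ} {q r : ℝ}

/-- The real valued conjugate of the Hamiltonian; `hamConj` is finite by `hamConj_eq_coe`. -/
def hamConjR (H : Torus d → Vec d → ℝ) (x : Torus d) (p : Vec d) : ℝ := (hamConj H x p).toReal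

namespace HamiltonianCondition

theorem continuous_apply (hH : HamiltonianCondition H r) (x : Torus d) : Continuous (H x) :=
  hH.continuous.comp (f := fun ξ : Vec d => (x, ξ)) (by fun_prop)

theorem exists_abs_le (hH : HamiltonianCondition H r) (K : ℝ) :
    ∃ C : ℝ, 0 ≤ C ∧ ∀ x ξ, ‖ξ‖ ≤ K → |H x ξ| ≤ C := by
  obtain ⟨C, hC, h⟩ := hH.growth
  have hr : 0 < r := by linarith [hH.one_lt]
  refine ⟨C / r * |K| ^ r + C, by positivity, fun x ξ hξ => abs_le.2 ⟨?_, ?_⟩⟩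
  · have h1 := (h x ξ).1
    have : 0 ≤ 1 / (r * C) * ‖ξ‖ ^ r := by positivity
    have : 0 ≤ C / r * |K| ^ r := by positivity
    linarith
  · refine (h x ξ).2.trans ?_
    gcongr
    exact hξ.trans (le_abs_self K)

theorem exists_lower_bound (hH : HamiltonianCondition H r) : ∃ C : ℝ, 0 ≤ C ∧ ∀ x ξ, -C ≤ H x ξ := by
  obtain ⟨C, hC, h⟩ := hH.growth
  have hr : 0 < r := by linarith [hH.one_lt]
  refine ⟨C, hC.le, fun x ξ => ?_⟩
  have h1 := (h x ξ).1
  have : 0 ≤ 1 / (r * C) * ‖ξ‖ ^ r := by positivity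
  linarith

/-- The supremum that defines the conjugate of the Hamiltonian is attained. -/
theorem exists_maximizer (hH : HamiltonianCondition H r) (x : Torus d) (p : Vec d) :
    ∃ ξ, ∀ η, inner ℝ p η - H x η ≤ inner ℝ p ξ - H x ξ := by
  obtain ⟨C, hC, h⟩ := hH.growth
  have hr := hH.one_lt
  have hlim : Filter.Tendsto (fun η : Vec d => H x η - inner ℝ p η) (Filter.cocompact _)
      Filter.atTop := by
    have h1 : Filter.Tendsto (fun s : ℝ => s * (1 / (r * C) * s ^ (r - 1) - ‖p‖) - C) Filter.atTop
        Filter.atTop := by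
      refine Filter.tendsto_atTop_add_const_right _ _ (Filter.tendsto_id.atTop_mul_atTop₀ ?_)
      exact Filter.tendsto_atTop_add_const_right _ _
        ((tendsto_rpow_atTop (by linarith)).const_mul_atTop (by positivity))
    refine Filter.tendsto_atTop_mono' _ ?_ (h1.comp (tendsto_norm_cocompact_atTop (E := Vec d)))
    have h0 := (tendsto_norm_cocompact_atTop (E := Vec d)).eventually (Filter.eventually_gt_atTop 0)
    filter_upwards [h0] with η hη
    have h2 := (h x η).1
    have h3 := real_inner_le_norm p η
    have e : ‖η‖ ^ r = ‖η‖ * ‖η‖ ^ (r - 1) := by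
      rw [Real.rpow_sub_one hη.ne']; field_simp
    simp only [Function.comp]
    rw [e] at h2
    nlinarith
  obtain ⟨ξ, hξ⟩ := Continuous.exists_forall_le
    ((hH.continuous_apply x).sub (continuous_const.inner continuous_id)) hlim
  exact ⟨ξ, fun η => by have := hξ η; simp only [Pi.sub_apply, id] at this; linarith⟩

theorem hamConj_eq (hH : HamiltonianCondition H r) (x : Torus d) (p : Vec d) :
    ∃ ξ, (∀ η, inner ℝ p η - H x η ≤ inner ℝ p ξ - H x ξ) ∧
      hamConj H x p = ((inner ℝ p ξ - H x ξ : ℝ) : EReal) := by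
  obtain ⟨ξ, hξ⟩ := hH.exists_maximizer x p
  refine ⟨ξ, hξ, le_antisymm (iSup_le fun η => ?_) ?_⟩
  · rw [← EReal.coe_sub]
    exact EReal.coe_le_coe_iff.2 (hξ η)
  · rw [EReal.coe_sub]
    exact le_iSup (fun η => ((inner ℝ p η : ℝ) : EReal) - ((H x η : ℝ) : EReal)) ξ

theorem hamConj_eq_coe (hH : HamiltonianCondition H r) (x : Torus d) (p : Vec d) :
    hamConj H x p = (hamConjR H x p : EReal) := by
  obtain ⟨ξ, -, h⟩ := hH.hamConj_eq x p
  rw [hamConjR, h, EReal.toReal_coe]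

theorem hamConjR_attained (hH : HamiltonianCondition H r) (x : Torus d) (p : Vec d) :
    ∃ ξ, hamConjR H x p = inner ℝ p ξ - H x ξ := by
  obtain ⟨ξ, -, h⟩ := hH.hamConj_eq x p
  exact ⟨ξ, by rw [hamConjR, h, EReal.toReal_coe]⟩

theorem le_hamConjR (hH : HamiltonianCondition H r) (x : Torus d) (p η : Vec d) :
    inner ℝ p η - H x η ≤ hamConjR H x p := by
  obtain ⟨ξ, hξ, h⟩ := hH.hamConj_eq x p
  rw [hamConjR, h, EReal.toReal_coe]
  exact hξ η

/-- If the supremum in the conjugate of the Hamiltonian at `p` is attained at `ξ`, then `p` is the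
gradient of the Hamiltonian at `ξ`. This is what makes the conjugate strictly convex. -/
theorem eq_gradient_of_hamConjR_eq (hH : HamiltonianCondition H r) {x : Torus d} {p ξ : Vec d}
    (h : hamConjR H x p = inner ℝ p ξ - H x ξ) : p = gradient (H x) ξ := by
  have hmax : IsLocalMax (fun η => inner ℝ p η - H x η) ξ := by
    refine Filter.Eventually.of_forall fun η => ?_
    simp only
    rw [← h]
    exact hH.le_hamConjR x p η
  have h1 : HasFDerivAt (fun η => inner ℝ p η - H x η) (innerSL ℝ p - fderiv ℝ (H x) ξ) ξ :=
    (innerSL ℝ p).hasFDerivAt.sub (hH.differentiable x ξ).hasFDerivAt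
  have h2 := hmax.hasFDerivAt_eq_zero h1
  have h3 : HasGradientAt (H x) (gradient (H x) ξ) ξ :=
    (hH.differentiable x ξ).hasGradientAt
  refine ext_inner_right ℝ fun v => ?_
  have h4 := congrArg (fun L => L v) h2
  have h5 := congrArg (fun L => L v) h3.hasFDerivAt.fderiv
  simp only [sub_apply, innerSL_apply_apply, zero_apply,
    InnerProductSpace.toDual_apply_apply] at h4 h5
  linarith

end HamiltonianCondition

/-- The affine minorants `m c - F^*(x,c) - m H(x,b) - ⟨w,b⟩` of the energy density
`m H^*(x,-w/m) + F(x,m)`, whose supremum over `c` and `b` is the energy density. -/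
def minorant (f : Torus d → ℝ → ℝ) (H : Torus d → Vec d → ℝ) (x : Torus d) (m : ℝ) (w : Vec d)
    (p : ℝ × Vec d) : ℝ :=
  m * p.1 - conjR f x p.1 - m * H x p.2 - inner ℝ w p.2

theorem continuous_minorant (hf : CouplingCondition f q) (hH : HamiltonianCondition H r)
    (x : Torus d) (m : ℝ) (w : Vec d) : Continuous (minorant f H x m w) := by
  have h1 := hf.continuous_conjR x
  have h2 := hH.continuous_apply x
  unfold minorant
  fun_prop

theorem kinetic_of_pos (hH : HamiltonianCondition H r) (x : Torus d) {m : ℝ} (hm : 0 < m)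
    (w : Vec d) : kinetic H x m w = ((m * hamConjR H x (-(m⁻¹ • w)) : ℝ) : EReal) := by
  rw [kinetic, if_neg hm.ne', hH.hamConj_eq_coe, EReal.coe_mul]

theorem minorant_le (hf : CouplingCondition f q) (hH : HamiltonianCondition H r) (x : Torus d)
    {m : ℝ} (hm : 0 ≤ m) (w : Vec d) (p : ℝ × Vec d) :
    (minorant f H x m w p : EReal) ≤ kinetic H x m w + primitive f x m := by
  rw [primitive_of_nonneg hm]
  have h1 := hf.le_conjR x p.1 hm
  rcases hm.eq_or_lt with rfl | hm
  · by_cases hw : w = 0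
    · subst hw
      rw [kinetic, if_pos rfl, if_pos rfl, zero_add, CouplingCondition.primR_zero]
      refine EReal.coe_le_coe_iff.2 ?_
      have := hf.conjR_nonneg x p.1
      simp [minorant, this]
    · rw [kinetic, if_pos rfl, if_neg hw, EReal.top_add_coe]
      exact le_top
  · rw [kinetic_of_pos hH x hm, ← EReal.coe_add]
    refine EReal.coe_le_coe_iff.2 ?_
    have h2 := mul_le_mul_of_nonneg_left (hH.le_hamConjR x (-(m⁻¹ • w)) p.2) hm.le
    have e : m * (inner ℝ (-(m⁻¹ • w)) p.2 - H x p.2) = - inner ℝ w p.2 - m * H x p.2 := by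
      rw [inner_neg_left, inner_smul_left]
      simp only [conj_trivial]
      field_simp
    rw [minorant]
    linarith

/-- The energy density is the supremum of a countable family of its affine minorants. -/
theorem isLUB_minorant (hf : CouplingCondition f q) (hH : HamiltonianCondition H r) (x : Torus d)
    {m : ℝ} (hm : 0 ≤ m) (w : Vec d) :
    IsLUB (range fun k : ℕ =>
      (minorant f H x m w (TopologicalSpace.denseSeq (ℝ × Vec d) k) : EReal))
      (kinetic H x m w + primitive f x m) := by
  constructor
  · rintro _ ⟨k, rfl⟩
    exact minorant_le hf hH x hm w _
  · intro e he
    have hall : ∀ p, (minorant f H x m w p : EReal) ≤ e := by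
      have hcl : IsClosed {p | (minorant f H x m w p : EReal) ≤ e} :=
        isClosed_le (continuous_coe_real_ereal.comp (continuous_minorant hf hH x m w))
          continuous_const
      exact fun p => (TopologicalSpace.denseRange_denseSeq (ℝ × Vec d)).induction_on
        (p := fun p => p ∈ {p | (minorant f H x m w p : EReal) ≤ e}) p hcl fun k => he ⟨k, rfl⟩
    rw [primitive_of_nonneg hm]
    rcases hm.eq_or_lt with rfl | hm
    · rw [CouplingCondition.primR_zero, EReal.coe_zero, add_zero]
      have h0 : conjR f x 0 = 0 := hf.conjR_of_nonpos x le_rfl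
      by_cases hw : w = 0
      · subst hw
        rw [kinetic, if_pos rfl, if_pos rfl]
        simpa [minorant, h0] using hall 0
      · -- for `m = 0` and `w ≠ 0` the minorants along `-w` are unbounded
        rw [kinetic, if_pos rfl, if_neg hw, top_le_iff, EReal.eq_top_iff_forall_lt]
        intro c
        refine lt_of_lt_of_le ?_ (hall (0, -((c + 1) / ‖w‖ ^ 2) • w))
        refine EReal.coe_lt_coe_iff.2 ?_
        have : ‖w‖ ≠ 0 := norm_ne_zero_iff.2 hw
        simp only [minorant, h0, inner_smul_right, real_inner_self_eq_norm_sq]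
        field_simp
        linarith
    · rw [kinetic_of_pos hH x hm, ← EReal.coe_add]
      obtain ⟨ξ, hξ⟩ := hH.hamConjR_attained x (-(m⁻¹ • w))
      refine le_trans (le_of_eq ?_) (hall (f x m, ξ))
      rw [EReal.coe_eq_coe_iff, minorant, hf.conjR_apply x hm.le, hξ, inner_neg_left,
        inner_smul_left]
      simp only [conj_trivial]
      field_simp
      ring

/-- If the affine minorants of the energy density are bounded above, then the density is
nonnegative. -/
theorem nonneg_of_minorant_le (hf : CouplingCondition f q) (hH : HamiltonianCondition H r)
    {x : Torus d} {m : ℝ} {w : Vec d} {e : ℝ}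
    (he : ∀ k : ℕ, minorant f H x m w (TopologicalSpace.denseSeq (ℝ × Vec d) k) ≤ e) : 0 ≤ m := by
  by_contra! hm
  have hcl : IsClosed {p | minorant f H x m w p ≤ e} :=
    isClosed_le (continuous_minorant hf hH x m w) continuous_const
  have hall : ∀ p, minorant f H x m w p ≤ e := fun p =>
    (TopologicalSpace.denseRange_denseSeq (ℝ × Vec d)).induction_on
      (p := fun p => p ∈ {p | minorant f H x m w p ≤ e}) p hcl he
  have h := hall ((|e| + 1 + |m * H x 0|) / m, 0)
  rw [minorant, hf.conjR_of_nonpos x (div_nonpos_of_nonneg_of_nonpos (by positivity) hm.le),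
    mul_div_cancel₀ _ hm.ne] at h
  simp only [inner_zero_right] at h
  linarith [le_abs_self e, le_abs_self (m * H x 0)]

/-- The energy density is measurable where the density is nonnegative. -/
theorem aemeasurable_energy (hf : CouplingCondition f q) (hH : HamiltonianCondition H r)
    {μ : Measure (ℝ × Torus d)} {m : ℝ × Torus d → ℝ} {w : ℝ × Torus d → Vec d}
    (hm : AEMeasurable m μ) (hw : AEMeasurable w μ) (hm0 : ∀ᵐ z ∂μ, 0 ≤ m z) :
    AEMeasurable (fun z => kinetic H z.2 (m z) (w z) + primitive f z.2 (m z)) μ := by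
  have hk : ∀ p : ℝ × Vec d, AEMeasurable (fun z => minorant f H z.2 (m z) (w z) p) μ := by
    intro p
    have h1 : Measurable fun z : ℝ × Torus d => conjR f z.2 p.1 :=
      hf.measurable_conjR.comp (f := fun z : ℝ × Torus d => (z.2, p.1)) (by fun_prop)
    have h2 : Measurable fun z : ℝ × Torus d => H z.2 p.2 :=
      (hH.continuous.comp (f := fun z : ℝ × Torus d => (z.2, p.2)) (by fun_prop)).measurable
    exact (((hm.mul_const _).sub h1.aemeasurable).sub (hm.mul h2.aemeasurable)).sub
      (hw.inner aemeasurable_const)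
  have : AEMeasurable (fun z => ⨆ k : ℕ, (minorant f H z.2 (m z) (w z)
      (TopologicalSpace.denseSeq (ℝ × Vec d) k) : EReal)) μ :=
    AEMeasurable.iSup fun k => (hk _).coe_real_ereal
  refine this.congr ?_
  filter_upwards [hm0] with z hz
  exact (isLUB_minorant hf hH z.2 hz (w z)).iSup_eq

end Hamiltonian

/-! ### Differential calculus on the torus -/

section TorusCalculus

variable {d : ℕ}

theorem toTorus_zero : toTorus (0 : Vec d) = 0 := by ext i; simp [toTorus]

theorem toTorus_add (y v : Vec d) : toTorus (y + v) = toTorus y + toTorus v := by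
  ext i; simp [toTorus]

theorem isOpenQuotientMap_toTorus : IsOpenQuotientMap (toTorus : Vec d → Torus d) := by
  have h1 : IsOpenQuotientMap (Pi.map fun (_ : Fin d) (t : ℝ) => (t : UnitAddCircle)) :=
    IsOpenQuotientMap.piMap fun _ => QuotientAddGroup.isOpenQuotientMap_mk
  exact h1.comp (PiLp.homeomorph 2 (fun _ : Fin d => ℝ)).isOpenQuotientMap

theorem continuous_toTorus : Continuous (toTorus : Vec d → Torus d) :=
  isOpenQuotientMap_toTorus.continuous

theorem surjective_toTorus : Function.Surjective (toTorus : Vec d → Torus d) :=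
  isOpenQuotientMap_toTorus.surjective

instance : IsProbabilityMeasure (volume : Measure UnitAddCircle) :=
  ⟨by simp [AddCircle.measure_univ]⟩
instance : Measure.IsNegInvariant (volume : Measure UnitAddCircle) :=
  Measure.IsAddHaarMeasure.isNegInvariant_of_regular _

instance (T : ℝ) : IsFiniteMeasure (cyl d T) := by unfold cyl; infer_instance

theorem hasGradientAt_translate {u : Torus d → ℝ} {g : Torus d → Vec d}
    (h : ∀ x, HasGradientAt (fun v : Vec d => u (x + toTorus v)) (g x) 0) (x : Torus d) (v : Vec d) :
    HasGradientAt (fun v : Vec d => u (x + toTorus v)) (g (x + toTorus v)) v := by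
  have h1 := h (x + toTorus v)
  rw [hasGradientAt_iff_hasFDerivAt] at h1 ⊢
  have h2 : HasFDerivAt (fun y : Vec d => y - v) (ContinuousLinearMap.id ℝ (Vec d)) v :=
    (hasFDerivAt_id v).sub_const v
  rw [← sub_self v] at h1
  have h3 := HasFDerivAt.comp (f := fun y : Vec d => y - v) v h1 h2
  rw [ContinuousLinearMap.comp_id] at h3
  refine h3.congr_of_eventuallyEq (Filter.Eventually.of_forall fun y => ?_)
  simp only [Function.comp, add_assoc, ← toTorus_add]
  congr 3
  abel

theorem torusGrad_eq {u : Torus d → ℝ} {g : Vec d} {x : Torus d}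
    (h : HasGradientAt (fun v : Vec d => u (x + toTorus v)) g 0) : torusGrad u x = g := h.gradient

/-- The integral of a gradient over the torus vanishes. -/
theorem integral_gradient_eq_zero {u : Torus d → ℝ} {g : Torus d → Vec d} (hg : Continuous g)
    (hu : Continuous u) (h : ∀ x, HasGradientAt (fun v : Vec d => u (x + toTorus v)) (g x) 0) :
    ∫ x, g x = 0 := by
  have hgint : Integrable g volume := hg.integrable_of_hasCompactSupport (.of_compactSpace _)
  have huint : Integrable u volume := hu.integrable_of_hasCompactSupport (.of_compactSpace _)
  -- translate along the integral `e` itself: the mean of `⟨g, e⟩` is `|e|²`, and it is the mean of a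
  -- translation difference of `u`, hence zero
  set e : Vec d := ∫ x, g x with he
  have hder : ∀ x, ∀ s : ℝ, HasDerivAt (fun s : ℝ => u (x + toTorus (s • e)))
      (inner ℝ (g (x + toTorus (s • e))) e) s := by
    intro x s
    have h1 := (hasGradientAt_translate h x (s • e)).hasFDerivAt
    have h2 : HasDerivAt (fun s : ℝ => s • e) e s := by
      simpa using (hasDerivAt_id s).smul_const e
    have h3 := h1.comp_hasDerivAt s h2
    rwa [InnerProductSpace.toDual_apply_apply] at h3
  have hcont : Continuous fun p : Torus d × ℝ => inner ℝ (g (p.1 + toTorus (p.2 • e))) e := by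
    have := continuous_toTorus (d := d)
    fun_prop
  have hftc : ∀ x, ∫ s in (0 : ℝ)..1, inner ℝ (g (x + toTorus (s • e))) e
      = u (x + toTorus e) - u x := by
    intro x
    rw [intervalIntegral.integral_eq_sub_of_hasDerivAt (fun s _ => hder x s)]
    · simp [toTorus_zero]
    · exact (hcont.comp (f := fun s : ℝ => (x, s)) (by fun_prop)).intervalIntegrable _ _
  have h1 : ∫ x, ∫ s in (0 : ℝ)..1, inner ℝ (g (x + toTorus (s • e))) e = 0 := by
    simp only [hftc]
    rw [integral_sub (huint.comp_add_right _) huint, integral_add_right_eq_self, sub_self]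
  have h2 : ∫ x, ∫ s in (0 : ℝ)..1, inner ℝ (g (x + toTorus (s • e))) e = inner ℝ e e := by
    simp only [intervalIntegral.integral_of_le zero_le_one]
    rw [integral_integral_swap]
    · have : ∀ s : ℝ, ∫ x, inner ℝ (g (x + toTorus (s • e))) e = inner ℝ e e := by
        intro s
        rw [integral_add_right_eq_self (μ := volume) (fun x => inner ℝ (g x) e)]
        simp only [real_inner_comm e]
        rw [integral_inner hgint, he]
      simp [this]
    · obtain ⟨C, hC⟩ := isCompact_univ.exists_bound_of_continuousOn hg.continuousOn
      refine Integrable.of_bound hcont.aestronglyMeasurable (C * ‖e‖) (ae_of_all _ fun p => ?_)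
      exact (norm_inner_le_norm _ _).trans (by gcongr; exact hC _ (mem_univ _))
  exact inner_self_eq_zero.1 (h2.symm.trans h1)

/-- The value and the derivatives of a function of class `C¹` on `[0,T] × 𝕋^d`, as bounded continuous
functions on `ℝ × 𝕋^d`. Only their values at times in `[0,T]` are prescribed. -/
structure C1Data (T : ℝ) (φ : ℝ → Torus d → ℝ) where
  /-- the function itself -/
  val : ℝ × Torus d → ℝ
  /-- the time derivative -/
  dt : ℝ × Torus d → ℝ
  /-- the space gradient -/
  grad : ℝ × Torus d → Vec d
  continuous_val : Continuous val
  continuous_dt : Continuous dt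
  continuous_grad : Continuous grad
  val_eq : ∀ t ∈ Icc 0 T, ∀ x, val (t, x) = φ t x
  hasDerivAt : ∀ t ∈ Ioo 0 T, ∀ x, HasDerivAt (fun s => φ s x) (dt (t, x)) t
  hasGradientAt : ∀ t ∈ Icc 0 T, ∀ x,
    HasGradientAt (fun v : Vec d => φ t (x + toTorus v)) (grad (t, x)) 0
  exists_bound : ∃ C : ℝ, 0 ≤ C ∧ ∀ z, |val z| ≤ C ∧ |dt z| ≤ C ∧ ‖grad z‖ ≤ C

/-- A continuous function of `ℝ^d` that factors through the torus is continuous on the torus. -/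
theorem continuous_lift {X Y : Type*} [TopologicalSpace X] [TopologicalSpace Y]
    {g : X × Vec d → Y} (hg : Continuous g)
    (hper : ∀ t y y', toTorus y = toTorus y' → g (t, y) = g (t, y')) :
    Continuous fun z : X × Torus d => g (z.1, Function.surjInv surjective_toTorus z.2) := by
  have hq : IsOpenQuotientMap (Prod.map id toTorus : X × Vec d → X × Torus d) :=
    IsOpenQuotientMap.id.prodMap isOpenQuotientMap_toTorus
  rw [← hq.continuous_comp_iff]
  have : (fun z : X × Torus d => g (z.1, Function.surjInv surjective_toTorus z.2)) ∘
      (Prod.map id toTorus : X × Vec d → X × Torus d) = g := by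
    funext z
    exact hper _ _ _ (Function.surjInv_eq surjective_toTorus _)
  rwa [this]

theorem fderivWithin_eq_of_toTorus_eq {T : ℝ} (hT : 0 < T) {φ : ℝ → Torus d → ℝ}
    (hφ : ContDiffOn ℝ 1 (fun z : ℝ × Vec d => φ z.1 (toTorus z.2)) (Icc 0 T ×ˢ univ))
    {t : ℝ} (ht : t ∈ Icc 0 T) {y y' : Vec d} (hy : toTorus y = toTorus y') :
    fderivWithin ℝ (fun z : ℝ × Vec d => φ z.1 (toTorus z.2)) (Icc 0 T ×ˢ univ) (t, y)
      = fderivWithin ℝ (fun z : ℝ × Vec d => φ z.1 (toTorus z.2)) (Icc 0 T ×ˢ univ) (t, y') := by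
  set F : ℝ × Vec d → ℝ := fun z => φ z.1 (toTorus z.2) with hF
  set S : Set (ℝ × Vec d) := Icc 0 T ×ˢ univ with hS
  have hU : UniqueDiffOn ℝ S := (uniqueDiffOn_Icc hT).prod uniqueDiffOn_univ
  have h1 := (hφ.differentiableOn one_ne_zero (t, y') ⟨ht, mem_univ _⟩).hasFDerivWithinAt
  have h2 : HasFDerivWithinAt (fun z : ℝ × Vec d => z + ((0, y' - y) : ℝ × Vec d))
      (ContinuousLinearMap.id ℝ (ℝ × Vec d)) S (t, y) :=
    ((hasFDerivAt_id _).add_const _).hasFDerivWithinAt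
  have e : (t, y') = (fun z : ℝ × Vec d => z + ((0, y' - y) : ℝ × Vec d)) (t, y) := by simp
  rw [e] at h1
  have h3 := HasFDerivWithinAt.comp (t, y) h1 h2
    (show MapsTo _ S S from fun z hz => ⟨by simpa using hz.1, mem_univ _⟩)
  rw [ContinuousLinearMap.comp_id, ← e] at h3
  have h4 : F ∘ (fun z : ℝ × Vec d => z + ((0, y' - y) : ℝ × Vec d)) = F := by
    funext z
    have : toTorus (y' - y) = 0 := by
      have : toTorus y' = toTorus (y' - y) + toTorus y := by rw [← toTorus_add]; simp
      rw [hy] at this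
      simpa using this
    simp [hF, toTorus_add, this]
  rw [h4] at h3
  exact h3.fderivWithin (hU _ ⟨ht, mem_univ _⟩)

theorem exists_bound_of_projIcc {T : ℝ} (hT : 0 ≤ T) {V : Type*} [NormedAddCommGroup V]
    {g : ℝ × Torus d → V} (hg : Continuous g)
    (hgP : ∀ z, g ((projIcc 0 T hT z.1 : ℝ), z.2) = g z) : ∃ C, ∀ z, ‖g z‖ ≤ C := by
  obtain ⟨C, hC⟩ := (isCompact_Icc.prod isCompact_univ).exists_bound_of_continuousOn
    (hg.continuousOn (s := Icc (0 : ℝ) T ×ˢ (univ : Set (Torus d))))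
  exact ⟨C, fun z => hgP z ▸ hC _ ⟨(projIcc 0 T hT z.1).2, mem_univ _⟩⟩

theorem exists_C1Data {T : ℝ} (hT : 0 < T) {φ : ℝ → Torus d → ℝ}
    (hφ : ContDiffOn ℝ 1 (fun z : ℝ × Vec d => φ z.1 (toTorus z.2)) (Icc 0 T ×ˢ univ)) :
    Nonempty (C1Data T φ) := by
  set F : ℝ × Vec d → ℝ := fun z => φ z.1 (toTorus z.2) with hF
  set S : Set (ℝ × Vec d) := Icc 0 T ×ˢ univ with hS
  have hU : UniqueDiffOn ℝ S := (uniqueDiffOn_Icc hT).prod uniqueDiffOn_univ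
  have hdiff : ∀ z ∈ S, HasFDerivWithinAt F (fderivWithin ℝ F S z) S z := fun z hz =>
    (hφ.differentiableOn one_ne_zero z hz).hasFDerivWithinAt
  set P : ℝ → ℝ := fun t => projIcc 0 T hT.le t with hP
  have hPmem : ∀ t, P t ∈ Icc 0 T := fun t => (projIcc 0 T hT.le t).2
  have hPc : Continuous P := continuous_subtype_val.comp continuous_projIcc
  have hPeq : ∀ t ∈ Icc 0 T, P t = t := fun t ht => by simp [hP, projIcc_of_mem hT.le ht]
  have hPc' : Continuous fun z : ℝ × Vec d => (P z.1, z.2) := by fun_prop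
  have hmaps : ∀ z : ℝ × Vec d, (P z.1, z.2) ∈ S := fun z => ⟨hPmem _, mem_univ _⟩
  have hGc : Continuous fun z : ℝ × Vec d => fderivWithin ℝ F S (P z.1, z.2) :=
    (hφ.continuousOn_fderivWithin hU le_rfl).comp_continuous hPc' hmaps
  have hFc : Continuous fun z : ℝ × Vec d => F (P z.1, z.2) :=
    hφ.continuousOn.comp_continuous hPc' hmaps
  set σ : Torus d → Vec d := Function.surjInv surjective_toTorus
  have hσ : ∀ x, toTorus (σ x) = x := Function.surjInv_eq surjective_toTorus
  have hval : Continuous fun z : ℝ × Torus d => F (P z.1, σ z.2) :=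
    continuous_lift hFc fun t y y' h => by simp [hF, h]
  have hD : Continuous fun z : ℝ × Torus d => fderivWithin ℝ F S (P z.1, σ z.2) :=
    continuous_lift hGc fun t y y' h => fderivWithin_eq_of_toTorus_eq hT hφ (hPmem t) h
  have hdt : Continuous fun z : ℝ × Torus d => fderivWithin ℝ F S (P z.1, σ z.2) (1, 0) :=
    hD.clm_apply continuous_const
  have hgr : Continuous fun z : ℝ × Torus d => (InnerProductSpace.toDual ℝ (Vec d)).symm
      ((fderivWithin ℝ F S (P z.1, σ z.2)).comp (ContinuousLinearMap.inr ℝ ℝ (Vec d))) :=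
    (InnerProductSpace.toDual ℝ (Vec d)).symm.continuous.comp (hD.clm_comp continuous_const)
  have hPP : ∀ t, P (projIcc 0 T hT.le t : ℝ) = P t := fun t => hPeq _ (hPmem t)
  obtain ⟨C₁, hC₁⟩ := exists_bound_of_projIcc hT.le hval fun z => by
    simp only [hPP]
  obtain ⟨C₂, hC₂⟩ := exists_bound_of_projIcc hT.le hdt fun z => by
    simp only [hPP]
  obtain ⟨C₃, hC₃⟩ := exists_bound_of_projIcc hT.le hgr fun z => by
    simp only [hPP]
  have hval_eq : ∀ t ∈ Icc 0 T, ∀ x, F (P t, σ x) = φ t x := fun t ht x => by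
    simp [hF, hPeq t ht, hσ]
  have hder : ∀ t ∈ Ioo 0 T, ∀ x, HasDerivAt (fun s => φ s x)
      (fderivWithin ℝ F S (P t, σ x) (1, 0)) t := by
    intro t ht x
    have ht' := Ioo_subset_Icc_self ht
    rw [hPeq t ht']
    have h1 : HasFDerivAt F (fderivWithin ℝ F S (t, σ x)) (t, σ x) :=
      (hdiff (t, σ x) ⟨ht', mem_univ _⟩).hasFDerivAt
        (prod_mem_nhds (Icc_mem_nhds ht.1 ht.2) Filter.univ_mem)
    have h2 : HasDerivAt (fun s : ℝ => (s, σ x)) ((1, 0) : ℝ × Vec d) t :=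
      (hasDerivAt_id t).prodMk (hasDerivAt_const _ _)
    have h3 := HasFDerivAt.comp_hasDerivAt (f := fun s : ℝ => (s, σ x)) t h1 h2
    simpa only [hF, Function.comp_def, hσ] using h3
  have hgrad : ∀ t ∈ Icc 0 T, ∀ x, HasGradientAt (fun v : Vec d => φ t (x + toTorus v))
      ((InnerProductSpace.toDual ℝ (Vec d)).symm
        ((fderivWithin ℝ F S (P t, σ x)).comp (ContinuousLinearMap.inr ℝ ℝ (Vec d)))) 0 := by
    intro t ht x
    rw [hPeq t ht, hasGradientAt_iff_hasFDerivAt, LinearIsometryEquiv.apply_symm_apply]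
    have h1 := hdiff (t, σ x) ⟨ht, mem_univ _⟩
    have h2 : HasFDerivAt (fun v : Vec d => (t, σ x + v))
        (ContinuousLinearMap.inr ℝ ℝ (Vec d)) 0 :=
      (hasFDerivAt_const (𝕜 := ℝ) t (0 : Vec d)).prodMk
        ((hasFDerivAt_id (𝕜 := ℝ) (0 : Vec d)).const_add (σ x))
    have e : (t, σ x) = (fun v : Vec d => (t, σ x + v)) 0 := by simp
    rw [e] at h1
    have h3 := HasFDerivWithinAt.comp_hasFDerivAt (f := fun v : Vec d => (t, σ x + v)) 0 h1 h2
      (Filter.Eventually.of_forall fun v => ⟨ht, mem_univ _⟩)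
    simpa only [hF, Function.comp_def, toTorus_add, hσ, add_zero] using h3
  exact ⟨⟨fun z => F (P z.1, σ z.2), _, _, hval, hdt, hgr, hval_eq, hder, hgrad,
    max C₁ (max C₂ C₃), le_trans ((norm_nonneg _).trans (hC₁ (0, 0)))
      (le_max_left _ _), fun z => ⟨(hC₁ z).trans (le_max_left _ _),
      (hC₂ z).trans ((le_max_left _ _).trans (le_max_right _ _)),
      (hC₃ z).trans ((le_max_right _ _).trans (le_max_right _ _))⟩⟩⟩

end TorusCalculus

/-! ### Mollification on the torus -/

section Mollification

variable {d : ℕ}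

theorem exists_continuous_gradient {u : Torus d → ℝ} (hu : ContDiff ℝ 1 fun y => u (toTorus y)) :
    ∃ g : Torus d → Vec d, Continuous g ∧
      ∀ x, HasGradientAt (fun v : Vec d => u (x + toTorus v)) (g x) 0 := by
  obtain ⟨D⟩ := exists_C1Data one_pos (φ := fun _ => u)
    (hu.comp (contDiff_snd (E := ℝ))).contDiffOn
  exact ⟨fun x => D.grad (0, x), D.continuous_grad.comp (by fun_prop),
    fun x => D.hasGradientAt 0 ⟨le_rfl, zero_le_one⟩ x⟩

theorem continuous_of_comp_toTorus {Y : Type*} [TopologicalSpace Y] {u : Torus d → Y}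
    (hu : Continuous fun y => u (toTorus y)) : Continuous u :=
  isOpenQuotientMap_toTorus.continuous_comp_iff.1 hu

/-- A trigonometric polynomial with values in `[1, ∞)` and a strict maximum at the origin. -/
def bump (x : Torus d) : ℝ := 1 + ∑ i, (1 + (fourier 1 (x i) : ℂ).re)

theorem contDiff_bump : ContDiff ℝ (⊤ : ℕ∞) fun y : Vec d => bump (toTorus y) := by
  have : ∀ y : Vec d, bump (toTorus y) = 1 + ∑ i, (1 + Real.cos (2 * Real.pi * y i)) := by
    intro y
    simp only [bump, toTorus, fourier_coe_apply]
    congr 1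
    refine Finset.sum_congr rfl fun i _ => ?_
    congr 1
    rw [← Complex.exp_ofReal_mul_I_re]
    congr 2
    push_cast
    ring
  simp only [this]
  fun_prop

theorem continuous_bump : Continuous (bump : Torus d → ℝ) :=
  continuous_of_comp_toTorus contDiff_bump.continuous

theorem re_fourier_le (n : ℤ) (z : UnitAddCircle) : |(fourier n z : ℂ).re| ≤ 1 := by
  refine (Complex.abs_re_le_norm _).trans ?_
  rw [fourier_apply, Circle.norm_coe]

theorem one_le_bump (x : Torus d) : 1 ≤ bump x := by
  rw [bump, le_add_iff_nonneg_right]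
  exact Finset.sum_nonneg fun i _ => by linarith [(abs_le.1 (re_fourier_le 1 (x i))).1]

theorem bump_lt {x : Torus d} (hx : x ≠ 0) : bump x < bump (0 : Torus d) := by
  obtain ⟨i, hi⟩ := Function.ne_iff.1 hx
  rw [bump, bump, add_lt_add_iff_left]
  refine Finset.sum_lt_sum (fun j _ => ?_) ⟨i, Finset.mem_univ _, ?_⟩
  · simpa using (abs_le.1 (re_fourier_le 1 (x j))).2
  · have h1 : (fourier 1 (x i) : ℂ).re ≠ 1 := by
      intro h
      have h2 : ‖(fourier 1 (x i) : ℂ)‖ = 1 := by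
        rw [fourier_apply, Circle.norm_coe]
      have h3 : (fourier 1 (x i) : ℂ) = 1 := by
        have := Complex.sq_norm_sub_sq_re (fourier 1 (x i) : ℂ)
        rw [h2, h] at this
        refine Complex.ext h (by simpa using this.symm)
      rw [fourier_apply, one_smul] at h3
      apply hi
      have h4 : AddCircle.toCircle (x i) = 1 := Circle.ext (by rw [h3, Circle.coe_one])
      exact AddCircle.injective_toCircle one_ne_zero (by rw [h4]; simp)
    have := (abs_le.1 (re_fourier_le 1 (x i))).2
    have := lt_of_le_of_ne this h1
    simpa using this

/-- The normalized powers of `bump`, a sequence of smooth approximate identities on the torus. -/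
def kern (n : ℕ) (x : Torus d) : ℝ := (∫ y : Torus d, bump y ^ n)⁻¹ * bump x ^ n

theorem contDiff_kern (n : ℕ) : ContDiff ℝ (⊤ : ℕ∞) fun y : Vec d => kern n (toTorus y) := by
  have := contDiff_bump (d := d)
  unfold kern
  fun_prop

theorem continuous_kern (n : ℕ) : Continuous (kern n : Torus d → ℝ) :=
  continuous_of_comp_toTorus (contDiff_kern n).continuous

theorem kern_nonneg (n : ℕ) (x : Torus d) : 0 ≤ kern n x := by
  have h : ∀ y : Torus d, 0 ≤ bump y ^ n := fun y =>
    pow_nonneg (zero_le_one.trans (one_le_bump y)) n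
  exact mul_nonneg (inv_nonneg.2 (integral_nonneg h)) (h x)

theorem integrable_of_continuous {V : Type*} [NormedAddCommGroup V] {g : Torus d → V}
    (hg : Continuous g) {μ : Measure (Torus d)} [IsFiniteMeasure μ] : Integrable g μ :=
  hg.integrable_of_hasCompactSupport (.of_compactSpace _)

theorem integral_kern (n : ℕ) : ∫ x : Torus d, kern n x = 1 := by
  have h1 : 1 ≤ ∫ y : Torus d, bump y ^ n := by
    have : ∫ _y : Torus d, (1 : ℝ) ≤ ∫ y : Torus d, bump y ^ n :=
      integral_mono (integrable_const _) (integrable_of_continuous (continuous_bump.pow n))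
        fun y => one_le_pow₀ (one_le_bump y)
    simpa using this
  simp only [kern]
  rw [integral_const_mul, inv_mul_cancel₀ (by linarith)]

/-- The convolution of a function on the torus with the kernel. -/
def moll {V : Type*} [NormedAddCommGroup V] [NormedSpace ℝ V] (n : ℕ) (g : Torus d → V)
    (x : Torus d) : V := ∫ y, kern n (x - y) • g y

theorem tendsto_moll {V : Type*} [NormedAddCommGroup V] [NormedSpace ℝ V] [CompleteSpace V]
    {g : Torus d → V} (hg : Continuous g) (x : Torus d) :
    Filter.Tendsto (fun n => moll n g x) Filter.atTop (nhds (g x)) := by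
  have h := tendsto_setIntegral_pow_smul_of_unique_maximum_of_isCompact_of_continuousOn
    (μ := (volume : Measure (Torus d))) (s := univ) (x₀ := 0) (c := bump) isCompact_univ
    continuous_bump.continuousOn (fun y _ hy => bump_lt hy)
    (fun y _ => zero_le_one.trans (one_le_bump y)) (zero_lt_one.trans_le (one_le_bump 0)) (by simp)
    (g := fun u => g (x - u)) (hg.comp (by fun_prop)).continuousOn
  simp only [Measure.restrict_univ, sub_zero] at h
  refine h.congr fun n => ?_
  rw [moll, ← integral_sub_left_eq_self (fun y => kern n (x - y) • g y) volume x, ← integral_smul]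
  refine integral_congr_ae (ae_of_all _ fun u => ?_)
  simp [kern, smul_smul]

theorem norm_moll_le {V : Type*} [NormedAddCommGroup V] [NormedSpace ℝ V]
    (n : ℕ) {g : Torus d → V} {C : ℝ} (hC : ∀ y, ‖g y‖ ≤ C) (x : Torus d) : ‖moll n g x‖ ≤ C := by
  have hk : Integrable (fun y => kern n (x - y)) (volume : Measure (Torus d)) :=
    integrable_of_continuous ((continuous_kern n).comp (by fun_prop))
  have h1 := norm_integral_le_of_norm_le (f := fun y => kern n (x - y) • g y) (hk.mul_const C)
    (ae_of_all _ fun y => by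
      rw [norm_smul, Real.norm_of_nonneg (kern_nonneg _ _)]
      have := kern_nonneg n (x - y)
      gcongr
      exact hC y)
  rw [integral_mul_const, integral_sub_left_eq_self (kern n) volume x, integral_kern, one_mul] at h1
  exact h1

theorem hasGradientAt_kern_sub {g : Torus d → Vec d} {n : ℕ}
    (h : ∀ x, HasGradientAt (fun v : Vec d => kern n (x + toTorus v)) (g x) 0) (x y : Torus d) :
    HasGradientAt (fun v : Vec d => kern n (x - (y + toTorus v))) (-g (x - y)) 0 := by
  have h1 := h (x - y)
  rw [hasGradientAt_iff_hasFDerivAt] at h1 ⊢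
  have h2 : HasFDerivAt (fun v : Vec d => -v) (-ContinuousLinearMap.id ℝ (Vec d)) 0 :=
    (hasFDerivAt_id _).neg
  have e : (0 : Vec d) = (fun v : Vec d => -v) 0 := by simp
  rw [e] at h1
  have h3 := HasFDerivAt.comp (f := fun v : Vec d => -v) 0 h1 h2
  rw [map_neg]
  refine (h3.congr_fderiv ?_).congr_of_eventuallyEq (Filter.Eventually.of_forall fun v => ?_)
  · ext v; simp
  · have : toTorus (-v) = -toTorus v := by ext i; simp [toTorus]
    simp only [Function.comp, this]
    congr 1
    abel

/-- Integration by parts against the kernel. -/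
theorem integral_smul_gradient_kern {k' : Torus d → Vec d} {n : ℕ} (hk' : Continuous k')
    (h : ∀ x, HasGradientAt (fun v : Vec d => kern n (x + toTorus v)) (k' x) 0)
    {u : Torus d → ℝ} {g : Torus d → Vec d} (hu : Continuous u) (hg : Continuous g)
    (hug : ∀ x, HasGradientAt (fun v : Vec d => u (x + toTorus v)) (g x) 0) (x : Torus d) :
    ∫ y, u y • k' (x - y) = moll n g x := by
  have hkc := continuous_kern (d := d) n
  have c1 : Continuous fun y => u y • k' (x - y) := by fun_prop
  have c2 : Continuous fun y => kern n (x - y) • g y := by fun_prop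
  have h0 := integral_gradient_eq_zero (u := fun y => kern n (x - y) * u y)
    (g := fun y => kern n (x - y) • g y - u y • k' (x - y)) (c2.sub c1) (by fun_prop) (by
      intro y
      have h1 := hasGradientAt_kern_sub h x y
      have h2 := hug y
      rw [hasGradientAt_iff_hasFDerivAt] at h1 h2 ⊢
      have h3 := h1.mul h2
      simp only [toTorus_zero, add_zero] at h3
      refine h3.congr_fderiv ?_
      ext v
      simp
      ring)
  rw [integral_sub (integrable_of_continuous c2) (integrable_of_continuous c1)] at h0
  rw [moll]
  exact (sub_eq_zero.1 h0).symm

end Mollification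

section TimeIntegration

variable {T : ℝ}

/-- Integration by parts in time: if `η' = κ` and `η(T) = 0`, then
`∫_0^T η W = - ∫_0^T κ(t) (∫_0^t W) dt`. -/
theorem integral_mul_primitive {W κ η : ℝ → ℝ}
    (hW : Integrable W (volume.restrict (Ioo 0 T))) (hκ : Integrable κ (volume.restrict (Ioo 0 T)))
    (hη : ∀ t ∈ Ioo 0 T, η t = -∫ s in t..T, κ s) :
    ∫ t in Ioo 0 T, η t * W t = -∫ t in Ioo 0 T, κ t * ∫ s in (0 : ℝ)..t, W s := by
  set μ : Measure ℝ := volume.restrict (Ioo 0 T) with hμ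
  have hms : MeasurableSet {p : ℝ × ℝ | p.1 < p.2} := measurableSet_lt measurable_fst measurable_snd
  have hint : Integrable (Function.uncurry fun t s : ℝ =>
      {p : ℝ × ℝ | p.1 < p.2}.indicator (fun p => W p.1 * κ p.2) (t, s)) (μ.prod μ) :=
    (hW.mul_prod hκ).indicator hms
  have hswap := integral_integral_swap hint
  have e1 : ∀ t ∈ Ioo 0 T, ∫ s, {p : ℝ × ℝ | p.1 < p.2}.indicator (fun p => W p.1 * κ p.2) (t, s) ∂μ
      = - (η t * W t) := by
    intro t ht
    have : ∀ s, {p : ℝ × ℝ | p.1 < p.2}.indicator (fun p => W p.1 * κ p.2) (t, s)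
        = W t * (Ioi t).indicator κ s := fun s => by
      by_cases h : t < s <;> simp [h, indicator]
    simp only [this]
    rw [integral_const_mul, integral_indicator measurableSet_Ioi, hμ,
      Measure.restrict_restrict measurableSet_Ioi,
      show Ioi t ∩ Ioo 0 T = Ioo t T by
        ext s; simp only [mem_inter_iff, mem_Ioi, mem_Ioo]
        exact ⟨fun h => ⟨h.1, h.2.2⟩, fun h => ⟨h.1, ht.1.trans h.1, h.2⟩⟩,
      hη t ht, intervalIntegral.integral_of_le ht.2.le, integral_Ioc_eq_integral_Ioo]
    ring
  have e2 : ∀ s ∈ Ioo 0 T, ∫ t, {p : ℝ × ℝ | p.1 < p.2}.indicator (fun p => W p.1 * κ p.2) (t, s) ∂μ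
      = κ s * ∫ t in (0 : ℝ)..s, W t := by
    intro s hs
    have : ∀ t, {p : ℝ × ℝ | p.1 < p.2}.indicator (fun p => W p.1 * κ p.2) (t, s)
        = κ s * (Iio s).indicator W t := fun t => by
      by_cases h : t < s <;> simp [h, indicator, mul_comm]
    simp only [this]
    rw [integral_const_mul, integral_indicator measurableSet_Iio, hμ,
      Measure.restrict_restrict measurableSet_Iio,
      show Iio s ∩ Ioo 0 T = Ioo 0 s by
        ext t; simp only [mem_inter_iff, mem_Iio, mem_Ioo]
        exact ⟨fun h => ⟨h.2.1, h.1⟩, fun h => ⟨h.2, h.1, h.2.trans hs.2⟩⟩,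
      intervalIntegral.integral_of_le hs.1.le, integral_Ioc_eq_integral_Ioo]
  rw [hμ, setIntegral_congr_fun measurableSet_Ioo e1, setIntegral_congr_fun measurableSet_Ioo e2,
    integral_neg] at hswap
  rw [← hswap, neg_neg]

end TimeIntegration

/-! ### The continuity equation tested with products -/

section WeakEquation

variable {d : ℕ} {T : ℝ} {m₀ : Torus d → ℝ} {m : ℝ × Torus d → ℝ} {w : ℝ × Torus d → Vec d}

theorem ae_mem_Ioo_cyl : ∀ᵐ z ∂(cyl d T), z.1 ∈ Ioo 0 T :=
  Measure.quasiMeasurePreserving_fst.ae (ae_restrict_mem measurableSet_Ioo)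

theorem integrable_mul_of_bound (hm : Integrable m (cyl d T)) {b : ℝ × Torus d → ℝ}
    (hb : AEStronglyMeasurable b (cyl d T)) {C : ℝ} (h : ∀ t ∈ Ioo 0 T, ∀ x, |b (t, x)| ≤ C) :
    Integrable (fun z => m z * b z) (cyl d T) := by
  have := hm.bdd_mul hb (c := C) (ae_mem_Ioo_cyl.mono fun z hz => h z.1 hz z.2)
  simpa [mul_comm] using this

theorem integrable_inner_of_bound (hw : Integrable w (cyl d T)) {b : ℝ × Torus d → Vec d}
    (hb : AEStronglyMeasurable b (cyl d T)) {C : ℝ} (h : ∀ t ∈ Ioo 0 T, ∀ x, ‖b (t, x)‖ ≤ C) :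
    Integrable (fun z => inner ℝ (w z) (b z)) (cyl d T) := by
  refine (hw.norm.mul_const C).mono' (hw.1.inner hb) ?_
  filter_upwards [ae_mem_Ioo_cyl] with z hz
  exact (norm_inner_le_norm _ _).trans (by gcongr; exact h z.1 hz z.2)

theorem exists_bound_torus {V : Type*} [NormedAddCommGroup V] {g : Torus d → V}
    (hg : Continuous g) : ∃ C, ∀ x, ‖g x‖ ≤ C := by
  obtain ⟨C, hC⟩ := isCompact_univ.exists_bound_of_continuousOn hg.continuousOn
  exact ⟨C, fun x => hC x (mem_univ _)⟩

theorem integral_cyl {f : ℝ × Torus d → ℝ} (hf : Integrable f (cyl d T)) :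
    ∫ z, f z ∂(cyl d T) = ∫ t in Ioo 0 T, ∫ x, f (t, x) := integral_prod f hf

theorem integrable_moment (hm : Integrable m (cyl d T)) {ξ : Torus d → ℝ} (hξ : Continuous ξ) :
    Integrable (fun t => ∫ x, m (t, x) * ξ x) (volume.restrict (Ioo 0 T)) := by
  obtain ⟨C, hC⟩ := exists_bound_torus hξ
  exact (integrable_mul_of_bound hm (b := fun z => ξ z.2)
    (hξ.comp continuous_snd).aestronglyMeasurable fun t _ x => hC x).integral_prod_left

theorem integrable_flux_moment (hw : Integrable w (cyl d T)) {g : Torus d → Vec d}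
    (hg : Continuous g) :
    Integrable (fun t => ∫ x, inner ℝ (w (t, x)) (g x)) (volume.restrict (Ioo 0 T)) := by
  obtain ⟨C, hC⟩ := exists_bound_torus hg
  exact (integrable_inner_of_bound hw (b := fun z => g z.2)
    (hg.comp continuous_snd).aestronglyMeasurable fun t _ x => hC x).integral_prod_left

/-- The weak equation, tested against a product `η(t) ξ(x)`, as an equation in time only. -/
theorem integral_product_test (hm : Integrable m (cyl d T)) (hw : Integrable w (cyl d T))
    {ξ : Torus d → ℝ} {g : Torus d → Vec d} (hξ : Continuous ξ) (hg : Continuous g)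
    {κ η : ℝ → ℝ} (hκ : Continuous κ) (hη : ContinuousOn η (Icc 0 T)) :
    ∫ z, (m z * (κ z.1 * ξ z.2) + inner ℝ (w z) (η z.1 • g z.2)) ∂(cyl d T)
      = (∫ t in Ioo 0 T, κ t * ∫ x, m (t, x) * ξ x)
        + ∫ t in Ioo 0 T, η t * ∫ x, inner ℝ (w (t, x)) (g x) := by
  obtain ⟨C₁, hC₁⟩ := exists_bound_torus hξ
  obtain ⟨C₂, hC₂⟩ := exists_bound_torus hg
  obtain ⟨K₁, hK₁⟩ := isCompact_Icc.exists_bound_of_continuousOn (hκ.continuousOn (s := Icc 0 T))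
  obtain ⟨K₂, hK₂⟩ := isCompact_Icc.exists_bound_of_continuousOn hη
  have hηm : AEStronglyMeasurable (fun z : ℝ × Torus d => η z.1) (cyl d T) := by
    have h1 : AEStronglyMeasurable η (volume.restrict (Ioo 0 T)) :=
      (hη.mono Ioo_subset_Icc_self).aestronglyMeasurable measurableSet_Ioo
    exact h1.comp_quasiMeasurePreserving Measure.quasiMeasurePreserving_fst
  have i1 : Integrable (fun z => m z * (κ z.1 * ξ z.2)) (cyl d T) :=
    integrable_mul_of_bound hm (C := K₁ * C₁) (by
      have : Continuous fun z : ℝ × Torus d => κ z.1 * ξ z.2 := by fun_prop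
      exact this.aestronglyMeasurable) fun t ht x => by
        have h1 := hK₁ t (Ioo_subset_Icc_self ht)
        have h2 := hC₁ x
        rw [Real.norm_eq_abs] at h1 h2
        rw [abs_mul]
        exact mul_le_mul h1 h2 (abs_nonneg _) ((abs_nonneg _).trans h1)
  have i2 : Integrable (fun z => inner ℝ (w z) (η z.1 • g z.2)) (cyl d T) :=
    integrable_inner_of_bound hw (C := K₂ * C₂)
      (hηm.smul (hg.comp continuous_snd).aestronglyMeasurable) fun t ht x => by
        have h1 := hK₂ t (Ioo_subset_Icc_self ht)
        rw [norm_smul]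
        exact mul_le_mul h1 (hC₂ x) (norm_nonneg _) ((norm_nonneg _).trans h1)
  rw [integral_add i1 i2, integral_cyl i1, integral_cyl i2]
  congr 1
  · refine integral_congr_ae (ae_of_all _ fun t => ?_)
    simp only
    rw [← integral_const_mul]
    exact integral_congr_ae (ae_of_all _ fun x => by simp only; ring)
  · refine integral_congr_ae (ae_of_all _ fun t => ?_)
    simp only
    rw [← integral_const_mul]
    exact integral_congr_ae (ae_of_all _ fun x => by simp only [inner_smul_right])

theorem continuousOn_primitive_Icc (hT : 0 < T) {W : ℝ → ℝ}
    (hW : Integrable W (volume.restrict (Ioo 0 T))) :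
    ContinuousOn (fun t => ∫ s in (0 : ℝ)..t, W s) (Icc 0 T) := by
  have h : IntegrableOn W (uIcc 0 T) := by
    rw [uIcc_of_le hT.le, integrableOn_Icc_iff_integrableOn_Ioo]
    exact hW
  have := intervalIntegral.continuousOn_primitive_interval h
  rwa [uIcc_of_le hT.le] at this

/-- If the equation holds for the tests `η(t) ξ(x)` with `η' = κ` smooth and compactly supported in
`(0,T)`, then the moment `∫ ξ m(t)` is almost everywhere the primitive of `∫ ⟨w, Dξ⟩` that starts
from `∫ ξ m₀`. -/
theorem ae_moment_eq (hT : 0 < T) (hm : Integrable m (cyl d T)) (hw : Integrable w (cyl d T))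
    {ξ : Torus d → ℝ} {g : Torus d → Vec d} (hξ : Continuous ξ) (hg : Continuous g)
    (h : ∀ κ : ℝ → ℝ, ContDiff ℝ (⊤ : ℕ∞) κ → HasCompactSupport κ → tsupport κ ⊆ Ioo 0 T →
      ∫ z, (m z * (κ z.1 * ξ z.2) + inner ℝ (w z) ((∫ s in T..z.1, κ s) • g z.2)) ∂(cyl d T)
        + (∫ s in T..0, κ s) * ∫ x, ξ x * m₀ x = 0) :
    ∀ᵐ t ∂(volume.restrict (Ioo 0 T)), ∫ x, m (t, x) * ξ x
      = (∫ x, ξ x * m₀ x) + ∫ s in (0 : ℝ)..t, ∫ x, inner ℝ (w (s, x)) (g x) := by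
  set M : ℝ → ℝ := fun t => ∫ x, m (t, x) * ξ x
  set W : ℝ → ℝ := fun t => ∫ x, inner ℝ (w (t, x)) (g x)
  set I : ℝ := ∫ x, ξ x * m₀ x
  have hM : Integrable M (volume.restrict (Ioo 0 T)) := integrable_moment hm hξ
  have hW : Integrable W (volume.restrict (Ioo 0 T)) := integrable_flux_moment hw hg
  have hV : Integrable (fun t => ∫ s in (0 : ℝ)..t, W s) (volume.restrict (Ioo 0 T)) :=
    ((continuousOn_primitive_Icc hT hW).integrableOn_compact isCompact_Icc).mono_set
      Ioo_subset_Icc_self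
  have hf : Integrable (fun t => M t - (I + ∫ s in (0 : ℝ)..t, W s))
      (volume.restrict (Ioo 0 T)) := hM.sub ((integrable_const I).add hV)
  have key := IsOpen.ae_eq_zero_of_integral_contDiff_smul_eq_zero (μ := volume) isOpen_Ioo
    (f := fun t => M t - (I + ∫ s in (0 : ℝ)..t, W s))
    (IntegrableOn.locallyIntegrableOn hf) (by
      intro κ hκ hκc hκs
      have h1 := h κ hκ hκc hκs
      have hκi : ∀ a b, IntervalIntegrable κ volume a b := fun a b =>
        hκ.continuous.intervalIntegrable a b
      have hκI : Integrable κ (volume.restrict (Ioo 0 T)) :=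
        (hκ.continuous.integrable_of_hasCompactSupport hκc).restrict
      have hηc : ContinuousOn (fun t => ∫ s in T..t, κ s) (Icc 0 T) :=
        (intervalIntegral.continuous_primitive hκi T).continuousOn
      rw [integral_product_test hm hw hξ hg hκ.continuous hηc,
        integral_mul_primitive hW hκI (fun t _ => intervalIntegral.integral_symm _ _),
        intervalIntegral.integral_symm, intervalIntegral.integral_of_le hT.le,
        integral_Ioc_eq_integral_Ioo] at h1
      obtain ⟨K, hK⟩ := hκc.exists_bound_of_continuous hκ.continuous
      have hb : ∀ {u : ℝ → ℝ}, Integrable u (volume.restrict (Ioo 0 T)) →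
          Integrable (fun t => κ t * u t) (volume.restrict (Ioo 0 T)) := fun hu =>
        hu.bdd_mul hκ.continuous.aestronglyMeasurable (ae_of_all _ hK)
      have hsupp : ∀ t, t ∉ Ioo 0 T → κ t • (M t - (I + ∫ s in (0 : ℝ)..t, W s)) = 0 := by
        intro t ht
        rw [image_eq_zero_of_notMem_tsupport fun h => ht (hκs h), zero_smul]
      rw [← setIntegral_eq_integral_of_forall_compl_eq_zero hsupp]
      have e : ∀ t, κ t • (M t - (I + ∫ s in (0 : ℝ)..t, W s))
          = κ t * M t - κ t * I - κ t * ∫ s in (0 : ℝ)..t, W s := fun t => by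
        rw [smul_eq_mul]; ring
      simp only [e]
      have i1 : Integrable (fun t => κ t * M t - κ t * I) (volume.restrict (Ioo 0 T)) :=
        (hb hM).sub (hκI.mul_const I)
      rw [integral_sub i1 (hb hV), integral_sub (hb hM) (hκI.mul_const I), integral_mul_const]
      linarith)
  rw [ae_restrict_iff' measurableSet_Ioo]
  filter_upwards [key] with t ht htm
  linarith [ht htm]

/-- If the moments of `ξ` are given by the flux, then the equation holds for all tests `η(t) ξ(x)`
with `η` of class `C¹` and `η(T) = 0`. -/
theorem product_equation (hT : 0 < T) (hm : Integrable m (cyl d T)) (hw : Integrable w (cyl d T))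
    {ξ : Torus d → ℝ} {g : Torus d → Vec d} (hξ : Continuous ξ) (hg : Continuous g)
    (h : ∀ᵐ t ∂(volume.restrict (Ioo 0 T)), ∫ x, m (t, x) * ξ x
      = (∫ x, ξ x * m₀ x) + ∫ s in (0 : ℝ)..t, ∫ x, inner ℝ (w (s, x)) (g x))
    {κ η : ℝ → ℝ} (hκ : Continuous κ) (hη : Continuous η)
    (hder : ∀ t ∈ Ioo 0 T, HasDerivAt η (κ t) t) (hηT : η T = 0) :
    ∫ z, (m z * (κ z.1 * ξ z.2) + inner ℝ (w z) (η z.1 • g z.2)) ∂(cyl d T)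
      + η 0 * ∫ x, ξ x * m₀ x = 0 := by
  have hW := integrable_flux_moment hw hg
  have hκi : ∀ a b, IntervalIntegrable κ volume a b := fun a b => hκ.intervalIntegrable a b
  have hκI : Integrable κ (volume.restrict (Ioo 0 T)) :=
    (hκ.continuousOn.integrableOn_compact isCompact_Icc).mono_set Ioo_subset_Icc_self
  have hftc : ∀ t ∈ Icc 0 T, ∫ s in t..T, κ s = -η t := fun t ht => by
    rw [intervalIntegral.integral_eq_sub_of_hasDerivAt_of_le ht.2 hη.continuousOn
      (fun s hs => hder s ⟨ht.1.trans_lt hs.1, hs.2⟩) (hκi _ _), hηT, zero_sub]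
  rw [integral_product_test hm hw hξ hg hκ hη.continuousOn,
    integral_mul_primitive hW hκI fun t ht => by
      rw [hftc t (Ioo_subset_Icc_self ht), neg_neg]]
  obtain ⟨K, hK⟩ := isCompact_Icc.exists_bound_of_continuousOn (hκ.continuousOn (s := Icc 0 T))
  have hV : Integrable (fun t => κ t * ∫ s in (0 : ℝ)..t, ∫ x, inner ℝ (w (s, x)) (g x))
      (volume.restrict (Ioo 0 T)) :=
    ((hκ.continuousOn.mul (continuousOn_primitive_Icc hT hW)).integrableOn_compact
      isCompact_Icc).mono_set Ioo_subset_Icc_self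
  have e : ∫ t in Ioo 0 T, κ t * ∫ x, m (t, x) * ξ x
      = (∫ t in Ioo 0 T, κ t) * (∫ x, ξ x * m₀ x)
        + ∫ t in Ioo 0 T, κ t * ∫ s in (0 : ℝ)..t, ∫ x, inner ℝ (w (s, x)) (g x) := by
    rw [← integral_mul_const, ← integral_add (hκI.mul_const _) hV]
    refine integral_congr_ae ?_
    filter_upwards [h] with t ht
    rw [ht]; ring
  rw [e]
  have := hftc 0 ⟨le_rfl, hT.le⟩
  rw [intervalIntegral.integral_of_le hT.le, integral_Ioc_eq_integral_Ioo] at this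
  rw [this]
  ring

theorem exists_lt_of_tsupport_subset (hT : 0 < T) {κ : ℝ → ℝ} (hκc : HasCompactSupport κ)
    (hκs : tsupport κ ⊆ Ioo 0 T) : ∃ t₁ < T, ∀ t, t₁ ≤ t → κ t = 0 := by
  rcases (tsupport κ).eq_empty_or_nonempty with h | h
  · exact ⟨0, hT, fun t _ => image_eq_zero_of_notMem_tsupport (by simp [h])⟩
  · obtain ⟨s, hs, hmax⟩ := IsCompact.exists_isGreatest hκc h
    refine ⟨(s + T) / 2, by linarith [(hκs hs).2], fun t ht => ?_⟩
    refine image_eq_zero_of_notMem_tsupport fun h => ?_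
    have := hmax h
    linarith [(hκs hs).2]

theorem contDiff_primitive {κ : ℝ → ℝ} (hκ : ContDiff ℝ (⊤ : ℕ∞) κ) (a : ℝ) :
    ContDiff ℝ (⊤ : ℕ∞) fun t => ∫ s in a..t, κ s := by
  have h : ∀ t, HasDerivAt (fun t => ∫ s in a..t, κ s) (κ t) t := fun t =>
    intervalIntegral.integral_hasDerivAt_right (hκ.continuous.intervalIntegrable _ _)
      (hκ.continuous.stronglyMeasurableAtFilter _ _) hκ.continuous.continuousAt
  rw [contDiff_infty_iff_deriv]
  refine ⟨fun t => (h t).differentiableAt, ?_⟩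
  rwa [funext fun t => (h t).deriv]

theorem hasGradientAt_const_mul {u : Torus d → ℝ} {g : Vec d} {x : Torus d}
    (h : HasGradientAt (fun v : Vec d => u (x + toTorus v)) g 0) (c : ℝ) :
    HasGradientAt (fun v : Vec d => c * u (x + toTorus v)) (c • g) 0 := by
  rw [hasGradientAt_iff_hasFDerivAt] at h ⊢
  rw [map_smul]
  exact h.const_mul c

/-- The moment of a smooth function `ξ` under `m(t)` is almost everywhere the primitive of the flux
moment `∫ ⟨w, Dξ⟩` that starts from its moment under `m₀`. -/
theorem ContinuityEquation.moment_of_smooth (hT : 0 < T) (hm : Integrable m (cyl d T))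
    (hw : Integrable w (cyl d T)) (h : ContinuityEquation T m₀ m w) {ξ : Torus d → ℝ}
    {g : Torus d → Vec d}
    (hξ : ContDiff ℝ (⊤ : ℕ∞) fun y => ξ (toTorus y)) (hg : Continuous g)
    (hgr : ∀ x, HasGradientAt (fun v : Vec d => ξ (x + toTorus v)) (g x) 0) :
    ∀ᵐ t ∂(volume.restrict (Ioo 0 T)), ∫ x, m (t, x) * ξ x
      = (∫ x, ξ x * m₀ x) + ∫ s in (0 : ℝ)..t, ∫ x, inner ℝ (w (s, x)) (g x) := by
  have hξc : Continuous ξ := continuous_of_comp_toTorus hξ.continuous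
  refine ae_moment_eq hT hm hw hξc hg fun κ hκ hκc hκs => ?_
  obtain ⟨t₁, ht₁, hκ0⟩ := exists_lt_of_tsupport_subset hT hκc hκs
  have hη := contDiff_primitive hκ T
  -- the primitive of `κ` that vanishes at `T`, which vanishes near `T`
  have htest : IsTest T fun t x => (∫ s in T..t, κ s) * ξ x := by
    refine ⟨(hη.comp contDiff_fst).mul (hξ.comp contDiff_snd), t₁, ht₁, fun t ht x => ?_⟩
    have : ∫ s in T..t, κ s = ∫ s in T..t, (0 : ℝ) := intervalIntegral.integral_congr fun s hs =>
      hκ0 s ((le_min ht₁.le ht).trans hs.1)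
    simp [this]
  have := h _ htest
  have e1 : ∀ z : ℝ × Torus d, deriv (fun s => (∫ s' in T..s, κ s') * ξ z.2) z.1
      = κ z.1 * ξ z.2 := fun z => by
    have h : HasDerivAt (fun t => ∫ s in T..t, κ s) (κ z.1) z.1 :=
      intervalIntegral.integral_hasDerivAt_right (hκ.continuous.intervalIntegrable _ _)
        (hκ.continuous.stronglyMeasurableAtFilter _ _) hκ.continuous.continuousAt
    exact (h.mul_const _).deriv
  have e2 : ∀ z : ℝ × Torus d, torusGrad (fun x => (∫ s in T..z.1, κ s) * ξ x) z.2
      = (∫ s in T..z.1, κ s) • g z.2 := fun z =>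
    torusGrad_eq (hasGradientAt_const_mul (hgr z.2) _)
  simp only [e1, e2, mul_assoc] at this
  rwa [integral_const_mul] at this

end WeakEquation

/-! ### The continuity equation tested with functions of class C¹ -/

section SmoothEquation

variable {d : ℕ} {T : ℝ} {m₀ : Torus d → ℝ} {m : ℝ × Torus d → ℝ} {w : ℝ × Torus d → Vec d}

theorem C1Data.hasDerivAt_val {ψ : ℝ → Torus d → ℝ} (D : C1Data T ψ) {t : ℝ} (ht : t ∈ Ioo 0 T)
    (x : Torus d) : HasDerivAt (fun s => D.val (s, x)) (D.dt (t, x)) t :=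
  (D.hasDerivAt t ht x).congr_of_eventuallyEq (by
    filter_upwards [Icc_mem_nhds ht.1 ht.2] with s hs
    exact D.val_eq s hs x)

theorem C1Data.hasGradientAt_val {ψ : ℝ → Torus d → ℝ} (D : C1Data T ψ) {t : ℝ}
    (ht : t ∈ Icc 0 T) (x : Torus d) :
    HasGradientAt (fun v : Vec d => D.val (t, x + toTorus v)) (D.grad (t, x)) 0 := by
  simp only [D.val_eq t ht]
  exact D.hasGradientAt t ht x

/-- The continuity equation tested with the translated kernel in space and `t ↦ ψ(t,y)` in time. -/
theorem K1.kern_equation (hT : 0 < T) (h : K1 T m₀ m w) {ψ : ℝ → Torus d → ℝ} (D : C1Data T ψ)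
    (hψT : ∀ x, D.val (T, x) = 0) {n : ℕ} {k' : Torus d → Vec d} (hk' : Continuous k')
    (hgr : ∀ x, HasGradientAt (fun v : Vec d => kern n (x + toTorus v)) (k' x) 0) (y : Torus d) :
    ∫ z, (m z * (D.dt (z.1, y) * kern n (z.2 - y))
        + inner ℝ (w z) (D.val (z.1, y) • k' (z.2 - y))) ∂(cyl d T)
      + D.val (0, y) * ∫ x, kern n (x - y) * m₀ x = 0 := by
  have hc := continuous_kern (d := d) n
  have hξ : ContDiff ℝ (⊤ : ℕ∞) fun v : Vec d => kern n (toTorus v - y) := by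
    obtain ⟨y₀, rfl⟩ := surjective_toTorus y
    have e : ∀ v : Vec d, toTorus v - toTorus y₀ = toTorus (v - y₀) := fun v => by
      ext i; simp [toTorus]
    simp only [e]
    exact (contDiff_kern n).comp (contDiff_id.sub contDiff_const)
  have hg : ∀ x, HasGradientAt (fun v : Vec d => kern n (x + toTorus v - y)) (k' (x - y)) 0 := by
    intro x
    have := hgr (x - y)
    simpa only [add_sub_right_comm] using this
  exact product_equation hT h.integrable_density h.integrable_flux
    (ξ := fun x => kern n (x - y)) (g := fun x => k' (x - y)) (by fun_prop) (by fun_prop)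
    (h.continuity.moment_of_smooth hT h.integrable_density h.integrable_flux hξ (by fun_prop) hg)
    (κ := fun t => D.dt (t, y)) (η := fun t => D.val (t, y))
    (D.continuous_dt.comp (by fun_prop)) (D.continuous_val.comp (by fun_prop))
    (fun t ht => D.hasDerivAt_val ht y) (hψT y)

/-- The continuity equation tested with the mollification of `ψ` in space: the integral over `y` of
`K1.kern_equation`. -/
theorem K1.moll_equation (hT : 0 < T) (hm₀ : Continuous m₀) (h : K1 T m₀ m w)
    {ψ : ℝ → Torus d → ℝ} (D : C1Data T ψ) (hψT : ∀ x, D.val (T, x) = 0) (n : ℕ) :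
    ∫ z, (m z * moll n (fun y => D.dt (z.1, y)) z.2
        + inner ℝ (w z) (moll n (fun y => D.grad (z.1, y)) z.2)) ∂(cyl d T)
      + ∫ x, moll n (fun y => D.val (0, y)) x * m₀ x = 0 := by
  have hc := continuous_kern (d := d) n
  have hdt := D.continuous_dt
  have hval := D.continuous_val
  have hgrad := D.continuous_grad
  obtain ⟨k', hk', hgr⟩ := exists_continuous_gradient (u := kern n)
    ((contDiff_kern (d := d) n).of_le (by exact_mod_cast le_top))
  obtain ⟨C, hC0, hC⟩ := D.exists_bound
  obtain ⟨K, hK⟩ := exists_bound_torus hc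
  obtain ⟨K', hK'⟩ := exists_bound_torus hk'
  have hm := h.integrable_density
  have hw := h.integrable_flux
  set F₁ : Torus d → ℝ × Torus d → ℝ := fun y z => m z * (D.dt (z.1, y) * kern n (z.2 - y))
  set F₂ : Torus d → ℝ × Torus d → ℝ :=
    fun y z => inner ℝ (w z) (D.val (z.1, y) • k' (z.2 - y))
  have hF₁ : Integrable (Function.uncurry F₁) (volume.prod (cyl d T)) := by
    refine ((hm.norm.mul_const (C * K)).comp_snd volume).mono' (hm.1.comp_snd.mul ?_)
      (ae_of_all _ fun p => ?_)
    · exact Continuous.aestronglyMeasurable (by fun_prop)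
    · simp only [Function.uncurry, F₁, norm_mul]
      have := (hC (p.2.1, p.1)).2.1
      rw [← Real.norm_eq_abs] at this
      gcongr
      exact hK _
  have hF₂ : Integrable (Function.uncurry F₂) (volume.prod (cyl d T)) := by
    refine ((hw.norm.mul_const (C * K')).comp_snd volume).mono' (hw.1.comp_snd.inner ?_)
      (ae_of_all _ fun p => ?_)
    · exact Continuous.aestronglyMeasurable (by fun_prop)
    · simp only [Function.uncurry, F₂]
      refine (norm_inner_le_norm _ _).trans ?_
      rw [norm_smul]
      have := (hC (p.2.1, p.1)).1
      rw [← Real.norm_eq_abs] at this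
      gcongr
      exact hK' _
  have hF : Integrable (Function.uncurry fun y z => F₁ y z + F₂ y z) (volume.prod (cyl d T)) :=
    hF₁.add hF₂
  have hG : Integrable (Function.uncurry fun y x : Torus d =>
      D.val (0, y) * (kern n (x - y) * m₀ x)) (volume.prod volume) := by
    have hc' : Continuous (Function.uncurry fun y x : Torus d =>
      D.val (0, y) * (kern n (x - y) * m₀ x)) := by fun_prop
    exact hc'.integrable_of_hasCompactSupport (.of_compactSpace _)
  have heq : ∀ y, (∫ z, (F₁ y z + F₂ y z) ∂(cyl d T))
      + ∫ x, D.val (0, y) * (kern n (x - y) * m₀ x) = 0 := fun y => by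
    rw [integral_const_mul]
    exact h.kern_equation hT D hψT hk' hgr y
  have hint : ∫ y, ((∫ z, (F₁ y z + F₂ y z) ∂(cyl d T))
      + ∫ x, D.val (0, y) * (kern n (x - y) * m₀ x)) = 0 := by simp only [heq, integral_zero]
  have i3 : Integrable fun y => ∫ z, (F₁ y z + F₂ y z) ∂(cyl d T) := hF.integral_prod_left
  have i4 : Integrable fun y => ∫ x, D.val (0, y) * (kern n (x - y) * m₀ x) :=
    hG.integral_prod_left
  rw [integral_add i3 i4, integral_integral_swap hF,
    integral_integral_swap hG] at hint
  convert hint using 2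
  · refine integral_congr_ae ?_
    filter_upwards [ae_mem_Ioo_cyl] with z hz
    have c1 : Continuous fun y => D.dt (z.1, y) * kern n (z.2 - y) := by fun_prop
    have c2 : Continuous fun y => D.val (z.1, y) • k' (z.2 - y) := by fun_prop
    have i1 : Integrable (fun y => F₁ y z) := (integrable_of_continuous c1).const_mul _
    have i2 : Integrable (fun y => F₂ y z) := (integrable_of_continuous c2).const_inner _
    rw [integral_add i1 i2]
    congr 1
    · simp only [F₁]
      rw [integral_const_mul, moll]
      simp only [smul_eq_mul, mul_comm]
    · simp only [F₂]
      rw [integral_inner (integrable_of_continuous c2)]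
      congr 1
      exact (integral_smul_gradient_kern hk' hgr (by fun_prop) (by fun_prop)
        (fun x => D.hasGradientAt_val (Ioo_subset_Icc_self hz) x) z.2).symm
  · refine integral_congr_ae (ae_of_all _ fun x => ?_)
    simp only [moll]
    rw [← integral_mul_const]
    refine integral_congr_ae (ae_of_all _ fun y => ?_)
    simp only [smul_eq_mul]
    ring

theorem continuous_moll_uncurry {V X : Type*} [NormedAddCommGroup V] [NormedSpace ℝ V]
    [TopologicalSpace X] [FirstCountableTopology X] (n : ℕ)
    {g : X × Torus d → V} (hg : Continuous g) {C : ℝ} (hC : ∀ z, ‖g z‖ ≤ C) :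
    Continuous fun z : X × Torus d => moll n (fun y => g (z.1, y)) z.2 := by
  have hc := continuous_kern (d := d) n
  obtain ⟨K, hK⟩ := exists_bound_torus hc
  refine continuous_of_dominated (bound := fun _ => K * C) (fun z => ?_) (fun z => ae_of_all _
    fun y => ?_) (integrable_const _) (ae_of_all _ fun y => by fun_prop)
  · have : Continuous fun y => kern n (z.2 - y) • g (z.1, y) := by fun_prop
    exact (integrable_of_continuous this).1
  · rw [norm_smul]
    exact mul_le_mul (hK _) (hC _) (norm_nonneg _) ((norm_nonneg _).trans (hK 0))

/-- The continuity equation holds for test functions of class `C¹` on `[0,T] × 𝕋^d` that vanish at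
time `T`. -/
theorem K1.equation_of_C1 (hT : 0 < T) (hm₀ : Continuous m₀) (h : K1 T m₀ m w)
    {ψ : ℝ → Torus d → ℝ} (D : C1Data T ψ) (hψT : ∀ x, D.val (T, x) = 0) :
    ∫ z, (m z * D.dt z + inner ℝ (w z) (D.grad z)) ∂(cyl d T)
      + ∫ x, D.val (0, x) * m₀ x = 0 := by
  have hdt := D.continuous_dt
  have hval := D.continuous_val
  have hgrad := D.continuous_grad
  obtain ⟨C, hC0, hC⟩ := D.exists_bound
  have hm := h.integrable_density
  have hw := h.integrable_flux
  obtain ⟨K, hK⟩ := exists_bound_torus hm₀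
  have hl : Filter.Tendsto (fun n => ∫ z, (m z * moll n (fun y => D.dt (z.1, y)) z.2
        + inner ℝ (w z) (moll n (fun y => D.grad (z.1, y)) z.2)) ∂(cyl d T)
      + ∫ x, moll n (fun y => D.val (0, y)) x * m₀ x) Filter.atTop
      (nhds (∫ z, (m z * D.dt z + inner ℝ (w z) (D.grad z)) ∂(cyl d T)
      + ∫ x, D.val (0, x) * m₀ x)) := by
    refine Filter.Tendsto.add ?_ ?_
    · refine tendsto_integral_of_dominated_convergence (fun z => ‖m z‖ * C + ‖w z‖ * C)
        (fun n => ?_) ((hm.norm.mul_const C).add (hw.norm.mul_const C))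
        (fun n => ae_of_all _ fun z => ?_) (ae_of_all _ fun z => ?_)
      · exact (hm.1.mul (continuous_moll_uncurry n hdt (C := C)
          fun z => (hC z).2.1).aestronglyMeasurable).add
          (hw.1.inner (continuous_moll_uncurry n hgrad fun z => (hC z).2.2).aestronglyMeasurable)
      · refine (norm_add_le _ _).trans (add_le_add ?_ ((norm_inner_le_norm _ _).trans ?_))
        · rw [norm_mul]
          gcongr
          exact norm_moll_le n (fun y => (hC (z.1, y)).2.1) _
        · gcongr
          exact norm_moll_le n (fun y => (hC (z.1, y)).2.2) _
      · exact ((tendsto_moll (g := fun y => D.dt (z.1, y)) (by fun_prop) z.2).const_mul _).add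
          (tendsto_const_nhds.inner
            (tendsto_moll (g := fun y => D.grad (z.1, y)) (by fun_prop) z.2))
    · refine tendsto_integral_of_dominated_convergence (fun x => C * K)
        (fun n => ?_) (integrable_const _)
        (fun n => ae_of_all _ fun x => ?_) (ae_of_all _ fun x => ?_)
      · have := (continuous_moll_uncurry n hval (C := C) fun z => (hC z).1).comp
          (f := fun x : Torus d => ((0 : ℝ), x)) (by fun_prop)
        exact (this.mul hm₀).aestronglyMeasurable
      · rw [norm_mul]
        gcongr
        · exact norm_moll_le n (fun y => (hC (0, y)).1) _
        · exact hK x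
      · exact (tendsto_moll (g := fun y => D.val (0, y)) (by fun_prop) x).mul_const _
  have hz : ∀ n, _ = (0 : ℝ) := fun n => h.moll_equation hT hm₀ D hψT n
  simp only [hz] at hl
  exact (tendsto_nhds_unique hl tendsto_const_nhds)

end SmoothEquation

/-! ### The weakly continuous representative and the terminal cost -/

section Representative

variable {d : ℕ} {T : ℝ} {m₀ φT : Torus d → ℝ} {m : ℝ × Torus d → ℝ} {w : ℝ × Torus d → Vec d}

/-- The extension of `ContinuityEquation.moment_of_smooth` to functions of class `C¹`. -/
theorem K1.moment_of_C1 (hT : 0 < T) (hm₀ : Continuous m₀) (h : K1 T m₀ m w) {ξ : Torus d → ℝ}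
    {g : Torus d → Vec d} (hξ : ContDiff ℝ 1 fun y => ξ (toTorus y)) (hg : Continuous g)
    (hgr : ∀ x, HasGradientAt (fun v : Vec d => ξ (x + toTorus v)) (g x) 0) :
    ∀ᵐ t ∂(volume.restrict (Ioo 0 T)), ∫ x, m (t, x) * ξ x
      = (∫ x, ξ x * m₀ x) + ∫ s in (0 : ℝ)..t, ∫ x, inner ℝ (w (s, x)) (g x) := by
  have hξc : Continuous ξ := continuous_of_comp_toTorus hξ.continuous
  refine ae_moment_eq hT h.integrable_density h.integrable_flux hξc hg fun κ hκ _ _ => ?_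
  have hη : ContDiff ℝ 1 fun t => ∫ s in T..t, κ s :=
    (contDiff_primitive hκ T).of_le (by exact_mod_cast le_top)
  obtain ⟨D⟩ := exists_C1Data hT (φ := fun t x => (∫ s in T..t, κ s) * ξ x)
    ((hη.comp contDiff_fst).mul (hξ.comp contDiff_snd)).contDiffOn
  have hTm : T ∈ Icc 0 T := ⟨hT.le, le_rfl⟩
  have hmem : (0 : ℝ) ∈ Icc 0 T := ⟨le_rfl, hT.le⟩
  have h1 := h.equation_of_C1 hT hm₀ D fun x => by rw [D.val_eq T hTm]; simp
  simp only [D.val_eq 0 hmem, mul_assoc] at h1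
  rw [integral_const_mul] at h1
  convert h1 using 2
  refine integral_congr_ae ?_
  filter_upwards [ae_mem_Ioo_cyl] with z hz
  have e1 : κ z.1 * ξ z.2 = D.dt z := by
    have h : HasDerivAt (fun t => ∫ s in T..t, κ s) (κ z.1) z.1 :=
      intervalIntegral.integral_hasDerivAt_right (hκ.continuous.intervalIntegrable _ _)
        (hκ.continuous.stronglyMeasurableAtFilter _ _) hκ.continuous.continuousAt
    exact (h.mul_const _).unique (D.hasDerivAt z.1 hz z.2)
  have e2 : (∫ s in T..z.1, κ s) • g z.2 = D.grad z :=
    (hasGradientAt_const_mul (hgr z.2) _).unique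
      (D.hasGradientAt z.1 (Ioo_subset_Icc_self hz) z.2)
  rw [e1, e2]

/-- The measure with density `m(t,·)`. -/
def slice (m : ℝ × Torus d → ℝ) (t : ℝ) : Measure (Torus d) :=
  volume.withDensity fun x => ENNReal.ofReal (m (t, x))

theorem integral_slice {t : ℝ} (hm : AEMeasurable (fun x => m (t, x)))
    (h0 : ∀ᵐ x, 0 ≤ m (t, x)) (ξ : Torus d → ℝ) :
    ∫ x, ξ x ∂(slice m t) = ∫ x, m (t, x) * ξ x := by
  rw [slice, integral_withDensity_eq_integral_toReal_smul₀ hm.ennreal_ofReal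
    (ae_of_all _ fun x => ENNReal.ofReal_lt_top)]
  refine integral_congr_ae ?_
  filter_upwards [h0] with x hx
  rw [ENNReal.toReal_ofReal hx, smul_eq_mul]

theorem isProbabilityMeasure_slice {t : ℝ} (hm : Integrable fun x => m (t, x))
    (h0 : ∀ᵐ x, 0 ≤ m (t, x)) (h1 : ∫ x, m (t, x) = 1) : IsProbabilityMeasure (slice m t) := by
  constructor
  rw [slice, withDensity_apply _ MeasurableSet.univ, Measure.restrict_univ,
    ← ofReal_integral_eq_lintegral_ofReal hm h0, h1, ENNReal.ofReal_one]

theorem K1.ae_slice (h : K1 T m₀ m w) : ∀ᵐ t ∂(volume.restrict (Ioo 0 T)),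
    (Integrable fun x => m (t, x)) ∧ (∀ᵐ x, 0 ≤ m (t, x)) ∧ ∫ x, m (t, x) = 1 := by
  filter_upwards [h.integrable_density.prod_right_ae, Measure.ae_ae_of_ae_prod h.nonneg, h.mass]
    with t h1 h2 h3
  exact ⟨h1, h2, h3⟩

theorem mem_closure_of_ae (hT : 0 < T) {D : Set ℝ}
    (hD : ∀ᵐ t ∂(volume.restrict (Ioo 0 T)), t ∈ D) {t : ℝ} (ht : t ∈ Icc 0 T) :
    t ∈ closure D := by
  rw [mem_closure_iff_nhds]
  intro U hU
  rw [← closure_Ioo hT.ne, mem_closure_iff_nhds] at ht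
  obtain ⟨s, hsU, hs⟩ := ht _ (interior_mem_nhds.2 hU)
  rw [ae_restrict_iff' measurableSet_Ioo] at hD
  have hopen : IsOpen (interior U ∩ Ioo 0 T) := isOpen_interior.inter isOpen_Ioo
  by_contra hne
  have hsub : interior U ∩ Ioo 0 T ⊆ {a | ¬(a ∈ Ioo 0 T → a ∈ D)} := fun a ha h =>
    hne ⟨a, interior_subset ha.1, h ha.2⟩
  exact (hopen.measure_pos volume ⟨s, hsU, hs⟩).ne' (measure_mono_null hsub hD)

/-- Prescribed moments that are continuous in time and almost everywhere those of `m(t)` are at all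
times the moments of a probability measure. -/
theorem K1.exists_measure_of_moments (hT : 0 < T) (h : K1 T m₀ m w) {ι : Type*} [Countable ι]
    {ξ : ι → Torus d → ℝ} (hξ : ∀ i, Continuous (ξ i)) {c : ι → ℝ → ℝ}
    (hc : ∀ i, ContinuousOn (c i) (Icc 0 T))
    (hmom : ∀ i, ∀ᵐ t ∂(volume.restrict (Ioo 0 T)), ∫ x, m (t, x) * ξ i x = c i t) :
    ∃ μ : ℝ → ProbabilityMeasure (Torus d),
      (∀ t ∈ Icc 0 T, ∀ i, ∫ x, ξ i x ∂(μ t : Measure (Torus d)) = c i t) ∧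
      ∀ᵐ t ∂(volume.restrict (Ioo 0 T)), (μ t : Measure (Torus d)) = slice m t := by
  classical
  set D : Set ℝ := {t | t ∈ Ioo 0 T ∧ IsProbabilityMeasure (slice m t) ∧
    ∀ i, ∫ x, ξ i x ∂(slice m t) = c i t} with hDdef
  have hD : ∀ᵐ t ∂(volume.restrict (Ioo 0 T)), t ∈ D := by
    filter_upwards [h.ae_slice, ae_all_iff.2 hmom, ae_restrict_mem measurableSet_Ioo]
      with t h1 h2 h3
    refine ⟨h3, isProbabilityMeasure_slice h1.1 h1.2.1 h1.2.2, fun i => ?_⟩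
    rw [integral_slice h1.1.aemeasurable h1.2.1, h2 i]
  let ν : ℝ → ProbabilityMeasure (Torus d) := fun t =>
    if ht : IsProbabilityMeasure (slice m t) then ⟨slice m t, ht⟩ else ⟨volume, inferInstance⟩
  have hν : ∀ t ∈ D, (ν t : Measure (Torus d)) = slice m t := fun t ht => by
    have : ν t = ⟨slice m t, ht.2.1⟩ := dif_pos ht.2.1
    rw [this]; rfl
  have hex : ∀ t ∈ Icc 0 T, ∃ μ : ProbabilityMeasure (Torus d),
      (∀ i, ∫ x, ξ i x ∂(μ : Measure (Torus d)) = c i t) ∧ (t ∈ D → μ = ν t) := by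
    intro t ht
    by_cases htD : t ∈ D
    · exact ⟨ν t, fun i => by rw [hν t htD]; exact htD.2.2 i, fun _ => rfl⟩
    -- at the other times, a weak limit of `ν s` as `s → t` within `D`
    have hne : (nhdsWithin t D).NeBot := mem_closure_iff_nhdsWithin_neBot.1
      (mem_closure_of_ae hT hD ht)
    let U : Ultrafilter ℝ := Ultrafilter.of (nhdsWithin t D)
    have hU : (U : Filter ℝ) ≤ nhdsWithin t D := Ultrafilter.of_le _
    obtain ⟨μ, -, hμ⟩ := isCompact_univ.ultrafilter_le_nhds (U.map ν) (by simp)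
    refine ⟨μ, fun i => ?_, fun h => absurd h htD⟩
    have hl : Filter.Tendsto ν U (nhds μ) := hμ
    have h1 := ProbabilityMeasure.tendsto_iff_forall_integral_tendsto.1 hl
      (BoundedContinuousFunction.mkOfCompact ⟨ξ i, hξ i⟩)
    simp only [BoundedContinuousFunction.mkOfCompact_apply, ContinuousMap.coe_mk] at h1
    have h2 : Filter.Tendsto (c i) U (nhds (c i t)) :=
      (hc i t ht).mono_left (hU.trans (nhdsWithin_mono _ fun s hs => Ioo_subset_Icc_self hs.1))
    refine tendsto_nhds_unique (h1.congr' ?_) h2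
    filter_upwards [hU self_mem_nhdsWithin] with s hs
    rw [hν s hs, hs.2.2 i]
  choose! μ hμ hμD using hex
  refine ⟨μ, hμ, ?_⟩
  filter_upwards [hD] with t ht
  rw [hμD t (Ioo_subset_Icc_self ht.1) ht, hν t ht]

theorem contDiff_fourier (n : Fin d → ℤ) :
    ContDiff ℝ (⊤ : ℕ∞) fun y : Vec d => UnitAddTorus.mFourier n (toTorus y) := by
  have : ∀ y : Vec d, UnitAddTorus.mFourier n (toTorus y)
      = ∏ i, Complex.exp (2 * Real.pi * Complex.I * n i * (y i : ℝ)) := by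
    intro y
    simp only [UnitAddTorus.mFourier, ContinuousMap.coe_mk, toTorus]
    refine Finset.prod_congr rfl fun i _ => ?_
    rw [fourier_coe_apply]
    simp
  simp only [this]
  refine contDiff_prod fun i _ => ?_
  have h1 : ContDiff ℝ (⊤ : ℕ∞) fun y : Vec d => ((y i : ℝ) : ℂ) :=
    Complex.ofRealCLM.contDiff.comp (by fun_prop)
  exact (contDiff_const.mul h1).cexp

/-- The real and imaginary parts of the Fourier monomials. -/
def fourierPart (p : (Fin d → ℤ) × Bool) (x : Torus d) : ℝ :=
  if p.2 then (UnitAddTorus.mFourier p.1 x).re else (UnitAddTorus.mFourier p.1 x).im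

theorem contDiff_fourierPart (p : (Fin d → ℤ) × Bool) :
    ContDiff ℝ (⊤ : ℕ∞) fun y : Vec d => fourierPart p (toTorus y) := by
  obtain ⟨n, b⟩ := p
  cases b
  · simp only [fourierPart]
    exact Complex.imCLM.contDiff.comp (contDiff_fourier n)
  · simp only [fourierPart]
    exact Complex.reCLM.contDiff.comp (contDiff_fourier n)

/-- A curve of probability measures on the torus whose Fourier coefficients are continuous is weakly
continuous. -/
theorem continuousOn_of_fourierPart {μ : ℝ → ProbabilityMeasure (Torus d)} {S : Set ℝ}
    (h : ∀ p, ContinuousOn (fun t => ∫ x, fourierPart p x ∂(μ t : Measure (Torus d))) S) :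
    ContinuousOn μ S := by
  have hint : ∀ (f : C(Torus d, ℂ)) t, Integrable f (μ t : Measure (Torus d)) := fun f t =>
    integrable_of_continuous f.continuous
  let V : Submodule ℂ C(Torus d, ℂ) :=
    { carrier := {f | ContinuousOn (fun t => ∫ x, f x ∂(μ t : Measure (Torus d))) S}
      add_mem' := by
        intro f g hf hg
        refine (ContinuousOn.add hf hg).congr fun t _ => ?_
        exact integral_add (hint f t) (hint g t)
      zero_mem' := by simpa using continuousOn_const
      smul_mem' := by
        intro a f hf
        refine (ContinuousOn.const_smul hf a).congr fun t _ => ?_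
        exact integral_smul a f }
  have hVcl : IsClosed (V : Set C(Torus d, ℂ)) := by
    refine isClosed_of_closure_subset fun f hf => ?_
    refine continuousOn_of_uniform_approx_of_continuousOn fun u hu => ?_
    obtain ⟨ε, hε, hεu⟩ := Metric.mem_uniformity_dist.1 hu
    obtain ⟨g, hg, hfg⟩ := Metric.mem_closure_iff.1 hf (ε / 2) (by positivity)
    refine ⟨_, hg, fun t _ => hεu ?_⟩
    rw [dist_eq_norm, ← integral_sub (hint f t) (hint g t)]
    have := norm_integral_le_of_norm_le_const (μ := (μ t : Measure (Torus d)))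
      (f := fun x => f x - g x) (C := ε / 2) (ae_of_all _ fun x => by
        rw [← dist_eq_norm]; exact (ContinuousMap.dist_apply_le_dist x).trans hfg.le)
    simp only [probReal_univ, mul_one] at this
    linarith
  have hVtop : V = ⊤ := by
    rw [eq_top_iff, ← UnitAddTorus.span_mFourier_closure_eq_top]
    refine Submodule.topologicalClosure_minimal _ (Submodule.span_le.2 ?_) hVcl
    rintro _ ⟨n, rfl⟩
    have h1 := h (n, true)
    have h2 := h (n, false)
    simp only [fourierPart, if_true, Bool.false_eq_true, if_false] at h1 h2
    have h3 : ContinuousOn (fun t => ((∫ x, (UnitAddTorus.mFourier n x).re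
        ∂(μ t : Measure (Torus d)) : ℝ) : ℂ) + ((∫ x, (UnitAddTorus.mFourier n x).im
        ∂(μ t : Measure (Torus d)) : ℝ) : ℂ) * Complex.I) S :=
      (Complex.continuous_ofReal.comp_continuousOn h1).add
        ((Complex.continuous_ofReal.comp_continuousOn h2).mul continuousOn_const)
    refine h3.congr fun t _ => ?_
    exact (integral_re_add_im (hint (UnitAddTorus.mFourier n) t)).symm
  intro t ht
  rw [ContinuousWithinAt, ProbabilityMeasure.tendsto_iff_forall_integral_tendsto]
  intro f
  let f' : C(Torus d, ℂ) := ⟨fun x => (f x : ℂ), by fun_prop⟩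
  have hf' : f' ∈ V := hVtop ▸ Submodule.mem_top
  have h1 := (Complex.continuous_re.continuousAt.tendsto.comp (hf' t ht))
  simpa [f', Function.comp_def, integral_complex_ofReal] using h1

/-- The Fourier moments of an admissible density have continuous versions, so that
`K1.exists_measure_of_moments` yields a weakly continuous curve. -/
theorem K1.exists_continuousRep (hT : 0 < T) (h : K1 T m₀ m w) : ∃ μ, IsContinuousRep T m μ := by
  have hgr := fun p => exists_continuous_gradient
    ((contDiff_fourierPart (d := d) p).of_le (by exact_mod_cast le_top))
  choose g hg hgr using hgr
  have hc : ∀ p : (Fin d → ℤ) × Bool, ContinuousOn (fun t => (∫ x, fourierPart p x * m₀ x)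
      + ∫ s in (0 : ℝ)..t, ∫ x, inner ℝ (w (s, x)) (g p x)) (Icc 0 T) := fun p =>
    continuousOn_const.add
      (continuousOn_primitive_Icc hT (integrable_flux_moment h.integrable_flux (hg p)))
  obtain ⟨μ, hμ, hμs⟩ := h.exists_measure_of_moments hT
    (fun p => continuous_of_comp_toTorus (contDiff_fourierPart p).continuous) hc
    fun p => h.continuity.moment_of_smooth hT h.integrable_density h.integrable_flux
      (contDiff_fourierPart p) (hg p) (hgr p)
  exact ⟨μ, continuousOn_of_fourierPart fun p => (hc p).congr fun t ht => hμ t ht p, hμs⟩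

/-- The terminal cost of an admissible pair is an affine function of the flux. -/
theorem K1.terminalCost_eq (hT : 0 < T) (hm₀ : Continuous m₀) (h : K1 T m₀ m w)
    {g : Torus d → Vec d} (hφ : ContDiff ℝ 1 fun y => φT (toTorus y)) (hg : Continuous g)
    (hgr : ∀ x, HasGradientAt (fun v : Vec d => φT (x + toTorus v)) (g x) 0) :
    terminalCost T φT m
      = (((∫ x, φT x * m₀ x) + ∫ z, inner ℝ (w z) (g z.2) ∂(cyl d T) : ℝ) : EReal) := by
  have hex := h.exists_continuousRep hT
  rw [terminalCost, dif_pos hex, EReal.coe_eq_coe_iff]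
  obtain ⟨hcont, hslice⟩ := hex.choose_spec
  set μ := hex.choose
  have hφc : Continuous φT := continuous_of_comp_toTorus hφ.continuous
  have hW := integrable_flux_moment h.integrable_flux hg
  have c1 : ContinuousOn (fun t => ∫ x, φT x ∂(μ t : Measure (Torus d))) (Icc 0 T) := by
    intro t ht
    have := ProbabilityMeasure.tendsto_iff_forall_integral_tendsto.1 (hcont t ht)
      (BoundedContinuousFunction.mkOfCompact ⟨φT, hφc⟩)
    exact this
  have c2 : ContinuousOn (fun t => (∫ x, φT x * m₀ x)
      + ∫ s in (0 : ℝ)..t, ∫ x, inner ℝ (w (s, x)) (g x)) (Icc 0 T) :=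
    continuousOn_const.add (continuousOn_primitive_Icc hT hW)
  have hae : (fun t => ∫ x, φT x ∂(μ t : Measure (Torus d))) =ᵐ[volume.restrict (Icc 0 T)]
      fun t => (∫ x, φT x * m₀ x) + ∫ s in (0 : ℝ)..t, ∫ x, inner ℝ (w (s, x)) (g x) := by
    rw [← Measure.restrict_congr_set Ioo_ae_eq_Icc]
    filter_upwards [hslice, h.ae_slice, h.moment_of_C1 hT hm₀ hφ hg hgr] with t h1 h2 h3
    rw [h1, ← h3]
    exact integral_slice h2.1.aemeasurable h2.2.1 φT
  have := Measure.eqOn_Icc_of_ae_eq volume hT.ne hae c1 c2 ⟨hT.le, le_rfl⟩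
  simp only at this
  obtain ⟨C, hC⟩ := exists_bound_torus hg
  rw [this, intervalIntegral.integral_of_le hT.le, integral_Ioc_eq_integral_Ioo,
    integral_cyl (integrable_inner_of_bound h.integrable_flux (b := fun z => g z.2)
      (hg.comp continuous_snd).aestronglyMeasurable fun t _ x => hC x)]

end Representative

/-! ### The primal functional and weak duality -/

section Functionals

variable {d : ℕ} {T q r : ℝ} {f : Torus d → ℝ → ℝ} {H : Torus d → Vec d → ℝ}
  {m₀ φT : Torus d → ℝ} {m : ℝ × Torus d → ℝ} {w : ℝ × Torus d → Vec d}

/-- `y = (∂_t φ, Dφ)` in `(0,T) × 𝕋^d`. -/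
def HasDerivs (T : ℝ) (φ : ℝ → Torus d → ℝ) (y : ℝ × Torus d → ℝ × Vec d) : Prop :=
  ∀ t ∈ Ioo 0 T, ∀ x, HasDerivAt (fun s => φ s x) (y (t, x)).1 t ∧
    HasGradientAt (fun v : Vec d => φ t (x + toTorus v)) (y (t, x)).2 0

theorem HasDerivs.ae_eq {φ : ℝ → Torus d → ℝ} {y y' : ℝ × Torus d → ℝ × Vec d}
    (h : HasDerivs T φ y) (h' : HasDerivs T φ y') : ∀ᵐ z ∂(cyl d T), y z = y' z := by
  filter_upwards [ae_mem_Ioo_cyl] with z hz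
  exact Prod.ext ((h _ hz z.2).1.unique (h' _ hz z.2).1) ((h _ hz z.2).2.unique (h' _ hz z.2).2)

theorem C1Data.hasDerivs {φ : ℝ → Torus d → ℝ} (D : C1Data T φ) :
    HasDerivs T φ fun z => (D.dt z, D.grad z) := fun t ht x =>
  ⟨D.hasDerivAt t ht x, D.hasGradientAt t (Ioo_subset_Icc_self ht) x⟩

theorem C1Data.mem_boundedFun {φ : ℝ → Torus d → ℝ} (D : C1Data T φ) :
    (fun z => (D.dt z, D.grad z)) ∈ boundedFun (cyl d T) (ℝ × Vec d) := by
  obtain ⟨C, -, hC⟩ := D.exists_bound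
  exact boundedFun_mem_of_bound (D.continuous_dt.prodMk D.continuous_grad).aestronglyMeasurable C
    (ae_of_all _ fun z => max_le (hC z).2.1 (hC z).2.2)

theorem HasDerivs.add {φ ψ : ℝ → Torus d → ℝ} {y y' : ℝ × Torus d → ℝ × Vec d}
    (h : HasDerivs T φ y) (h' : HasDerivs T ψ y') : HasDerivs T (φ + ψ) (y + y') := by
  refine fun t ht x => ⟨(h t ht x).1.add (h' t ht x).1, ?_⟩
  have h1 := (h t ht x).2
  have h2 := (h' t ht x).2
  rw [hasGradientAt_iff_hasFDerivAt] at h1 h2 ⊢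
  change HasFDerivAt _ ((InnerProductSpace.toDual ℝ (Vec d)) ((y (t, x)).2 + (y' (t, x)).2)) 0
  rw [map_add]
  exact h1.add h2

theorem HasDerivs.const_smul {φ : ℝ → Torus d → ℝ} {y : ℝ × Torus d → ℝ × Vec d}
    (h : HasDerivs T φ y) (c : ℝ) : HasDerivs T (c • φ) (c • y) :=
  fun t ht x => ⟨(h t ht x).1.const_mul c, hasGradientAt_const_mul (h t ht x).2 c⟩

theorem continuous_apply_zero (hT : 0 < T) {φ : ℝ → Torus d → ℝ}
    (hφ : ContDiffOn ℝ 1 (fun z : ℝ × Vec d => φ z.1 (toTorus z.2)) (Icc 0 T ×ˢ univ)) :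
    Continuous (φ 0) := by
  obtain ⟨D⟩ := exists_C1Data hT hφ
  have : φ 0 = fun x => D.val (0, x) := funext fun x => (D.val_eq 0 ⟨le_rfl, hT.le⟩ x).symm
  rw [this]
  exact D.continuous_val.comp (by fun_prop)

/-- The continuity equation for test functions of class `C¹`. -/
theorem K1.equation_of_hasDerivs (hT : 0 < T) (hm₀ : Continuous m₀) (h : K1 T m₀ m w)
    {ψ : ℝ → Torus d → ℝ}
    (hψ : ContDiffOn ℝ 1 (fun z : ℝ × Vec d => ψ z.1 (toTorus z.2)) (Icc 0 T ×ˢ univ))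
    (hψT : ∀ x, ψ T x = 0) {y : ℝ × Torus d → ℝ × Vec d} (hy : HasDerivs T ψ y) :
    ∫ z, (m z * (y z).1 + inner ℝ (w z) (y z).2) ∂(cyl d T) + ∫ x, ψ 0 x * m₀ x = 0 := by
  obtain ⟨D⟩ := exists_C1Data hT hψ
  have h1 := h.equation_of_C1 hT hm₀ D fun x => by rw [D.val_eq T ⟨hT.le, le_rfl⟩, hψT]
  simp only [D.val_eq 0 ⟨le_rfl, hT.le⟩] at h1
  convert h1 using 2
  refine integral_congr_ae ((hy.ae_eq D.hasDerivs).mono fun z hz => ?_)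
  simp only [hz]

/-- The integrand of the primal functional, as a convex function of `y = (∂_t φ, Dφ)`. -/
def primalDensity (f : Torus d → ℝ → ℝ) (H : Torus d → Vec d → ℝ) (x : Torus d) (y : ℝ × Vec d) :
    ℝ := conjR f x (-y.1 + H x y.2)

theorem primalDensity_nonneg (hf : CouplingCondition f q) (x : Torus d) (y : ℝ × Vec d) :
    0 ≤ primalDensity f H x y := hf.conjR_nonneg _ _

theorem exists_primalDensity_le (hf : CouplingCondition f q) (hH : HamiltonianCondition H r)
    (K : ℝ) : ∃ C : ℝ, 0 ≤ C ∧ ∀ x y, ‖y‖ ≤ K → primalDensity f H x y ≤ C := by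
  obtain ⟨C₁, hC₁, h1⟩ := hH.exists_abs_le K
  obtain ⟨C, hC, h⟩ := hf.exists_bound (K + C₁)
  refine ⟨C, hC, fun x y hy => hf.conjR_le fun m hm => h x _ ?_ m hm⟩
  have h2 := (norm_fst_le y).trans hy
  have h3 := h1 x y.2 ((norm_snd_le y).trans hy)
  rw [Real.norm_eq_abs] at h2
  linarith [neg_le_of_abs_le h2, le_of_abs_le h3]

theorem convexOn_primalDensity (hf : CouplingCondition f q) (hH : HamiltonianCondition H r)
    (x : Torus d) : ConvexOn ℝ univ (primalDensity f H x) := by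
  refine ⟨convex_univ, fun y _ y' _ s t hs ht hst => ?_⟩
  have h1 := (hH.convexOn x).2 (mem_univ y.2) (mem_univ y'.2) hs ht hst
  have h2 := (hf.convexOn_conjR x).2 (mem_univ (-y.1 + H x y.2)) (mem_univ (-y'.1 + H x y'.2))
    hs ht hst
  refine le_trans (hf.conjR_mono x ?_) h2
  simp only [smul_eq_mul, Prod.fst_add, Prod.smul_fst, Prod.snd_add, Prod.smul_snd] at h1 ⊢
  linarith

theorem aestronglyMeasurable_primalDensity (hf : CouplingCondition f q)
    (hH : HamiltonianCondition H r) {y : ℝ × Torus d → ℝ × Vec d} {μ : Measure (ℝ × Torus d)}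
    (hy : AEStronglyMeasurable y μ) :
    AEStronglyMeasurable (fun z => primalDensity f H z.2 (y z)) μ := by
  have h1 : Measurable fun p : Torus d × (ℝ × Vec d) => primalDensity f H p.1 p.2 := by
    have h2 : Measurable fun p : Torus d × (ℝ × Vec d) => H p.1 p.2.2 :=
      (hH.continuous.comp (f := fun p : Torus d × (ℝ × Vec d) => (p.1, p.2.2))
        (by fun_prop)).measurable
    exact hf.measurable_conjR.comp
      (measurable_fst.prodMk ((measurable_fst.comp measurable_snd).neg.add h2))
  exact (h1.comp_aemeasurable
    (measurable_snd.aemeasurable.prodMk hy.aemeasurable)).aestronglyMeasurable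

theorem integrable_primalDensity (hf : CouplingCondition f q)
    (hH : HamiltonianCondition H r) (y : boundedFun (cyl d T) (ℝ × Vec d)) :
    Integrable (fun z => primalDensity f H z.2 (y.1 z)) (cyl d T) := by
  obtain ⟨C, -, hC⟩ := exists_primalDensity_le hf hH (eLpNorm y.1 ⊤ (cyl d T)).toReal
  refine Integrable.of_bound (aestronglyMeasurable_primalDensity hf hH y.2.1) C ?_
  filter_upwards [ae_norm_le_of_boundedFun y] with z hz
  rw [Real.norm_of_nonneg (primalDensity_nonneg hf _ _)]
  exact hC _ _ hz

/-- The integral part of the primal functional, as a function of `(∂_t φ, Dφ)`. -/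
def primalIntegral (T : ℝ) (f : Torus d → ℝ → ℝ) (H : Torus d → Vec d → ℝ)
    (y : boundedFun (cyl d T) (ℝ × Vec d)) : ℝ := ∫ z, primalDensity f H z.2 (y.1 z) ∂(cyl d T)

theorem convexOn_primalIntegral (hf : CouplingCondition f q) (hH : HamiltonianCondition H r) :
    ConvexOn ℝ univ (primalIntegral T f H) := by
  refine ⟨convex_univ, fun y _ y' _ s t hs ht hst => ?_⟩
  have i1 := (integrable_primalDensity hf hH y).const_mul s
  have i2 := (integrable_primalDensity hf hH y').const_mul t
  simp only [primalIntegral, smul_eq_mul]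
  rw [← integral_const_mul, ← integral_const_mul, ← integral_add i1 i2]
  exact integral_mono (integrable_primalDensity hf hH _) (i1.add i2) fun z =>
    (convexOn_primalDensity hf hH z.2).2 (mem_univ _) (mem_univ _) hs ht hst

theorem A_eq (hf : CouplingCondition f q) (hH : HamiltonianCondition H r) {φ : ℝ → Torus d → ℝ}
    {y : boundedFun (cyl d T) (ℝ × Vec d)} (hy : HasDerivs T φ y.1) :
    A T f H m₀ φ = ((primalIntegral T f H y - ∫ x, φ 0 x * m₀ x : ℝ) : EReal) := by
  rw [A, EReal.coe_sub, primalIntegral, ← eintegral_coe (integrable_primalDensity hf hH y)]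
  congr 1
  refine eintegral_congr ?_
  filter_upwards [ae_mem_Ioo_cyl] with z hz
  rw [hf.primitiveConj_eq, (hy z.1 hz z.2).1.deriv, torusGrad_eq (hy z.1 hz z.2).2]
  rfl

theorem integrable_pairing (hm : Integrable m (cyl d T)) (hw : Integrable w (cyl d T))
    (y : boundedFun (cyl d T) (ℝ × Vec d)) :
    Integrable (fun z => m z * (y.1 z).1 + inner ℝ (w z) (y.1 z).2) (cyl d T) := by
  have hb := ae_norm_le_of_boundedFun y
  refine Integrable.add ?_ ?_
  · refine (hm.norm.mul_const (eLpNorm y.1 ⊤ (cyl d T)).toReal).mono' (hm.1.mul y.2.1.fst) ?_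
    filter_upwards [hb] with z hz
    rw [norm_mul]
    gcongr
    exact (norm_fst_le _).trans hz
  · refine (hw.norm.mul_const (eLpNorm y.1 ⊤ (cyl d T)).toReal).mono' (hw.1.inner y.2.1.snd) ?_
    filter_upwards [hb] with z hz
    refine (norm_inner_le_norm _ _).trans ?_
    gcongr
    exact (norm_snd_le _).trans hz

/-- The affine minorants of the energy density, in the variables of the primal problem. -/
theorem minorant_eq (x : Torus d) (m : ℝ) (w : Vec d) (y : ℝ × Vec d) :
    minorant f H x m w (-y.1 + H x y.2, y.2)
      = -(m * y.1 + inner ℝ w y.2) - primalDensity f H x y := by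
  rw [minorant, primalDensity]; ring

theorem hasDerivs_const {g : Torus d → Vec d}
    (hgr : ∀ x, HasGradientAt (fun v : Vec d => φT (x + toTorus v)) (g x) 0) :
    HasDerivs T (fun _ => φT) fun z => (0, g z.2) :=
  fun _ _ x => ⟨hasDerivAt_const _ _, hgr x⟩

/-- Weak duality: the equation tested with `φ - φ_T` turns `B` plus `A` into the integral of the gap
in the Fenchel inequality between the energy density and `primalDensity`. -/
theorem neg_A_le_B (hT : 0 < T) (hf : CouplingCondition f q) (hH : HamiltonianCondition H r)
    (hdata : DataCondition m₀ φT) (h : K1 T m₀ m w) {φ : ℝ → Torus d → ℝ} (hφ : φ ∈ K0 T φT) :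
    -A T f H m₀ φ ≤ B T f H φT m w := by
  obtain ⟨g, hg, hgr⟩ := exists_continuous_gradient hdata.terminal_contDiff
  obtain ⟨D⟩ := exists_C1Data hT hφ.1
  let y : boundedFun (cyl d T) (ℝ × Vec d) := ⟨_, D.mem_boundedFun⟩
  obtain ⟨C, hC⟩ := exists_bound_torus hg
  have hwg : Integrable (fun z => inner ℝ (w z) (g z.2)) (cyl d T) :=
    integrable_inner_of_bound h.integrable_flux (b := fun z => g z.2)
      (hg.comp continuous_snd).aestronglyMeasurable fun t _ x => hC x
  have hφ0 := continuous_apply_zero hT hφ.1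
  have hφTc : Continuous φT := continuous_of_comp_toTorus hdata.terminal_contDiff.continuous
  have hy : HasDerivs T φ y.1 := D.hasDerivs
  have hpair := integrable_pairing h.integrable_density h.integrable_flux y
  rw [A_eq hf hH hy, B, h.terminalCost_eq hT hdata.initial_continuous
    hdata.terminal_contDiff hg hgr]
  have hreg : ContDiffOn ℝ 1 (fun z : ℝ × Vec d => φ z.1 (toTorus z.2)
      + (-1 : ℝ) * φT (toTorus z.2)) (Icc 0 T ×ˢ univ) :=
    hφ.1.add (contDiff_const.mul (hdata.terminal_contDiff.comp contDiff_snd)).contDiffOn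
  -- the test function `φ - φ_T`
  have heq := h.equation_of_hasDerivs hT hdata.initial_continuous
    (ψ := φ + (-1 : ℝ) • fun _ => φT)
    (y := y.1 + (-1 : ℝ) • fun z => (0, g z.2))
    hreg
    (fun x => by simp [hφ.2 x]) (hy.add ((hasDerivs_const hgr).const_smul _))
  have e1 : ∫ z, (m z * ((y.1 + (-1 : ℝ) • fun z : ℝ × Torus d => ((0 : ℝ), g z.2)) z).1
      + inner ℝ (w z) ((y.1 + (-1 : ℝ) • fun z : ℝ × Torus d => ((0 : ℝ), g z.2)) z).2) ∂(cyl d T)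
      = (∫ z, (m z * (y.1 z).1 + inner ℝ (w z) (y.1 z).2) ∂(cyl d T))
        - ∫ z, inner ℝ (w z) (g z.2) ∂(cyl d T) := by
    rw [← integral_sub hpair hwg]
    refine integral_congr_ae (ae_of_all _ fun z => ?_)
    simp [inner_add_right]
    ring
  have e2 : ∫ x, (φ + (-1 : ℝ) • fun _ : ℝ => φT : ℝ → Torus d → ℝ) 0 x * m₀ x
      = (∫ x, φ 0 x * m₀ x) - ∫ x, φT x * m₀ x := by
    have i1 : Integrable fun x => φ 0 x * m₀ x :=
      integrable_of_continuous (hφ0.mul hdata.initial_continuous)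
    have i2 : Integrable fun x => φT x * m₀ x :=
      integrable_of_continuous (hφTc.mul hdata.initial_continuous)
    rw [← integral_sub i1 i2]
    refine integral_congr_ae (ae_of_all _ fun x => ?_)
    simp
    ring
  rw [e1, e2] at heq
  have hle := integral_le_eintegral (hpair.neg.sub (integrable_primalDensity hf hH y))
    (g := fun z => kinetic H z.2 (m z) (w z) + primitive f z.2 (m z)) (by
      filter_upwards [h.nonneg] with z hz
      have := minorant_le hf hH z.2 hz (w z) (-(y.1 z).1 + H z.2 (y.1 z).2, (y.1 z).2)
      rwa [minorant_eq] at this)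
  rw [← EReal.coe_neg]
  refine le_trans (le_of_eq ?_) (add_le_add_left hle _)
  rw [← EReal.coe_add, EReal.coe_eq_coe_iff]
  have e3 : ∫ z, ((-fun z => m z * (y.1 z).1 + inner ℝ (w z) (y.1 z).2)
      - fun z => primalDensity f H z.2 (y.1 z)) z ∂(cyl d T)
      = -(∫ z, (m z * (y.1 z).1 + inner ℝ (w z) (y.1 z).2) ∂(cyl d T)) - primalIntegral T f H y := by
    rw [integral_sub' hpair.neg (integrable_primalDensity hf hH y), integral_neg', primalIntegral]
  rw [e3]
  linarith

end Functionals

/-! ### Strong duality and existence -/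

section StrongDuality

variable {d : ℕ} {T q r : ℝ} {f : Torus d → ℝ → ℝ} {H : Torus d → Vec d → ℝ}
  {m₀ φT : Torus d → ℝ} {m : ℝ × Torus d → ℝ} {w : ℝ × Torus d → Vec d}

theorem HasDerivs.integral_eq {ψ : ℝ → Torus d → ℝ} {y : ℝ × Torus d → ℝ × Vec d}
    (hy : HasDerivs T ψ y) :
    ∫ z, (m z * deriv (fun s => ψ s z.2) z.1 + inner ℝ (w z) (torusGrad (ψ z.1) z.2)) ∂(cyl d T)
      = ∫ z, (m z * (y z).1 + inner ℝ (w z) (y z).2) ∂(cyl d T) := by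
  refine integral_congr_ae ?_
  filter_upwards [ae_mem_Ioo_cyl] with z hz
  rw [(hy z.1 hz z.2).1.deriv, torusGrad_eq (hy z.1 hz z.2).2]

theorem IsTest.contDiffOn {ψ : ℝ → Torus d → ℝ} (h : IsTest T ψ) :
    ContDiffOn ℝ 1 (fun z : ℝ × Vec d => ψ z.1 (toTorus z.2)) (Icc 0 T ×ˢ univ) :=
  (h.1.of_le (by exact_mod_cast le_top)).contDiffOn

theorem IsTest.apply_terminal {ψ : ℝ → Torus d → ℝ} (h : IsTest T ψ) (x : Torus d) : ψ T x = 0 := by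
  obtain ⟨-, t₁, ht, h⟩ := h
  exact h T ht.le x

/-- The initial density, kept constant in time with no flux, is admissible. -/
theorem K1_static (hT : 0 < T) (hdata : DataCondition m₀ φT) :
    K1 T m₀ (fun z => m₀ z.2) (0 : ℝ × Torus d → Vec d) := by
  have hm₀ := hdata.initial_continuous
  obtain ⟨M, hM⟩ := exists_bound_torus hm₀
  refine ⟨?_, integrable_zero _ _ _, ae_of_all _ fun z => hdata.initial_nonneg z.2,
    ae_of_all _ fun t => hdata.initial_mass, fun ψ hψ => ?_⟩
  · exact Integrable.of_bound (hm₀.comp continuous_snd).aestronglyMeasurable M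
      (ae_of_all _ fun z => hM z.2)
  obtain ⟨D⟩ := exists_C1Data hT hψ.contDiffOn
  rw [D.hasDerivs.integral_eq]
  simp only [Pi.zero_apply, inner_zero_left, add_zero]
  obtain ⟨C, hC0, hC⟩ := D.exists_bound
  have hdt := D.continuous_dt
  have hval := D.continuous_val
  have hint : Integrable (fun z : ℝ × Torus d => m₀ z.2 * D.dt z) (cyl d T) := by
    refine Integrable.of_bound ((hm₀.comp continuous_snd).mul hdt).aestronglyMeasurable (M * C)
      (ae_of_all _ fun z => ?_)
    rw [norm_mul]
    exact mul_le_mul (hM z.2) (hC z).2.1 (norm_nonneg _) ((norm_nonneg _).trans (hM z.2))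
  rw [cyl] at hint ⊢
  rw [integral_prod_symm _ hint]
  have hFTC : ∀ x, ∫ t in Ioo 0 T, m₀ x * D.dt (t, x) = -(ψ 0 x * m₀ x) := by
    intro x
    rw [integral_const_mul, ← integral_Ioc_eq_integral_Ioo, ← intervalIntegral.integral_of_le hT.le,
      intervalIntegral.integral_eq_sub_of_hasDerivAt_of_le hT.le (f := fun t => D.val (t, x))
        (by fun_prop) (fun t ht => D.hasDerivAt_val ht x)
        (Continuous.intervalIntegrable (by fun_prop) _ _),
      D.val_eq T ⟨hT.le, le_rfl⟩, D.val_eq 0 ⟨le_rfl, hT.le⟩, hψ.apply_terminal]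
    ring
  simp only [hFTC]
  rw [integral_neg, neg_add_cancel]

/-- The static pair has finite cost, which bounds the primal problem from below. -/
theorem exists_B_static_le (hT : 0 < T) (hf : CouplingCondition f q) (hH : HamiltonianCondition H r)
    (hdata : DataCondition m₀ φT) :
    ∃ c : ℝ, B T f H φT (fun z => m₀ z.2) (0 : ℝ × Torus d → Vec d) ≤ c := by
  obtain ⟨g, hg, hgr⟩ := exists_continuous_gradient hdata.terminal_contDiff
  obtain ⟨C, hC, hlow⟩ := hH.exists_lower_bound
  have hm₀ := hdata.initial_continuous
  have hP : Continuous fun x => m₀ x * C + primR f x (m₀ x) := by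
    have := hf.continuous_primR_max.comp (f := fun x => (x, m₀ x)) (by fun_prop)
    simp only [Function.comp_def, max_eq_left (hdata.initial_nonneg _)] at this
    exact (hm₀.mul_const _).add this
  obtain ⟨M, hM⟩ := exists_bound_torus hP
  have hle : eintegral (cyl d T) (fun z => kinetic H z.2 (m₀ z.2) (0 : Vec d)
      + primitive f z.2 (m₀ z.2)) ≤ eintegral (cyl d T) fun _ => ((M : ℝ) : EReal) := by
    refine eintegral_mono (ae_of_all _ fun z => ?_)
    have h0 := hdata.initial_nonneg z.2
    refine le_trans ?_ (EReal.coe_le_coe_iff.2 ((le_abs_self _).trans (hM z.2)))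
    rw [primitive_of_nonneg h0, EReal.coe_add]
    refine add_le_add_left ?_ _
    rcases h0.eq_or_lt with h0 | h0
    · simp [kinetic, ← h0]
    · rw [kinetic_of_pos hH _ h0, EReal.coe_le_coe_iff]
      refine mul_le_mul_of_nonneg_left ?_ h0.le
      obtain ⟨ξ, hξ⟩ := hH.hamConjR_attained z.2 (-((m₀ z.2)⁻¹ • (0 : Vec d)))
      rw [hξ]
      simpa using neg_le.1 (hlow z.2 ξ)
  rw [eintegral_coe (integrable_const _)] at hle
  rw [B, (K1_static hT hdata).terminalCost_eq hT hm₀ hdata.terminal_contDiff hg hgr]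
  exact ⟨_, (add_le_add_left hle _).trans (le_of_eq (EReal.coe_add _ _).symm)⟩

/-- The infimum of the primal problem is finite. -/
theorem exists_iInf_A_eq (hT : 0 < T) (hf : CouplingCondition f q) (hH : HamiltonianCondition H r)
    (hdata : DataCondition m₀ φT) : ∃ α : ℝ, (⨅ φ ∈ K0 T φT, A T f H m₀ φ) = α := by
  obtain ⟨c, hc⟩ := exists_B_static_le hT hf hH hdata
  have hlow : ((-c : ℝ) : EReal) ≤ ⨅ φ ∈ K0 T φT, A T f H m₀ φ := le_iInf₂ fun φ hφ => by
    rw [EReal.coe_neg, EReal.neg_le]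
    exact (neg_A_le_B hT hf hH hdata (K1_static hT hdata) hφ).trans hc
  have hφ : (fun _ => φT) ∈ K0 T φT :=
    ⟨(hdata.terminal_contDiff.comp contDiff_snd).contDiffOn, fun _ => rfl⟩
  obtain ⟨D⟩ := exists_C1Data (φ := fun _ => φT) hT hφ.1
  have hup := iInf₂_le (f := fun φ (_ : φ ∈ K0 T φT) => A T f H m₀ φ) _ hφ
  rw [A_eq hf hH (y := ⟨_, D.mem_boundedFun⟩) D.hasDerivs] at hup
  refine ⟨_, (EReal.coe_toReal (ne_top_of_le_ne_top (EReal.coe_ne_top _) hup)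
    (ne_bot_of_le_ne_bot (EReal.coe_ne_bot _) hlow)).symm⟩

/-- The pairs formed by `(∂_t ψ, Dψ)` and `∫ ψ(0,x) m₀(x) dx`, for the functions `ψ` of class `C¹`
which vanish at time `T`. -/
def testDerivs (hT : 0 < T) (hm₀ : Continuous m₀) :
    Submodule ℝ (boundedFun (cyl d T) (ℝ × Vec d) × ℝ) where
  carrier := {p | ∃ ψ : ℝ → Torus d → ℝ,
    ContDiffOn ℝ 1 (fun z : ℝ × Vec d => ψ z.1 (toTorus z.2)) (Icc 0 T ×ˢ univ) ∧
    (∀ x, ψ T x = 0) ∧ HasDerivs T ψ p.1.1 ∧ p.2 = ∫ x, ψ 0 x * m₀ x}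
  zero_mem' := by
    refine ⟨0, contDiffOn_const, fun _ => rfl, fun t _ x => ⟨hasDerivAt_const _ _, ?_⟩, by simp⟩
    exact hasGradientAt_const _ _
  add_mem' := by
    rintro p p' ⟨ψ, h1, h2, h3, h4⟩ ⟨ψ', h1', h2', h3', h4'⟩
    refine ⟨ψ + ψ', h1.add h1', fun x => by simp [h2, h2'], h3.add h3', ?_⟩
    have i1 : Integrable fun x => ψ 0 x * m₀ x :=
      integrable_of_continuous ((continuous_apply_zero hT h1).mul hm₀)
    have i2 : Integrable fun x => ψ' 0 x * m₀ x :=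
      integrable_of_continuous ((continuous_apply_zero hT h1').mul hm₀)
    rw [Prod.snd_add, h4, h4', ← integral_add i1 i2]
    simp only [Pi.add_apply, add_mul]
  smul_mem' := by
    rintro c p ⟨ψ, h1, h2, h3, h4⟩
    refine ⟨c • ψ, h1.const_smul c, fun x => by simp [h2], h3.const_smul c, ?_⟩
    rw [Prod.smul_snd, h4, smul_eq_mul, ← integral_const_mul]
    simp only [Pi.smul_apply, smul_eq_mul, mul_assoc]

/-- Perturbing `y` on a set `E` changes the primal integral by at most a multiple of the measure of
`E`. -/
theorem exists_primalIntegral_add_le (hf : CouplingCondition f q) (hH : HamiltonianCondition H r)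
    (y : boundedFun (cyl d T) (ℝ × Vec d)) (K : ℝ) : ∃ C : ℝ, 0 ≤ C ∧
      ∀ (v : boundedFun (cyl d T) (ℝ × Vec d)) (E : Set (ℝ × Torus d)), MeasurableSet E →
        (∀ᵐ z ∂(cyl d T), ‖v.1 z‖ ≤ E.indicator (fun _ => K) z) →
        primalIntegral T f H (y + v) ≤ C * (cyl d T).real E + primalIntegral T f H y := by
  obtain ⟨C, hC0, hC⟩ := exists_primalDensity_le hf hH ((eLpNorm y.1 ⊤ (cyl d T)).toReal + K)
  refine ⟨C, hC0, fun v E hE hv => ?_⟩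
  have i1 : Integrable (E.indicator fun _ => C) (cyl d T) :=
    (integrable_const C).indicator hE
  have e1 : ∫ z, E.indicator (fun _ => C) z ∂(cyl d T) = C * (cyl d T).real E := by
    rw [integral_indicator_const _ hE, smul_eq_mul, mul_comm]
  rw [← e1, primalIntegral, primalIntegral, ← integral_add i1 (integrable_primalDensity hf hH y)]
  refine integral_mono_ae (integrable_primalDensity hf hH _)
    (i1.add (integrable_primalDensity hf hH y)) ?_
  filter_upwards [hv, ae_norm_le_of_boundedFun y] with z hz hyz
  change primalDensity f H z.2 (y.1 z + v.1 z) ≤ E.indicator (fun _ => C) z + _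
  by_cases hzE : z ∈ E
  · rw [indicator_of_mem hzE] at hz ⊢
    have := hC z.2 (y.1 z + v.1 z) ((norm_add_le _ _).trans (add_le_add hyz hz))
    linarith [primalDensity_nonneg (H := H) hf z.2 (y.1 z)]
  · rw [indicator_of_notMem hzE] at hz ⊢
    rw [norm_le_zero_iff.1 hz, add_zero, zero_add]

/-- The values `(∂_t φ, Dφ)` at which `minorant_eq` gives the minorant with parameter `p`, as a
bounded function. -/
theorem exists_boundedFun_of_measurable (hH : HamiltonianCondition H r)
    {p : ℝ × Torus d → ℝ × Vec d} (hp : Measurable p) {R : ℝ} (hR : ∀ z, ‖p z‖ ≤ R) :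
    ∃ y : boundedFun (cyl d T) (ℝ × Vec d),
      ∀ z, y.1 z = (H z.2 (p z).2 - (p z).1, (p z).2) := by
  obtain ⟨C, hC0, hC⟩ := hH.exists_abs_le R
  have h1 : Measurable fun z => H z.2 (p z).2 :=
    hH.continuous.measurable.comp (measurable_snd.prodMk (measurable_snd.comp hp))
  have h2 : Measurable fun z => (H z.2 (p z).2 - (p z).1, (p z).2) :=
    (h1.sub (measurable_fst.comp hp)).prodMk (measurable_snd.comp hp)
  refine ⟨⟨_, boundedFun_mem_of_bound h2.aestronglyMeasurable (C + R) (ae_of_all _ fun z => ?_)⟩,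
    fun z => rfl⟩
  have h3 := (norm_fst_le (p z)).trans (hR z)
  have h4 := (norm_snd_le (p z)).trans (hR z)
  refine max_le ((norm_sub_le _ _).trans (add_le_add (hC z.2 _ h4) h3)) ?_
  exact h4.trans (by linarith)

theorem isLUB_range_coe {ι : Type*} [Nonempty ι] {h : ι → ℝ} {u : ℝ} (hu : IsLUB (range h) u) :
    IsLUB (range fun i => (h i : EReal)) u := by
  refine ⟨?_, fun e he => ?_⟩
  · rintro _ ⟨i, rfl⟩
    exact EReal.coe_le_coe_iff.2 (hu.1 ⟨i, rfl⟩)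
  · induction e with
    | bot => exact absurd (he ⟨Classical.arbitrary ι, rfl⟩) (not_le.2 (EReal.bot_lt_coe _))
    | top => exact le_top
    | coe e =>
      refine EReal.coe_le_coe_iff.2 (hu.2 ?_)
      rintro _ ⟨i, rfl⟩
      exact EReal.coe_le_coe_iff.1 (he ⟨i, rfl⟩)

/-- If the pairing of `(m,w)` with bounded functions is controlled by the primal integral, then `m`
is nonnegative and the energy density is integrable. -/
theorem exists_integrable_energy (hf : CouplingCondition f q) (hH : HamiltonianCondition H r)
    (hm : Integrable m (cyl d T)) (hw : Integrable w (cyl d T)) {M : ℝ}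
    (h : ∀ y : boundedFun (cyl d T) (ℝ × Vec d),
      -(∫ z, (m z * (y.1 z).1 + inner ℝ (w z) (y.1 z).2) ∂(cyl d T)) ≤ M + primalIntegral T f H y) :
    ∃ u : ℝ × Torus d → ℝ, Integrable u (cyl d T) ∧ ∫ z, u z ∂(cyl d T) ≤ M ∧
      (∀ᵐ z ∂(cyl d T), 0 ≤ m z) ∧
      ∀ᵐ z ∂(cyl d T), kinetic H z.2 (m z) (w z) + primitive f z.2 (m z) = u z := by
  set e := TopologicalSpace.denseSeq (ℝ × Vec d)
  have key : ∀ (y : boundedFun (cyl d T) (ℝ × Vec d)) (p : ℝ × Torus d → ℝ × Vec d),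
      (∀ z, y.1 z = (H z.2 (p z).2 - (p z).1, (p z).2)) →
      (fun z => minorant f H z.2 (m z) (w z) (p z)) = fun z =>
        -(m z * (y.1 z).1 + inner ℝ (w z) (y.1 z).2) - primalDensity f H z.2 (y.1 z) := by
    intro y p hy
    funext z
    rw [← minorant_eq, hy z]
    congr 1
    exact Prod.ext (by simp) rfl
  obtain ⟨u, hu, huM, hlub⟩ := exists_integrable_isLUB_of_selection (μ := cyl d T)
    (h := fun k z => minorant f H z.2 (m z) (w z) (e k)) (M := M) (fun k => by
      obtain ⟨y, hy⟩ := exists_boundedFun_of_measurable (T := T) hH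
        (p := fun _ => e k) measurable_const (R := ‖e k‖) fun _ => le_rfl
      rw [key y _ hy]
      exact (integrable_pairing hm hw y).neg.sub (integrable_primalDensity hf hH y))
    (fun k n hk hkn => by
      obtain ⟨y, hy⟩ := exists_boundedFun_of_measurable (T := T) hH
        (p := fun z => e (k z)) (measurable_from_nat.comp hk)
        (R := ∑ i ∈ Finset.range (n + 1), ‖e i‖) fun z =>
          Finset.single_le_sum (f := fun i => ‖e i‖) (fun i _ => norm_nonneg _)
            (Finset.mem_range.2 (Nat.lt_succ_of_le (hkn z)))
      have hi : Integrable (fun z => -(m z * (y.1 z).1 + inner ℝ (w z) (y.1 z).2)) (cyl d T) :=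
        (integrable_pairing hm hw y).neg
      rw [key y _ hy, integral_sub hi (integrable_primalDensity hf hH y), integral_neg]
      have := h y
      rw [primalIntegral] at this
      linarith)
  have hm0 : ∀ᵐ z ∂(cyl d T), 0 ≤ m z := hlub.mono fun z hz =>
    nonneg_of_minorant_le hf hH fun k => hz.1 ⟨k, rfl⟩
  refine ⟨u, hu, huM, hm0, ?_⟩
  filter_upwards [hlub, hm0] with z hz hmz
  exact (isLUB_minorant hf hH z.2 hmz (w z)).unique (isLUB_range_coe hz)

/-- The continuity equation preserves the mass. -/
theorem ContinuityEquation.mass (hT : 0 < T) (hm : Integrable m (cyl d T))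
    (hw : Integrable w (cyl d T)) (hmass : ∫ x, m₀ x = 1) (h : ContinuityEquation T m₀ m w) :
    ∀ᵐ t ∂(volume.restrict (Ioo 0 T)), ∫ x, m (t, x) = 1 := by
  have := h.moment_of_smooth hT hm hw (ξ := fun _ => 1) (g := fun _ => 0) contDiff_const
    continuous_const fun x => hasGradientAt_const _ _
  simpa [hmass] using this

/-- Strong duality and existence of a minimizer: any lower bound of the primal problem is attained
by some admissible pair, produced by the Hahn-Banach theorem. -/
theorem exists_K1_B_le (hT : 0 < T) (hf : CouplingCondition f q) (hH : HamiltonianCondition H r)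
    (hdata : DataCondition m₀ φT) {α : ℝ} (hα : ∀ φ ∈ K0 T φT, (α : EReal) ≤ A T f H m₀ φ) :
    ∃ (m : ℝ × Torus d → ℝ) (w : ℝ × Torus d → Vec d) (β : ℝ), K1 T m₀ m w ∧
      B T f H φT m w = β ∧ β ≤ -α := by
  obtain ⟨g, hg, hgr⟩ := exists_continuous_gradient hdata.terminal_contDiff
  have hm₀ := hdata.initial_continuous
  have hφTc : Continuous φT := continuous_of_comp_toTorus hdata.terminal_contDiff.continuous
  have hreg : ContDiffOn ℝ 1 (fun z : ℝ × Vec d => φT (toTorus z.2)) (Icc 0 T ×ˢ univ) :=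
    (hdata.terminal_contDiff.comp contDiff_snd).contDiffOn
  obtain ⟨Cg, hCg⟩ := exists_bound_torus hg
  let x₀ : boundedFun (cyl d T) (ℝ × Vec d) := ⟨fun z => (0, g z.2),
    boundedFun_mem_of_bound (by fun_prop : Continuous fun z : ℝ × Torus d =>
      ((0 : ℝ), g z.2)).aestronglyMeasurable Cg (ae_of_all _ fun z => by
        refine max_le ?_ (hCg z.2)
        simpa using (norm_nonneg _).trans (hCg z.2))⟩
  obtain ⟨ρ, hρR, hρ⟩ := exists_linearMap_le_of_convexOn
    (convexOn_primalIntegral (T := T) hf hH) x₀ (testDerivs hT hm₀)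
    (α := α + ∫ x, φT x * m₀ x) (by
      rintro ⟨y, l⟩ ⟨ψ, h1, h2, h3, h4⟩
      have hmem : (fun _ => φT : ℝ → Torus d → ℝ) + ψ ∈ K0 T φT :=
        ⟨hreg.add h1, fun x => by simp [h2]⟩
      have hd : HasDerivs T ((fun _ => φT : ℝ → Torus d → ℝ) + ψ) (x₀ + y).1 :=
        (hasDerivs_const hgr).add h3
      have := hα _ hmem
      rw [A_eq hf hH hd, EReal.coe_le_coe_iff] at this
      have i1 : Integrable fun x => φT x * m₀ x := integrable_of_continuous (hφTc.mul hm₀)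
      have i2 : Integrable fun x => ψ 0 x * m₀ x :=
        integrable_of_continuous ((continuous_apply_zero hT h1).mul hm₀)
      simp only [Pi.add_apply, add_mul] at this
      rw [integral_add i1 i2] at this
      simp only at h4 ⊢
      linarith)
  have hbdd : BoundedOnSmallSets ρ := by
    refine ⟨primalIntegral T f H x₀ - (α + ∫ x, φT x * m₀ x), fun K => ?_⟩
    obtain ⟨C, hC0, hC⟩ := exists_primalIntegral_add_le hf hH x₀ K
    exact ⟨C, hC0, fun v E hE hv => by linarith [hC v E hE hv, hρ v]⟩
  obtain ⟨m, w, hm, hw, hmw⟩ := exists_integrable_of_functional hbdd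
  have hneg : ∀ y : ℝ × Torus d → ℝ × Vec d,
      ∫ z, ((-m) z * (y z).1 + inner ℝ ((-w) z) (y z).2) ∂(cyl d T)
        = -∫ z, (m z * (y z).1 + inner ℝ (w z) (y z).2) ∂(cyl d T) := fun y => by
    rw [← integral_neg]
    refine integral_congr_ae (ae_of_all _ fun z => ?_)
    simp only [Pi.neg_apply, inner_neg_left]
    ring
  obtain ⟨u, hu, huM, hm0, hen⟩ := exists_integrable_energy hf hH hm.neg hw.neg
    (M := ρ x₀ - (α + ∫ x, φT x * m₀ x)) (fun y => by
      rw [hneg, ← hmw, neg_neg]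
      have h1 := hρ (y - x₀)
      rw [map_sub, add_sub_cancel] at h1
      linarith)
  have hcont : ContinuityEquation T m₀ (-m) (-w) := fun ψ hψ => by
    obtain ⟨D⟩ := exists_C1Data hT hψ.contDiffOn
    have h1 := hρR (⟨_, D.mem_boundedFun⟩, _) ⟨ψ, hψ.contDiffOn, hψ.apply_terminal, D.hasDerivs, rfl⟩
    rw [D.hasDerivs.integral_eq, hneg, ← hmw ⟨_, D.mem_boundedFun⟩, h1]
    exact neg_add_cancel _
  have hK : K1 T m₀ (-m) (-w) := ⟨hm.neg, hw.neg, hm0,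
    hcont.mass hT hm.neg hw.neg hdata.initial_mass, hcont⟩
  -- the value of `ρ` at `(0, Dφ_T)` is the flux part of the terminal cost
  have hx₀ : ρ x₀ = -∫ z, inner ℝ ((-w) z) (g z.2) ∂(cyl d T) := by
    have := hneg x₀.1
    rw [← hmw] at this
    simp only [x₀, mul_zero, zero_add] at this
    rw [this, neg_neg]
  refine ⟨_, _, (∫ z, u z ∂(cyl d T)) + ((∫ x, φT x * m₀ x)
    + ∫ z, inner ℝ ((-w) z) (g z.2) ∂(cyl d T)), hK, ?_, by linarith⟩
  rw [B, hK.terminalCost_eq hT hm₀ hdata.terminal_contDiff hg hgr, eintegral_congr hen,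
    eintegral_coe hu, ← EReal.coe_add]

end StrongDuality

/-! ### Uniqueness and integrability of the minimizer -/

section Minimizers

variable {d : ℕ} {T q r : ℝ} {f : Torus d → ℝ → ℝ} {H : Torus d → Vec d → ℝ}
  {m₀ φT : Torus d → ℝ} {m m' : ℝ × Torus d → ℝ} {w w' : ℝ × Torus d → Vec d}

/-- The minorants of the energy density which are optimal in the first variable. -/
theorem primR_sub_le_energy (hf : CouplingCondition f q) (hH : HamiltonianCondition H r)
    {x : Torus d} {m : ℝ} (hm : 0 ≤ m) {w : Vec d} {u : ℝ}
    (hu : kinetic H x m w + primitive f x m = u) (b : Vec d) :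
    primR f x m - m * H x b - inner ℝ w b ≤ u := by
  have h := minorant_le hf hH x hm w (f x m, b)
  rw [hu, EReal.coe_le_coe_iff, minorant, hf.conjR_apply x hm] at h
  linarith

/-- Strict convexity of the energy density. -/
theorem eq_of_energy_midpoint (hf : CouplingCondition f q) (hH : HamiltonianCondition H r)
    {x : Torus d} {m m' : ℝ} (hm : 0 ≤ m) (hm' : 0 ≤ m') {w w' : Vec d} {u u' : ℝ}
    (hu : kinetic H x m w + primitive f x m = u)
    (hu' : kinetic H x m' w' + primitive f x m' = u')
    (hmid : kinetic H x ((1 / 2 : ℝ) * (m + m')) ((1 / 2 : ℝ) • (w + w'))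
      + primitive f x ((1 / 2 : ℝ) * (m + m')) = ((1 / 2 * (u + u') : ℝ) : EReal)) :
    m = m' ∧ w = w' := by
  have h0 : 0 ≤ (1 / 2 : ℝ) * (m + m') := by positivity
  rcases h0.eq_or_lt with h0 | h0
  · obtain rfl : m = 0 := by linarith
    obtain rfl : m' = 0 := by linarith
    have hz : ∀ {w : Vec d} {u : ℝ}, kinetic H x 0 w + primitive f x 0 = u → w = 0 := by
      intro w u h
      by_contra hw
      rw [kinetic, if_pos rfl, if_neg hw, primitive_of_nonneg le_rfl, EReal.top_add_coe] at h
      exact EReal.coe_ne_top _ h.symm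
    exact ⟨rfl, (hz hu).trans (hz hu').symm⟩
  · set n := (1 / 2 : ℝ) * (m + m') with hn
    -- `ξ` is optimal at the midpoint, hence at both points
    obtain ⟨ξ, hξ⟩ := hH.hamConjR_attained x (-(n⁻¹ • ((1 / 2 : ℝ) • (w + w'))))
    have hscale : ∀ {n : ℝ} (v : Vec d), 0 < n →
        n * (inner ℝ (-(n⁻¹ • v)) ξ - H x ξ) = - inner ℝ v ξ - n * H x ξ := fun v hn => by
      rw [inner_neg_left, inner_smul_left]
      simp only [conj_trivial]
      field_simp
    rw [kinetic_of_pos hH x h0, primitive_of_nonneg h0.le, ← EReal.coe_add, EReal.coe_eq_coe_iff,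
      hξ, hscale _ h0, inner_smul_left, inner_add_left] at hmid
    simp only [conj_trivial] at hmid
    have h1 := primR_sub_le_energy hf hH hm hu ξ
    have h2 := primR_sub_le_energy hf hH hm' hu' ξ
    have hmm : m = m' := by
      by_contra hne
      have t1 := hf.tangent_lt x h0.le hm fun h => hne (by rw [hn] at h; linarith)
      have t2 := hf.tangent_lt x h0.le hm' fun h => hne (by rw [hn] at h; linarith)
      have t3 : f x n * (m - n) + f x n * (m' - n) = 0 := by rw [hn]; ring
      have t4 : n * H x ξ = 1 / 2 * (m * H x ξ + m' * H x ξ) := by rw [hn]; ring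
      linarith
    subst hmm
    have hnm : n = m := by rw [hn]; ring
    rw [hnm] at h0 hmid
    have hgrad : ∀ {v : Vec d} {a : ℝ}, kinetic H x m v + primitive f x m = a →
        a = primR f x m - m * H x ξ - inner ℝ v ξ → -(m⁻¹ • v) = gradient (H x) ξ := by
      intro v a h ha
      rw [kinetic_of_pos hH x h0, primitive_of_nonneg h0.le, ← EReal.coe_add,
        EReal.coe_eq_coe_iff] at h
      refine hH.eq_gradient_of_hamConjR_eq (mul_left_cancel₀ h0.ne' ?_)
      rw [hscale v h0]
      linarith
    have h3 := (hgrad hu (by linarith)).trans (hgrad hu' (by linarith)).symm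
    exact ⟨rfl, smul_right_injective _ (inv_ne_zero h0.ne') (neg_injective h3)⟩

/-- The energy density of a pair of finite cost is integrable. -/
theorem K1.exists_integrable_energy (hf : CouplingCondition f q) (hH : HamiltonianCondition H r)
    (h : K1 T m₀ m w) (htop : eintegral (cyl d T)
      (fun z => kinetic H z.2 (m z) (w z) + primitive f z.2 (m z)) ≠ ⊤) :
    ∃ u : ℝ × Torus d → ℝ, Integrable u (cyl d T) ∧
      ∀ᵐ z ∂(cyl d T), kinetic H z.2 (m z) (w z) + primitive f z.2 (m z) = u z := by
  refine exists_integrable_of_eintegral_ne_top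
    (integrable_primalDensity hf hH (0 : boundedFun (cyl d T) (ℝ × Vec d))).neg
    (aemeasurable_energy hf hH h.integrable_density.1.aemeasurable
      h.integrable_flux.1.aemeasurable h.nonneg) ?_ htop
  filter_upwards [h.nonneg] with z hz
  have := minorant_le hf hH z.2 hz (w z) (-(0 : ℝ × Vec d).1 + H z.2 (0 : ℝ × Vec d).2,
    (0 : ℝ × Vec d).2)
  rw [minorant_eq] at this
  simpa using this

/-- A pair of finite cost has an integrable energy density, and its cost is the integral of that
density plus the terminal cost in its affine form. -/
theorem K1.exists_energy_of_B_eq (hT : 0 < T) (hf : CouplingCondition f q)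
    (hH : HamiltonianCondition H r) (hdata : DataCondition m₀ φT) (h : K1 T m₀ m w)
    {g : Torus d → Vec d} (hg : Continuous g)
    (hgr : ∀ x, HasGradientAt (fun v : Vec d => φT (x + toTorus v)) (g x) 0) {β : ℝ}
    (hB : B T f H φT m w = β) :
    ∃ u : ℝ × Torus d → ℝ, Integrable u (cyl d T) ∧
      (∀ᵐ z ∂(cyl d T), kinetic H z.2 (m z) (w z) + primitive f z.2 (m z) = u z) ∧
      β = (∫ z, u z ∂(cyl d T)) + ((∫ x, φT x * m₀ x) + ∫ z, inner ℝ (w z) (g z.2) ∂(cyl d T)) := by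
  rw [B, h.terminalCost_eq hT hdata.initial_continuous hdata.terminal_contDiff hg hgr] at hB
  obtain ⟨u, hu, hue⟩ := h.exists_integrable_energy hf hH fun htop => by
    rw [htop, EReal.top_add_coe] at hB
    exact EReal.coe_ne_top _ hB.symm
  refine ⟨u, hu, hue, ?_⟩
  rw [eintegral_congr hue, eintegral_coe hu, ← EReal.coe_add, EReal.coe_eq_coe_iff] at hB
  exact hB.symm

theorem K1.midpoint (hT : 0 < T) (h : K1 T m₀ m w) (h' : K1 T m₀ m' w') :
    K1 T m₀ (fun z => (1 / 2 : ℝ) * (m z + m' z)) fun z => (1 / 2 : ℝ) • (w z + w' z) := by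
  refine ⟨(h.integrable_density.add h'.integrable_density).const_mul _,
    (h.integrable_flux.add h'.integrable_flux).smul (1 / 2 : ℝ), ?_, ?_, fun ψ hψ => ?_⟩
  · filter_upwards [h.nonneg, h'.nonneg] with z h1 h2
    positivity
  · filter_upwards [h.ae_slice, h'.ae_slice] with t h1 h2
    rw [integral_const_mul, integral_add h1.1 h2.1, h1.2.2, h2.2.2]
    norm_num
  · obtain ⟨D⟩ := exists_C1Data hT hψ.contDiffOn
    let y : boundedFun (cyl d T) (ℝ × Vec d) := ⟨_, D.mem_boundedFun⟩
    have hy : HasDerivs T ψ y.1 := D.hasDerivs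
    have e1 := h.continuity ψ hψ
    have e2 := h'.continuity ψ hψ
    rw [hy.integral_eq] at e1 e2 ⊢
    have e3 : ∫ z, (1 / 2 * (m z + m' z) * (y.1 z).1
        + inner ℝ ((1 / 2 : ℝ) • (w z + w' z)) (y.1 z).2) ∂(cyl d T)
        = 1 / 2 * ((∫ z, (m z * (y.1 z).1 + inner ℝ (w z) (y.1 z).2) ∂(cyl d T))
          + ∫ z, (m' z * (y.1 z).1 + inner ℝ (w' z) (y.1 z).2) ∂(cyl d T)) := by
      rw [← integral_add (integrable_pairing h.integrable_density h.integrable_flux y)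
        (integrable_pairing h'.integrable_density h'.integrable_flux y), ← integral_const_mul]
      refine integral_congr_ae (ae_of_all _ fun z => ?_)
      simp only [inner_smul_left, inner_add_left, conj_trivial]
      ring
    rw [e3]
    linarith

/-- Two minimizers coincide. -/
theorem K1.eq_of_isMin (hT : 0 < T) (hf : CouplingCondition f q) (hH : HamiltonianCondition H r)
    (hdata : DataCondition m₀ φT) (h : K1 T m₀ m w) (h' : K1 T m₀ m' w') {β : ℝ}
    (hB : B T f H φT m w = β) (hB' : B T f H φT m' w' = β)
    (hmin : ∀ n v, K1 T m₀ n v → (β : EReal) ≤ B T f H φT n v) :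
    m' =ᵐ[cyl d T] m ∧ w' =ᵐ[cyl d T] w := by
  obtain ⟨g, hg, hgr⟩ := exists_continuous_gradient hdata.terminal_contDiff
  obtain ⟨C, hC⟩ := exists_bound_torus hg
  obtain ⟨u, hu, hue, hβ⟩ := h.exists_energy_of_B_eq hT hf hH hdata hg hgr hB
  obtain ⟨u', hu', hue', hβ'⟩ := h'.exists_energy_of_B_eq hT hf hH hdata hg hgr hB'
  have hK := h.midpoint hT h'
  have hle : ∀ᵐ z ∂(cyl d T), kinetic H z.2 ((1 / 2 : ℝ) * (m z + m' z))
      ((1 / 2 : ℝ) • (w z + w' z)) + primitive f z.2 ((1 / 2 : ℝ) * (m z + m' z))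
      ≤ ((1 / 2 * (u z + u' z) : ℝ) : EReal) := by
    filter_upwards [hue, hue', h.nonneg, h'.nonneg] with z h1 h2 h3 h4
    refine (isLUB_minorant hf hH z.2 (by positivity) _).2 ?_
    rintro _ ⟨k, rfl⟩
    have l1 := minorant_le hf hH z.2 h3 (w z) (TopologicalSpace.denseSeq (ℝ × Vec d) k)
    have l2 := minorant_le hf hH z.2 h4 (w' z) (TopologicalSpace.denseSeq (ℝ × Vec d) k)
    rw [h1, EReal.coe_le_coe_iff] at l1
    rw [h2, EReal.coe_le_coe_iff] at l2
    refine EReal.coe_le_coe_iff.2 ?_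
    rw [minorant] at l1 l2 ⊢
    simp only [inner_smul_left, inner_add_left, conj_trivial]
    linarith
  have hi : Integrable (fun z => 1 / 2 * (u z + u' z)) (cyl d T) := (hu.add hu').const_mul _
  obtain ⟨v, hv, hve⟩ := hK.exists_integrable_energy hf hH (by
    refine ne_top_of_le_ne_top ?_ (eintegral_mono hle)
    rw [eintegral_coe hi]
    exact EReal.coe_ne_top _)
  have hwi : ∀ {v : ℝ × Torus d → Vec d}, Integrable v (cyl d T) →
      Integrable (fun z => inner ℝ (v z) (g z.2)) (cyl d T) := fun hv =>
    integrable_inner_of_bound hv (b := fun z => g z.2)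
      (hg.comp continuous_snd).aestronglyMeasurable fun t _ x => hC x
  have hτ : ∫ z, inner ℝ ((1 / 2 : ℝ) • (w z + w' z)) (g z.2) ∂(cyl d T)
      = 1 / 2 * ((∫ z, inner ℝ (w z) (g z.2) ∂(cyl d T))
        + ∫ z, inner ℝ (w' z) (g z.2) ∂(cyl d T)) := by
    rw [← integral_add (hwi h.integrable_flux) (hwi h'.integrable_flux), ← integral_const_mul]
    simp only [inner_smul_left, inner_add_left, conj_trivial]
  have hβK := hmin _ _ hK
  rw [B, hK.terminalCost_eq hT hdata.initial_continuous hdata.terminal_contDiff hg hgr,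
    eintegral_congr hve, eintegral_coe hv, ← EReal.coe_add, EReal.coe_le_coe_iff, hτ] at hβK
  have hvle : ∀ᵐ z ∂(cyl d T), v z ≤ 1 / 2 * (u z + u' z) := by
    filter_upwards [hle, hve] with z h1 h2
    rwa [h2, EReal.coe_le_coe_iff] at h1
  have hint : ∫ z, 1 / 2 * (u z + u' z) ∂(cyl d T)
      = 1 / 2 * ((∫ z, u z ∂(cyl d T)) + ∫ z, u' z ∂(cyl d T)) := by
    rw [integral_const_mul, integral_add hu hu']
  -- minimality forces equality in the convexity inequality
  have heq : v =ᵐ[cyl d T] fun z => 1 / 2 * (u z + u' z) :=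
    (integral_eq_iff_of_ae_le hv hi hvle).1
      (le_antisymm (integral_mono_ae hv hi hvle) (by linarith))
  have hfin : ∀ᵐ z ∂(cyl d T), m z = m' z ∧ w z = w' z := by
    filter_upwards [hue, hue', h.nonneg, h'.nonneg, hve, heq] with z h1 h2 h3 h4 h5 h6
    exact eq_of_energy_midpoint hf hH h3 h4 h1 h2 (by rw [h5, h6])
  exact ⟨hfin.mono fun z hz => hz.1.symm, hfin.mono fun z hz => hz.2.symm⟩

/-- The growth of the coupling controls the density in `L^q`. -/
theorem memLp_density (hf : CouplingCondition f q) (hH : HamiltonianCondition H r)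
    (hm : Integrable m (cyl d T)) (hm0 : ∀ᵐ z ∂(cyl d T), 0 ≤ m z)
    {u : ℝ × Torus d → ℝ} (hu : Integrable u (cyl d T))
    (hue : ∀ᵐ z ∂(cyl d T), kinetic H z.2 (m z) (w z) + primitive f z.2 (m z) = u z) :
    MemLp m (ENNReal.ofReal q) (cyl d T) := by
  have hq : 0 < q := by linarith [hf.one_lt]
  obtain ⟨C, hC0, hC⟩ := hf.growth
  obtain ⟨C', hC'0, hC'⟩ := hH.exists_abs_le 0
  rw [← integrable_norm_rpow_iff hm.1 (by simpa using hq) ENNReal.ofReal_ne_top,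
    ENNReal.toReal_ofReal hq.le]
  -- `(1 / C) (m / 2) ^ q - C m / 2 ≤ F(x, m)` by the growth of the coupling at `m / 2`
  refine Integrable.mono' (g := fun z => 2 ^ q * (C * (u z + (C' + C / 2) * m z)))
    (((hu.add (hm.const_mul _)).const_mul _).const_mul _)
    (hm.1.norm.aemeasurable.pow_const q).aestronglyMeasurable ?_
  filter_upwards [hm0, hue] with z hz he
  have h1 := primR_sub_le_energy hf hH hz he 0
  have h2 := hf.mul_half_le_primR z.2 hz
  have h3 := (hC z.2 (m z / 2) (by positivity)).1
  have h4 := mul_le_mul_of_nonneg_left (le_of_abs_le (hC' z.2 0 (by simp))) hz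
  rw [inner_zero_right] at h1
  have h5 := mul_le_mul_of_nonneg_right h3 (show 0 ≤ m z / 2 by positivity)
  have h6 : (m z / 2) ^ (q - 1) * (m z / 2) = (m z / 2) ^ q := by
    rw [← Real.rpow_add_one' (by positivity) (by linarith)]
    simp
  have h7 : 1 / C * (m z / 2) ^ q ≤ u z + (C' + C / 2) * m z := by
    rw [← h6]
    linarith
  rw [Real.norm_of_nonneg (by positivity), Real.norm_of_nonneg hz,
    show m z = 2 * (m z / 2) by ring, Real.mul_rpow (by norm_num) (by positivity)]
  refine mul_le_mul_of_nonneg_left ?_ (by positivity)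
  rw [one_div, inv_mul_le_iff₀ hC0] at h7
  rwa [show 2 * (m z / 2) = m z by ring]

/-- The growth of the Hamiltonian controls the flux in `L^s`, where `s = r'q / (r' + q - 1)`. -/
theorem memLp_flux (hf : CouplingCondition f q) (hH : HamiltonianCondition H r)
    (hm : Integrable m (cyl d T)) (hm0 : ∀ᵐ z ∂(cyl d T), 0 ≤ m z)
    (hmq : MemLp m (ENNReal.ofReal q) (cyl d T)) (hw : Integrable w (cyl d T))
    {u : ℝ × Torus d → ℝ} (hu : Integrable u (cyl d T))
    (hue : ∀ᵐ z ∂(cyl d T), kinetic H z.2 (m z) (w z) + primitive f z.2 (m z) = u z) :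
    MemLp w (ENNReal.ofReal (r.conjExponent * q / (r.conjExponent + q - 1))) (cyl d T) := by
  have hq := hf.one_lt
  have hr := hH.one_lt
  have hq1 : 0 < q - 1 := by linarith
  have hr1 : 0 < r - 1 := by linarith
  have hden : 0 < r * q - q + 1 := by nlinarith
  have hsval : r.conjExponent * q / (r.conjExponent + q - 1) = r * q / (r * q - q + 1) := by
    have : r.conjExponent + q - 1 = (r * q - q + 1) / (r - 1) := by
      rw [Real.conjExponent]; field_simp; ring
    rw [this, Real.conjExponent]
    field_simp
  rw [hsval]
  set s := r * q / (r * q - q + 1) with hs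
  have hs1 : 0 < s - 1 := by
    have : s - 1 = (q - 1) / (r * q - q + 1) := by rw [hs]; field_simp; ring
    rw [this]; positivity
  -- the exponent `s` is the one for which Young's inequality closes the estimate
  have hsr : (s - 1) * r * q.conjExponent = s := by
    rw [hs, Real.conjExponent]; field_simp; ring
  obtain ⟨C, hC0, hC⟩ := hH.growth
  -- the size of the test direction, chosen so that `(C / r) ε ^ r = ε / 2`
  set ε := (r / (2 * C)) ^ (1 / (r - 1)) with hε
  have hε0 : 0 < ε := by positivity
  have hεr : C / r * ε ^ r = ε / 2 := by
    have h1 : ε ^ (r - 1) = r / (2 * C) := by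
      rw [hε, ← Real.rpow_mul (by positivity), one_div_mul_cancel hr1.ne', Real.rpow_one]
    have h2 : ε ^ r = ε ^ (r - 1) * ε := by
      rw [← Real.rpow_add_one hε0.ne']; simp
    rw [h2, h1]; field_simp
  have hmq' : Integrable (fun z => ‖m z‖ ^ q) (cyl d T) := by
    have := hmq.integrable_norm_rpow (by simpa using by linarith) ENNReal.ofReal_ne_top
    rwa [ENNReal.toReal_ofReal (by linarith)] at this
  rw [← integrable_norm_rpow_iff hw.1 (by simpa using by linarith) ENNReal.ofReal_ne_top,
    ENNReal.toReal_ofReal (by linarith)]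
  refine Integrable.mono' (g := fun z => 2 / ε * (u z + C * m z + ε / 2 * ‖m z‖ ^ q))
    (((hu.add (hm.const_mul _)).add (hmq'.const_mul _)).const_mul _)
    (hw.1.norm.aemeasurable.pow_const s).aestronglyMeasurable ?_
  filter_upwards [hm0, hue] with z hz he
  rw [Real.norm_of_nonneg (by positivity), Real.norm_of_nonneg hz]
  -- test the energy density with a multiple of `-|w|^{s-2} w`
  set b : Vec d := -(ε * ‖w z‖ ^ (s - 1)) • (‖w z‖⁻¹ • w z) with hb
  have hbn : ‖b‖ ≤ ε * ‖w z‖ ^ (s - 1) := by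
    rw [hb, norm_smul, norm_neg, norm_smul, norm_inv, norm_norm, Real.norm_of_nonneg (by positivity)]
    exact mul_le_of_le_one_right (by positivity) (inv_mul_le_one (a := ‖w z‖))
  have hbw : inner ℝ (w z) b = -(ε * ‖w z‖ ^ s) := by
    rw [hb, inner_smul_right, inner_smul_right, real_inner_self_eq_norm_sq]
    have h1 : ‖w z‖ ^ s = ‖w z‖ ^ (s - 1) * ‖w z‖ := by
      rw [← Real.rpow_add_one' (norm_nonneg _) (by linarith)]; simp
    rw [h1]
    rcases eq_or_ne ‖w z‖ 0 with h0 | h0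
    · simp [h0]
    · field_simp
  have hbr : C / r * ‖b‖ ^ r ≤ ε / 2 * ‖w z‖ ^ ((s - 1) * r) := by
    rw [← hεr, mul_assoc, Real.rpow_mul (norm_nonneg _), ← Real.mul_rpow hε0.le (by positivity)]
    gcongr
  have hyoung : m z * ‖w z‖ ^ ((s - 1) * r) ≤ m z ^ q + ‖w z‖ ^ s := by
    have hpq := Real.HolderConjugate.conjExponent hq
    have := Real.young_inequality_of_nonneg hz
      (show 0 ≤ ‖w z‖ ^ ((s - 1) * r) by positivity) hpq
    rw [← Real.rpow_mul (norm_nonneg _), hsr] at this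
    have d1 := div_le_self (show 0 ≤ m z ^ q by positivity) hpq.lt.le
    have d2 := div_le_self (show 0 ≤ ‖w z‖ ^ s by positivity) hpq.symm.lt.le
    linarith
  have h1 := primR_sub_le_energy hf hH hz he b
  have h2 := hf.primR_nonneg z.2 hz
  have h3 := mul_le_mul_of_nonneg_left ((hC z.2 b).2.trans (add_le_add_left hbr C)) hz
  have h4 := mul_le_mul_of_nonneg_left hyoung (show 0 ≤ ε / 2 by positivity)
  rw [hbw] at h1
  rw [div_mul_eq_mul_div, le_div_iff₀ hε0]
  linarith

end Minimizers

end MeanField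

end

theorem lemma2p1 {d : ℕ} {T q r : ℝ} (hT : 0 < T)
    (f : MeanField.Torus d → ℝ → ℝ) (H : MeanField.Torus d → MeanField.Vec d → ℝ)
    (m₀ φT : MeanField.Torus d → ℝ)
    (hf : MeanField.CouplingCondition f q)
    (hH : MeanField.HamiltonianCondition H r)
    (hHx : MeanField.HamiltonianSpaceRegularity H r)
    (hdata : MeanField.DataCondition m₀ φT) :
    ∃ (β : ℝ) (m : ℝ × MeanField.Torus d → ℝ) (w : ℝ × MeanField.Torus d → MeanField.Vec d),
      -- the pair is admissible, and the minimum of `B` is attained there, with finite value `β`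
      MeanField.K1 T m₀ m w ∧
      MeanField.B T f H φT m w = (β : EReal) ∧
      (∀ m' w', MeanField.K1 T m₀ m' w' → (β : EReal) ≤ MeanField.B T f H φT m' w') ∧
      -- duality
      (⨅ φ ∈ MeanField.K0 T φT, MeanField.A T f H m₀ φ) = ((-β : ℝ) : EReal) ∧
      -- uniqueness of the minimizer, up to null sets
      (∀ m' w', MeanField.K1 T m₀ m' w' → MeanField.B T f H φT m' w' = (β : EReal) →
        m' =ᵐ[MeanField.cyl d T] m ∧ w' =ᵐ[MeanField.cyl d T] w) ∧
      -- integrability of the minimizer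
      MemLp m (ENNReal.ofReal q) (MeanField.cyl d T) ∧
      MemLp w (ENNReal.ofReal (r.conjExponent * q / (r.conjExponent + q - 1)))
        (MeanField.cyl d T) := by
  obtain ⟨α, hα⟩ := MeanField.exists_iInf_A_eq hT hf hH hdata
  obtain ⟨m, w, β, hK, hB, hβ⟩ := MeanField.exists_K1_B_le hT hf hH hdata (α := α) fun φ hφ => by
    rw [← hα]
    exact iInf₂_le φ hφ
  have hmin : ∀ m' w', MeanField.K1 T m₀ m' w' →
      ((-α : ℝ) : EReal) ≤ MeanField.B T f H φT m' w' := fun m' w' h => by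
    rw [EReal.coe_neg, EReal.neg_le, ← hα]
    refine le_iInf₂ fun φ hφ => ?_
    rw [EReal.neg_le]
    exact MeanField.neg_A_le_B hT hf hH hdata h hφ
  obtain rfl : β = -α := hβ.antisymm (by
    have := hmin m w hK
    rwa [hB, EReal.coe_le_coe_iff] at this)
  obtain ⟨g, hg, hgr⟩ := MeanField.exists_continuous_gradient hdata.terminal_contDiff
  obtain ⟨u, hu, hue, -⟩ := hK.exists_energy_of_B_eq hT hf hH hdata hg hgr hB
  have hmq := MeanField.memLp_density hf hH hK.integrable_density hK.nonneg hu hue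
  exact ⟨-α, m, w, hK, hB, hmin, by rw [hα, neg_neg],
    fun m' w' h' hB' => hK.eq_of_isMin hT hf hH hdata h' hB hB' hmin, hmq,
    MeanField.memLp_flux hf hH hK.integrable_density hK.nonneg hmq hK.integrable_flux hu hue⟩
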